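/- **Conventions.** All vector spaces are over $\mathbb K=\mathbb R$ or $\mathbb C$. There are two contexts, *plain* and *tame*. A *rescaling* is a strictly increasing sequence $\mathbf k=(k_j)_{j\ge 0}$ in $\mathbb N_0$; in the tame context one requires in addition $k_j\le j+r$ for all $j$ and some constant $r$. An *sc-chain* $\mathbb E$ consists of Banach spaces $E_k$ ($k\ge 0$) and injective compact linear maps $E_{k+1}\to E_k$ of norm $\le 1$ with dense image; these maps are treated as inclusions. $E_\infty=\varprojlim E_k$ is its Fréchet limit, $\mathbb E^{\mathbf k}=(E_{k_j})_j$ its rescaling, $\mathbb E\oplus\mathbb F=(E_k\oplus F_k)_k$. An *operator* $\mathbb E\to\mathbb F$ is a family of continuous linear maps $E_k\to F_k$ compatible with the inclusions; it is an *embedding* if each of these is injective; it is *strongly smoothing* if for every rescaling $\mathbf m$ it factors as $\mathbb E\to\mathbb F^{\mathbf m}\to\mathbb F$. A map $E_\infty\to F_\infty$ is a *weak morphism* (*weak embedding*, *strongly smoothing*) if for some rescalings $\mathbf k,\mathbf l$ it is induced by an operator (embedding, strongly smoothing operator) $\mathbb E^{\mathbf k}\to\mathbb F^{\mathbf l}$.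 An *sc-structure* on a topological vector space $E$ is an sc-chain $\mathbb E$ with an isomorphism $E_\infty\cong E$. Two sc-structures on $E$ are *equivalent* if the identity is a weak embedding in both directions. An *$\overline{\mathrm{sc}}$-Fréchet space* (in the tame context: *pre-tame $\overline{\mathrm{sc}}$-Fréchet space*) is a topological vector space with an equivalence class of sc-structures, called *compatible*. Direct sums carry the class of $\mathbb E\oplus\mathbb F$. *Morphisms* (*strongly smoothing morphisms*) are the continuous linear maps that are weak morphisms (strongly smoothing) with respect to some compatible sc-structures. A morphism $T:E\to F$ is *Fredholm* if there are a morphism $T':F\to E$ and strongly smoothing morphisms $K,K'$ with $T'T=\mathrm{id}+K$, $TT'=\mathrm{id}+K'$. An *sc-subspace* is a closed subspace $X\subseteq E$ such that, for some compatible sc-structure, there are closed subspaces $E'_k\subseteq E_k$ which form an sc-chain with the restricted norms and inclusions and satisfy $E'_\infty=X$; it carries the resulting class of sc-structures. A *splitting* $E=X\oplus Y$ consists of sc-subspaces $X,Y$ such that $X\oplus Y\to E$, $(x,y)\mapsto x+y$, is an isomorphism of (pre-tame) $\overline{\mathrm{sc}}$-Fréchet spaces. An *envelope* of a map $f:A\to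 F_\infty$, $A\subseteq E_\infty$, consists of open sets $A_k\subseteq E_k$ with $A_{k+1}\subseteq A_k$ and $A=\bigcap_k A_k$, and continuous maps $f_k:A_k\to F_k$ compatible with each other and with $f$; it is *tame* if for every $k$ there is $C_k$ with $\|f_k(x)\|_k\le C_k(1+\|x\|_k)$ on $A_k$. A map $f:U\to F$ on an open set $U \subseteq E$ is *$\overline{\mathrm{sc}}^0$* if every point of $U$ has a neighbourhood $V\subseteq U$ on which $f$ has, for some compatible sc-structures, an envelope (in the tame context: a tame envelope). A *family of morphisms* $\varphi:U\times E^1\to E^2$ is an $\overline{\mathrm{sc}}^0$ map that is linear in the second variable; write $\varphi(x)=\varphi(x,\cdot)$. It is *invertible* if there is a family of morphisms $\psi:U\times E^2\to E^1$ with $\psi(x)=\varphi(x)^{-1}$ for all $x\in U$. A family $\kappa:U\times E^1\to E^2$ is *strongly smoothing* if every point of $U$ has a neighbourhood $V\subseteq U$ such that, for some compatible sc-structures, $\kappa|_{V\times E^1}$ has an envelope $(\kappa_j:U_j\times E^1_j\to E^2_j)_j$ with the following property: for every rescaling $\mathbf k$ it also has an envelope $(\kappa_{\mathbf k,j}:U_{k_j}\times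 E^1_j\to E^2_{k_j})_j$ with $\kappa_j(x,u)=\kappa_{\mathbf k,j}(x,u)$ for $x\in U_{k_j}$, $u\in E^1_j$. In the tame context all these envelopes are moreover required to satisfy tame estimates for $u$ in bounded subsets of $E^1_0$: for all $j$ and $R$ there is $C$ such that the norm of the value at $(x,u)$ is at most $C(1+\|x\|+\|u\|)$ whenever $\|u\|_0\le R$ (with the norms of the $j$-th levels of the chains involved). **Theorem.** Let $E,E^1,E^2$ be $\overline{\mathrm{sc}}$-Fréchet spaces, $U\subseteq E$ open and $\varphi:U\times E^1\to E^2$ a family of morphisms. The following are equivalent. 1. $\varphi$ is Fredholm: every $x_0\in U$ has an open neighbourhood $V\subseteq U$ with families of morphisms $\psi:V\times E^2\to E^1$, $\kappa:V\times E^1\to E^1$, $\kappa':V\times E^2\to E^2$, where $\kappa,\kappa'$ are strongly smoothing, such that $\psi(x)\varphi(x)=\mathrm{id}+\kappa(x)$ and $\varphi(x)\psi(x)=\mathrm{id}+\kappa'(x)$ for all $x\in V$. 2. For every $x_0\in U$, $\varphi(x_0):E^1\to E^2$ is a Fredholm morphism, and there exists a pair of splittings $E^1=X\oplus\ker\varphi(x_0)$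 and $E^2=\operatorname{im}\varphi(x_0)\oplus C$ for which there is an open neighbourhood $V\subseteq U$ of $x_0$ such that the family $V\times X\to\operatorname{im}\varphi(x_0)$, $(x,u)\mapsto \mathrm{pr}_{\operatorname{im}\varphi(x_0)}\varphi(x)u$, is invertible. 3. For every $x_0\in U$, $\varphi(x_0):E^1\to E^2$ is a Fredholm morphism, and for every such pair of splittings there is an open neighbourhood $V\subseteq U$ of $x_0$ such that this family is invertible over $V$. The same equivalence holds in the tame context, i.e. for pre-tame $\overline{\mathrm{sc}}$-Fréchet spaces with all rescalings, morphisms and maps tame. -/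

import Mathlib

open Set Filter Topology

universe w u v u₁ u₂

/-- The two settings: `plain` (all rescalings are allowed) and `tame` (every rescaling, morphism,
equivalence and map is required to be tame). -/
inductive ScContext
  | plain
  | tame

/-- Strictly increasing sequences of natural numbers; in the tame setting they are moreover tame,
i.e. `k j ≤ j + r` for some constant `r`. -/
structure ScContext.IsRescaling (c : ScContext) (k : ℕ → ℕ) : Prop where
  strictMono : StrictMono k
  tame : c = ScContext.tame → ∃ r : ℕ, ∀ j, k j ≤ j + r

/-! ### sc-chains of Banach spaces -/

/-- An sc-chain: Banach spaces `E₀ ← E₁ ← E₂ ← ⋯` with injective compact linear maps of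
norm at most one and with dense image. -/
structure ScChain (𝕜 : Type w) [RCLike 𝕜] where
  space : ℕ → Type u
  [normed : ∀ k, NormedAddCommGroup (space k)]
  [normedSpace : ∀ k, NormedSpace 𝕜 (space k)]
  [complete : ∀ k, CompleteSpace (space k)]
  ι : ∀ k, space (k + 1) →L[𝕜] space k
  ι_injective : ∀ k, Function.Injective (ι k)
  ι_denseRange : ∀ k, DenseRange (ι k)
  ι_norm_le : ∀ k, ‖ι k‖ ≤ 1
  ι_compact : ∀ k, IsCompactOperator (ι k)

attribute [instance] ScChain.normed ScChain.normedSpace ScChain.complete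

namespace ScChain

variable {𝕜 : Type w} [RCLike 𝕜]

/-- The inclusion `E_l → E_k` for `k ≤ l`. -/
noncomputable def incl (E : ScChain.{w, u} 𝕜) {k l : ℕ} (h : k ≤ l) :
    E.space l →L[𝕜] E.space k :=
  Nat.leRec (motive := fun l _ => E.space l →L[𝕜] E.space k)
    (ContinuousLinearMap.id 𝕜 (E.space k)) (fun l _ f => f.comp (E.ι l)) h

/-- The Fréchet space `E_∞`, realised as the inverse limit of the `E_k`. Its elements are the
compatible sequences, and its topology is the weakest one for which all the maps to the
`E_k` are continuous. -/
def limit (E : ScChain.{w, u} 𝕜) : Submodule 𝕜 (∀ k, E.space k) where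
  carrier := {x | ∀ k, E.ι k (x (k + 1)) = x k}
  add_mem' := fun {x y} hx hy k => by
    simp only [Set.mem_ofPred_eq] at hx hy
    simp [hx k, hy k]
  zero_mem' := fun k => by simp
  smul_mem' := fun a x hx k => by
    simp only [Set.mem_ofPred_eq] at hx
    simp [hx k]

theorem incl_self (E : ScChain.{w, u} 𝕜) (k : ℕ) (h : k ≤ k) :
    E.incl h = ContinuousLinearMap.id 𝕜 (E.space k) := by
  simp [incl, Nat.leRec_self]

theorem incl_succ (E : ScChain.{w, u} 𝕜) {k l : ℕ} (h : k ≤ l) (h' : k ≤ l + 1) :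
    E.incl h' = (E.incl h).comp (E.ι l) := by
  unfold incl
  rw [Nat.leRec_succ _ _ h]

theorem incl_trans (E : ScChain.{w, u} 𝕜) {k l m : ℕ} (h : k ≤ l) (h' : l ≤ m)
    (x : E.space m) : E.incl h (E.incl h' x) = E.incl (h.trans h') x := by
  induction m, h' using Nat.le_induction with
  | base => simp [incl_self]
  | succ m h' ih =>
    rw [E.incl_succ h', E.incl_succ (h.trans h')]
    exact ih _

theorem incl_limit (E : ScChain.{w, u} 𝕜) {k l : ℕ} (h : k ≤ l) (x : E.limit) :
    E.incl h (x.1 l) = x.1 k := by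
  induction l, h using Nat.le_induction with
  | base => simp [incl_self]
  | succ l h ih =>
    rw [E.incl_succ h, ContinuousLinearMap.comp_apply, x.2 l]
    exact ih

theorem incl_injective (E : ScChain.{w, u} 𝕜) {k l : ℕ} (h : k ≤ l) :
    Function.Injective (E.incl h) := by
  induction l, h using Nat.le_induction with
  | base => rw [incl_self]; exact fun x y h => h
  | succ l h ih =>
    rw [E.incl_succ h]
    exact ih.comp (E.ι_injective l)

theorem incl_denseRange (E : ScChain.{w, u} 𝕜) {k l : ℕ} (h : k ≤ l) :
    DenseRange (E.incl h) := by
  induction l, h using Nat.le_induction with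
  | base => rw [incl_self]; exact Function.surjective_id.denseRange
  | succ l h ih =>
    rw [E.incl_succ h]
    exact ih.comp (E.ι_denseRange l) (E.incl h).continuous

theorem incl_norm_le (E : ScChain.{w, u} 𝕜) {k l : ℕ} (h : k ≤ l) : ‖E.incl h‖ ≤ 1 := by
  induction l, h using Nat.le_induction with
  | base => rw [incl_self]; exact ContinuousLinearMap.norm_id_le
  | succ l h ih =>
    rw [E.incl_succ h]
    refine (ContinuousLinearMap.opNorm_comp_le _ _).trans ?_
    exact mul_le_one₀ ih (norm_nonneg _) (E.ι_norm_le l)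

theorem incl_compact (E : ScChain.{w, u} 𝕜) {k l : ℕ} (h : k < l) :
    IsCompactOperator (E.incl h.le) := by
  obtain ⟨m, rfl⟩ : ∃ m, l = m + 1 := ⟨l - 1, by omega⟩
  rw [E.incl_succ (Nat.lt_succ_iff.mp h)]
  exact (E.ι_compact m).clm_comp _

/-- The rescaling `E^k = (E_{k_j})_j` of an sc-chain. -/
@[reducible] noncomputable def rescale (E : ScChain.{w, u} 𝕜) (k : ℕ → ℕ) (hk : StrictMono k) :
    ScChain.{w, u} 𝕜 where
  space j := E.space (k j)
  normed j := E.normed (k j)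
  normedSpace j := E.normedSpace (k j)
  complete j := E.complete (k j)
  ι j := E.incl (hk (Nat.lt_succ_self j)).le
  ι_injective _ := E.incl_injective _
  ι_denseRange _ := E.incl_denseRange _
  ι_norm_le _ := E.incl_norm_le _
  ι_compact j := E.incl_compact (hk (Nat.lt_succ_self j))

theorem rescale_incl (E : ScChain.{w, u} 𝕜) (k : ℕ → ℕ) (hk : StrictMono k) {i j : ℕ}
    (h : i ≤ j) : (E.rescale k hk).incl h = E.incl (hk.monotone h) := by
  induction j, h using Nat.le_induction with
  | base => rw [incl_self, incl_self]
  | succ j h ih =>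
    rw [(E.rescale k hk).incl_succ h, ih]
    ext x
    exact E.incl_trans _ _ x

/-- The identification `E_∞ = (E^k)_∞`. -/
noncomputable def rescaleLimit (E : ScChain.{w, u} 𝕜) (k : ℕ → ℕ) (hk : StrictMono k) :
    E.limit ≃L[𝕜] (E.rescale k hk).limit where
  toFun x := ⟨fun j => x.1 (k j), fun _ => E.incl_limit _ x⟩
  invFun y := ⟨fun j => E.incl (hk.le_apply (x := j)) (y.1 j), fun j => by
    have h := y.2 j
    have h1 : E.ι j = E.incl (Nat.le_succ j) := by
      rw [E.incl_succ le_rfl, incl_self]; rfl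
    rw [h1, E.incl_trans]
    refine Eq.trans ?_ (congrArg (E.incl (hk.le_apply (x := j))) h)
    exact (E.incl_trans _ _ _).symm⟩
  left_inv x := by
    ext j
    exact E.incl_limit _ x
  right_inv y := by
    ext j
    change E.incl _ (y.1 (k j)) = y.1 j
    have h := (E.rescale k hk).incl_limit (hk.le_apply (x := j)) y
    rw [rescale_incl] at h
    exact h
  map_add' _ _ := rfl
  map_smul' _ _ := rfl
  continuous_toFun := by
    refine Continuous.subtype_mk (continuous_pi fun j => ?_) _
    exact (continuous_apply (k j)).comp continuous_subtype_val
  continuous_invFun := by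
    refine Continuous.subtype_mk (continuous_pi fun j => ?_) _
    exact (E.incl (hk.le_apply (x := j))).continuous.comp
      ((continuous_apply j).comp continuous_subtype_val)

/-- The direct sum of two sc-chains (levelwise with the maximum norm, which is equivalent to the
sum of the norms). -/
@[reducible] noncomputable def prod (E : ScChain.{w, u} 𝕜) (F : ScChain.{w, v} 𝕜) :
    ScChain.{w, max u v} 𝕜 where
  space k := E.space k × F.space k
  ι k := (E.ι k).prodMap (F.ι k)
  ι_injective k := (E.ι_injective k).prodMap (F.ι_injective k)
  ι_denseRange k := (E.ι_denseRange k).prodMap (F.ι_denseRange k)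
  ι_norm_le k := by
    refine ContinuousLinearMap.opNorm_le_bound _ zero_le_one fun x => ?_
    rw [one_mul]
    refine max_le_max ?_ ?_
    · simpa using (E.ι k).le_of_opNorm_le (E.ι_norm_le k) x.1
    · simpa using (F.ι k).le_of_opNorm_le (F.ι_norm_le k) x.2
  ι_compact k := by
    obtain ⟨K, hK, hK'⟩ := E.ι_compact k
    obtain ⟨L, hL, hL'⟩ := F.ι_compact k
    exact ⟨K ×ˢ L, hK.prod hL, prod_mem_nhds hK' hL'⟩

/-- The identification `(E ⊕ F)_∞ = E_∞ × F_∞`. -/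
noncomputable def prodLimit (E : ScChain.{w, u} 𝕜) (F : ScChain.{w, v} 𝕜) :
    (E.prod F).limit ≃L[𝕜] E.limit × F.limit where
  toFun x := (⟨fun k => (x.1 k).1, fun k => congrArg Prod.fst (x.2 k)⟩,
    ⟨fun k => (x.1 k).2, fun k => congrArg Prod.snd (x.2 k)⟩)
  invFun y := ⟨fun k => (y.1.1 k, y.2.1 k), fun k => Prod.ext (y.1.2 k) (y.2.2 k)⟩
  left_inv _ := rfl
  right_inv _ := rfl
  map_add' _ _ := rfl
  map_smul' _ _ := rfl
  continuous_toFun := by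
    refine Continuous.prodMk ?_ ?_
    · refine Continuous.subtype_mk (continuous_pi fun j => ?_) _
      exact continuous_fst.comp ((continuous_apply j).comp continuous_subtype_val)
    · refine Continuous.subtype_mk (continuous_pi fun j => ?_) _
      exact continuous_snd.comp ((continuous_apply j).comp continuous_subtype_val)
  continuous_invFun := by
    refine Continuous.subtype_mk (continuous_pi fun j => ?_) _
    exact Continuous.prodMk
      ((continuous_apply j).comp (continuous_subtype_val.comp continuous_fst))
      ((continuous_apply j).comp (continuous_subtype_val.comp continuous_snd))

/-! ### Operators between sc-chains and weak morphisms -/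

/-- A continuous linear operator between sc-chains. -/
structure Hom (E : ScChain.{w, u} 𝕜) (F : ScChain.{w, v} 𝕜) where
  map : ∀ k, E.space k →L[𝕜] F.space k
  comm : ∀ k, (map k).comp (E.ι k) = (F.ι k).comp (map (k + 1))

/-- An embedding of sc-chains is a levelwise injective operator. -/
def Hom.IsEmbedding {E : ScChain.{w, u} 𝕜} {F : ScChain.{w, v} 𝕜} (T : Hom E F) : Prop :=
  ∀ k, Function.Injective (T.map k)

/-- `T : E^k → F^l` extends `f : E_∞ → F_∞`. -/
def Hom.Extends {E : ScChain.{w, u} 𝕜} {F : ScChain.{w, v} 𝕜} {k l : ℕ → ℕ}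
    {hk : StrictMono k} {hl : StrictMono l} (T : Hom (E.rescale k hk) (F.rescale l hl))
    (f : E.limit → F.limit) : Prop :=
  ∀ (x : E.limit) (j : ℕ), T.map j (x.1 (k j)) = (f x).1 (l j)

/-- `K : E → F` is strongly smoothing: for every rescaling `m`, it factors as
`E → F^m → F`. -/
def Hom.IsStronglySmoothing (c : ScContext) {E : ScChain.{w, u} 𝕜} {F : ScChain.{w, v} 𝕜}
    (K : Hom E F) : Prop :=
  ∀ (m : ℕ → ℕ) (hm : c.IsRescaling m), ∃ L : Hom E (F.rescale m hm.strictMono),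
    ∀ (j : ℕ) (x : E.space j), K.map j x = F.incl (hm.strictMono.le_apply (x := j)) (L.map j x)

/-- (Tame) weak morphisms `E_∞ → F_∞`. -/
def IsWeakMorphism (c : ScContext) {E : ScChain.{w, u} 𝕜} {F : ScChain.{w, v} 𝕜}
    (f : E.limit → F.limit) : Prop :=
  ∃ (k l : ℕ → ℕ) (hk : c.IsRescaling k) (hl : c.IsRescaling l)
    (T : Hom (E.rescale k hk.strictMono) (F.rescale l hl.strictMono)), T.Extends f

/-- (Tame) weak embeddings `E_∞ → F_∞`. -/
def IsWeakEmbedding (c : ScContext) {E : ScChain.{w, u} 𝕜} {F : ScChain.{w, v} 𝕜}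
    (f : E.limit → F.limit) : Prop :=
  ∃ (k l : ℕ → ℕ) (hk : c.IsRescaling k) (hl : c.IsRescaling l)
    (T : Hom (E.rescale k hk.strictMono) (F.rescale l hl.strictMono)),
    T.Extends f ∧ T.IsEmbedding

/-- (Tame) strongly smoothing weak morphisms `E_∞ → F_∞`. -/
def IsStronglySmoothingWeak (c : ScContext) {E : ScChain.{w, u} 𝕜} {F : ScChain.{w, v} 𝕜}
    (f : E.limit → F.limit) : Prop :=
  ∃ (k l : ℕ → ℕ) (hk : c.IsRescaling k) (hl : c.IsRescaling l)
    (T : Hom (E.rescale k hk.strictMono) (F.rescale l hl.strictMono)),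
    T.Extends f ∧ T.IsStronglySmoothing c

/-! ### Subchains -/

/-- A subchain: closed subspaces `E'_k ⊆ E_k` which form an sc-chain with the restricted norms
and inclusions. -/
structure Subchain (E : ScChain.{w, u} 𝕜) where
  sub : ∀ k, Submodule 𝕜 (E.space k)
  isClosed : ∀ k, IsClosed (sub k : Set (E.space k))
  mapsTo : ∀ k, ∀ x ∈ sub (k + 1), E.ι k x ∈ sub k
  dense : ∀ k, (sub k : Set (E.space k)) ⊆ closure (E.ι k '' (sub (k + 1) : Set _))

/-- A subchain, regarded as an sc-chain. -/
@[reducible] noncomputable def Subchain.toChain {E : ScChain.{w, u} 𝕜} (S : E.Subchain) :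
    ScChain.{w, u} 𝕜 where
  space k := S.sub k
  complete k := (S.isClosed k).completeSpace_coe
  ι k := ((E.ι k).comp (S.sub (k + 1)).subtypeL).codRestrict (S.sub k)
    fun x => S.mapsTo k x.1 x.2
  ι_injective k := fun x y h => Subtype.ext (E.ι_injective k (congrArg Subtype.val h))
  ι_denseRange k := by
    intro x
    rw [closure_subtype]
    refine closure_mono ?_ (S.dense k x.2)
    rintro _ ⟨y, hy, rfl⟩
    exact ⟨_, ⟨⟨y, hy⟩, rfl⟩, rfl⟩
  ι_norm_le k := by
    refine ContinuousLinearMap.opNorm_le_bound _ zero_le_one fun x => ?_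
    exact (E.ι k).le_of_opNorm_le (E.ι_norm_le k) x.1
  ι_compact k := by
    have h : IsCompactOperator ((E.ι k).comp (S.sub (k + 1)).subtypeL) :=
      (E.ι_compact k).comp_clm _
    exact h.codRestrict (fun x => S.mapsTo k x.1 x.2) (S.isClosed k)

/-! ### Envelopes -/

/-- An envelope of a subset `A ⊆ E_∞`. -/
structure SetEnvelope (E : ScChain.{w, u} 𝕜) (A : Set E.limit) where
  dom : ∀ k, Set (E.space k)
  isOpen : ∀ k, IsOpen (dom k)
  mapsTo : ∀ k, ∀ x ∈ dom (k + 1), E.ι k x ∈ dom k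
  mem_iff : ∀ x : E.limit, x ∈ A ↔ ∀ k, x.1 k ∈ dom k

/-- A continuous envelope of a map `f : A → F_∞`, where `A ⊆ E_∞`. -/
structure MapEnvelope (E : ScChain.{w, u} 𝕜) (F : ScChain.{w, v} 𝕜) (A : Set E.limit)
    (f : E.limit → F.limit) extends SetEnvelope E A where
  map : ∀ k, E.space k → F.space k
  continuousOn : ∀ k, ContinuousOn (map k) (dom k)
  map_limit : ∀ x ∈ A, ∀ k, map k (x.1 k) = (f x).1 k
  comm : ∀ k, ∀ x ∈ dom (k + 1), map k (E.ι k x) = F.ι k (map (k + 1) x)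

/-- A tame envelope: each `f_k` satisfies `‖f_k(x)‖ ≤ C_k (1 + ‖x‖)` on its domain. -/
def MapEnvelope.IsTame {E : ScChain.{w, u} 𝕜} {F : ScChain.{w, v} 𝕜} {A : Set E.limit}
    {f : E.limit → F.limit} (𝓕 : MapEnvelope E F A f) : Prop :=
  ∀ k, ∃ C : ℝ, ∀ x ∈ 𝓕.dom k, ‖𝓕.map k x‖ ≤ C * (1 + ‖x‖)

/-- Tameness of an envelope over `𝒰 ⊕ 𝔼¹`, where the second variable `u` is unrestricted: the tame
estimates hold as long as `u` stays in a bounded subset of `E¹_0`. -/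
def MapEnvelope.IsTameOnBounded {E : ScChain.{w, u} 𝕜} {E₁ : ScChain.{w, u₁} 𝕜}
    {F : ScChain.{w, v} 𝕜} {A : Set (E.prod E₁).limit} {f : (E.prod E₁).limit → F.limit}
    (𝓕 : MapEnvelope (E.prod E₁) F A f) : Prop :=
  ∀ (k : ℕ) (R : ℝ), ∃ C : ℝ, ∀ (x : E.space k) (u : E₁.space k), (x, u) ∈ 𝓕.dom k →
    ‖E₁.incl (Nat.zero_le k) u‖ ≤ R → ‖𝓕.map k (x, u)‖ ≤ C * (1 + ‖x‖ + ‖u‖)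

end ScChain

/-! ### sc-structures on topological vector spaces -/

/-- An sc-structure on a topological vector space `E`: an sc-chain `𝔼` together with an isomorphism
`E_∞ ≃ E` of topological vector spaces. -/
structure ScStructure (𝕜 : Type w) [RCLike 𝕜] (E : Type u) [AddCommGroup E] [Module 𝕜 E]
    [TopologicalSpace E] where
  chain : ScChain.{w, u} 𝕜
  equiv : chain.limit ≃L[𝕜] E

section

variable {𝕜 : Type w} [RCLike 𝕜]
variable {E : Type u} [AddCommGroup E] [Module 𝕜 E] [TopologicalSpace E]
variable {F : Type v} [AddCommGroup F] [Module 𝕜 F] [TopologicalSpace F]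
variable {E₁ : Type u₁} [AddCommGroup E₁] [Module 𝕜 E₁] [TopologicalSpace E₁]
variable {E₂ : Type u₂} [AddCommGroup E₂] [Module 𝕜 E₂] [TopologicalSpace E₂]

namespace ScStructure

/-- The map `E_∞ → F_∞` corresponding to a map `E → F`. -/
def conj (s : ScStructure 𝕜 E) (t : ScStructure 𝕜 F) (f : E → F) :
    s.chain.limit → t.chain.limit :=
  fun x => t.equiv.symm (f (s.equiv x))

/-- (Tame) equivalence of two sc-structures on the same space. -/
def Equivalent (c : ScContext) (s t : ScStructure 𝕜 E) : Prop :=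
  ScChain.IsWeakEmbedding c (s.conj t id) ∧ ScChain.IsWeakEmbedding c (t.conj s id)

/-- The rescaling of an sc-structure. -/
@[reducible] noncomputable def rescale (s : ScStructure 𝕜 E) (k : ℕ → ℕ) (hk : StrictMono k) :
    ScStructure 𝕜 E where
  chain := s.chain.rescale k hk
  equiv := (s.chain.rescaleLimit k hk).symm.trans s.equiv

/-- The direct sum of two sc-structures. -/
@[reducible] noncomputable def prod (s : ScStructure 𝕜 E) (t : ScStructure 𝕜 F) :
    ScStructure 𝕜 (E × F) where
  chain := s.chain.prod t.chain
  equiv := (s.chain.prodLimit t.chain).trans (s.equiv.prodCongr t.equiv)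

/-- The subchain `S` of `𝔼` realises the subspace `X` of `E ≅ E_∞`. -/
def Realizes (s : ScStructure 𝕜 E) (S : s.chain.Subchain) (X : Submodule 𝕜 E) : Prop :=
  ∀ x : s.chain.limit, s.equiv x ∈ X ↔ ∀ k, x.1 k ∈ S.sub k

/-- The sc-structure on a subspace `X` given by a subchain that realises it. -/
noncomputable def restrict (s : ScStructure 𝕜 E) (S : s.chain.Subchain) (X : Submodule 𝕜 E)
    (h : s.Realizes S X) : ScStructure 𝕜 X where
  chain := S.toChain
  equiv :=
    { toFun := fun y => ⟨s.equiv ⟨fun k => (y.1 k).1, fun k => congrArg Subtype.val (y.2 k)⟩,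
        (h _).2 fun k => (y.1 k).2⟩
      invFun := fun x => ⟨fun k => ⟨(s.equiv.symm x.1).1 k,
        (h (s.equiv.symm x.1)).1 (by simp) k⟩,
        fun k => Subtype.ext ((s.equiv.symm x.1).2 k)⟩
      left_inv := fun y => by
        ext k
        simp
      right_inv := fun x => Subtype.ext (s.equiv.apply_symm_apply x.1)
      map_add' := fun x y => Subtype.ext (s.equiv.map_add
        ⟨fun k => (x.1 k).1, fun k => congrArg Subtype.val (x.2 k)⟩
        ⟨fun k => (y.1 k).1, fun k => congrArg Subtype.val (y.2 k)⟩)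
      map_smul' := fun a x => Subtype.ext (s.equiv.map_smul a
        ⟨fun k => (x.1 k).1, fun k => congrArg Subtype.val (x.2 k)⟩)
      continuous_toFun := by
        refine Continuous.subtype_mk (s.equiv.continuous.comp ?_) _
        refine Continuous.subtype_mk (continuous_pi fun k => ?_) _
        exact continuous_subtype_val.comp ((continuous_apply k).comp continuous_subtype_val)
      continuous_invFun := by
        refine Continuous.subtype_mk (continuous_pi fun k => ?_) _
        refine Continuous.subtype_mk ?_ _
        exact (continuous_apply k).comp (continuous_subtype_val.comp
          (s.equiv.symm.continuous.comp continuous_subtype_val)) }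

end ScStructure

/-! ### (Pre-tame) sc-Fréchet spaces -/

/-- A (pre-tame) sc-Fréchet space is a topological vector space with a (tame) equivalence class `𝒮`
of sc-structures; the members of `𝒮` are the (tamely) compatible sc-structures. -/
structure IsScClass (c : ScContext) (𝒮 : Set (ScStructure 𝕜 E)) : Prop where
  nonempty : 𝒮.Nonempty
  mem_iff : ∀ s ∈ 𝒮, ∀ t, t ∈ 𝒮 ↔ s.Equivalent c t

/-- The class of sc-structures of the direct sum of two sc-Fréchet spaces. -/
def prodClass (c : ScContext) (𝒮 : Set (ScStructure 𝕜 E)) (𝒯 : Set (ScStructure 𝕜 F)) :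
    Set (ScStructure 𝕜 (E × F)) :=
  {r | ∃ s ∈ 𝒮, ∃ t ∈ 𝒯, (s.prod t).Equivalent c r}

/-- sc-subspaces of an sc-Fréchet space. -/
def IsScSubspace (𝒮 : Set (ScStructure 𝕜 E)) (X : Submodule 𝕜 E) : Prop :=
  IsClosed (X : Set E) ∧ ∃ s ∈ 𝒮, ∃ S : s.chain.Subchain, s.Realizes S X

/-- The class of sc-structures of an sc-subspace. -/
def subClass (c : ScContext) (𝒮 : Set (ScStructure 𝕜 E)) (X : Submodule 𝕜 E) :
    Set (ScStructure 𝕜 X) :=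
  {r | ∃ s ∈ 𝒮, ∃ (S : s.chain.Subchain) (h : s.Realizes S X), (s.restrict S X h).Equivalent c r}

/-- (Tame) morphisms of sc-Fréchet spaces. -/
def IsScMorphism (c : ScContext) (𝒮 : Set (ScStructure 𝕜 E)) (𝒯 : Set (ScStructure 𝕜 F))
    (T : E →ₗ[𝕜] F) : Prop :=
  Continuous T ∧ ∃ s ∈ 𝒮, ∃ t ∈ 𝒯, ScChain.IsWeakMorphism c (s.conj t T)

/-- (Tame) strongly smoothing morphisms of sc-Fréchet spaces. -/
def IsStronglySmoothingMorphism (c : ScContext) (𝒮 : Set (ScStructure 𝕜 E))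
    (𝒯 : Set (ScStructure 𝕜 F)) (K : E →ₗ[𝕜] F) : Prop :=
  IsScMorphism c 𝒮 𝒯 K ∧ ∃ s ∈ 𝒮, ∃ t ∈ 𝒯, ScChain.IsStronglySmoothingWeak c (s.conj t K)

/-- (Tame) Fredholm morphisms: morphisms that are invertible modulo strongly smoothing ones. -/
def IsFredholmMorphism (c : ScContext) (𝒮 : Set (ScStructure 𝕜 E)) (𝒯 : Set (ScStructure 𝕜 F))
    (T : E →ₗ[𝕜] F) : Prop :=
  IsScMorphism c 𝒮 𝒯 T ∧ ∃ (T' : F →ₗ[𝕜] E) (K : E →ₗ[𝕜] E) (K' : F →ₗ[𝕜] F),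
    IsScMorphism c 𝒯 𝒮 T' ∧ IsStronglySmoothingMorphism c 𝒮 𝒮 K ∧
    IsStronglySmoothingMorphism c 𝒯 𝒯 K' ∧
    T' ∘ₗ T = LinearMap.id + K ∧ T ∘ₗ T' = LinearMap.id + K'

/-- A splitting `E = X ⊕ Y` of a (pre-tame) sc-Fréchet space: `X` and `Y` are sc-subspaces and the
canonical map `X ⊕ Y → E`, `(x, y) ↦ x + y`, has an inverse `proj : E → X ⊕ Y` that is a (tame)
morphism. -/
structure ScSplitting (c : ScContext) (𝒮 : Set (ScStructure 𝕜 E)) (X Y : Submodule 𝕜 E) where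
  isScSubspace_left : IsScSubspace 𝒮 X
  isScSubspace_right : IsScSubspace 𝒮 Y
  proj : E →ₗ[𝕜] X × Y
  proj_add : ∀ (x : X) (y : Y), proj ((x : E) + (y : E)) = (x, y)
  add_proj : ∀ e : E, ((proj e).1 : E) + ((proj e).2 : E) = e
  isScMorphism_proj : IsScMorphism c 𝒮 (prodClass c (subClass c 𝒮 X) (subClass c 𝒮 Y)) proj

/-! ### sc-continuous maps and families of morphisms -/

/-- `f : U → F` is (tame and) sc-continuous: locally it has a (tame) envelope. -/
def IsScContinuousOn (c : ScContext) (𝒮 : Set (ScStructure 𝕜 E)) (𝒯 : Set (ScStructure 𝕜 F))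
    (U : Set E) (f : E → F) : Prop :=
  ∀ x ∈ U, ∃ V ∈ 𝓝 x, V ⊆ U ∧ ∃ s ∈ 𝒮, ∃ t ∈ 𝒯,
    ∃ 𝓕 : ScChain.MapEnvelope s.chain t.chain (s.equiv ⁻¹' V) (s.conj t f),
      c = ScContext.tame → 𝓕.IsTame

/-- A (tame) family over `U` of morphisms from `E¹` to `E²`: a map `φ : U × E¹ → E²` that is linear
in the second variable and (tame and) sc-continuous. Values of `φ` outside `U` are irrelevant. -/
def IsScFamily (c : ScContext) (𝒮 : Set (ScStructure 𝕜 E)) (𝒮₁ : Set (ScStructure 𝕜 E₁))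
    (𝒮₂ : Set (ScStructure 𝕜 E₂)) (U : Set E) (φ : E → E₁ →ₗ[𝕜] E₂) : Prop :=
  IsScContinuousOn c (prodClass c 𝒮 𝒮₁) 𝒮₂ (U ×ˢ univ) (fun p => φ p.1 p.2)

/-- The family `φ` over `U` is invertible as a (tame) family of morphisms. -/
def IsInvertibleFamily (c : ScContext) (𝒮 : Set (ScStructure 𝕜 E)) (𝒮₁ : Set (ScStructure 𝕜 E₁))
    (𝒮₂ : Set (ScStructure 𝕜 E₂)) (U : Set E) (φ : E → E₁ →ₗ[𝕜] E₂) : Prop :=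
  IsScFamily c 𝒮 𝒮₁ 𝒮₂ U φ ∧ ∃ ψ : E → E₂ →ₗ[𝕜] E₁, IsScFamily c 𝒮 𝒮₂ 𝒮₁ U ψ ∧
    ∀ x ∈ U, ψ x ∘ₗ φ x = LinearMap.id ∧ φ x ∘ₗ ψ x = LinearMap.id

/-- The family `κ` over `V` has a (tame) strongly smoothing envelope: an envelope
`𝒦 = (κ_j : U_j × E¹_j → E²_j)_j` such that for every rescaling `k` there is an envelope
`𝒦_k = (U_{k_j} × E¹_j → E²_{k_j})_j` of `κ` with `𝒦 ∘ (𝕀^k × id) = 𝕀^k ∘ 𝒦_k`. -/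
def HasStronglySmoothingEnvelope (c : ScContext) (𝒮 : Set (ScStructure 𝕜 E))
    (𝒮₁ : Set (ScStructure 𝕜 E₁)) (𝒮₂ : Set (ScStructure 𝕜 E₂)) (V : Set E)
    (κ : E → E₁ →ₗ[𝕜] E₂) : Prop :=
  ∃ s ∈ 𝒮, ∃ s₁ ∈ 𝒮₁, ∃ s₂ ∈ 𝒮₂,
  ∃ (𝒰 : ScChain.SetEnvelope s.chain (s.equiv ⁻¹' V))
    (𝒦 : ScChain.MapEnvelope (s.chain.prod s₁.chain) s₂.chain
      ((s.prod s₁).equiv ⁻¹' (V ×ˢ univ)) ((s.prod s₁).conj s₂ fun p => κ p.1 p.2)),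
    (∀ j, 𝒦.dom j = 𝒰.dom j ×ˢ univ) ∧ (c = ScContext.tame → 𝒦.IsTameOnBounded) ∧
    ∀ (k : ℕ → ℕ) (hk : c.IsRescaling k),
    ∃ 𝒦k : ScChain.MapEnvelope ((s.chain.rescale k hk.strictMono).prod s₁.chain)
        (s₂.chain.rescale k hk.strictMono)
        (((s.rescale k hk.strictMono).prod s₁).equiv ⁻¹' (V ×ˢ univ))
        (((s.rescale k hk.strictMono).prod s₁).conj (s₂.rescale k hk.strictMono)
          fun p => κ p.1 p.2),
      (∀ j, 𝒦k.dom j = 𝒰.dom (k j) ×ˢ univ) ∧ (c = ScContext.tame → 𝒦k.IsTameOnBounded) ∧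
      ∀ (j : ℕ), ∀ x ∈ 𝒰.dom (k j), ∀ u : s₁.chain.space j,
        𝒦.map j (s.chain.incl (hk.strictMono.le_apply (x := j)) x, u) =
          s₂.chain.incl (hk.strictMono.le_apply (x := j)) (𝒦k.map j (x, u))

/-- (Tame) strongly smoothing families of morphisms. -/
def IsStronglySmoothingFamily (c : ScContext) (𝒮 : Set (ScStructure 𝕜 E))
    (𝒮₁ : Set (ScStructure 𝕜 E₁)) (𝒮₂ : Set (ScStructure 𝕜 E₂)) (U : Set E)
    (κ : E → E₁ →ₗ[𝕜] E₂) : Prop :=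
  IsScFamily c 𝒮 𝒮₁ 𝒮₂ U κ ∧
    ∀ x ∈ U, ∃ V ∈ 𝓝 x, V ⊆ U ∧ HasStronglySmoothingEnvelope c 𝒮 𝒮₁ 𝒮₂ V κ

/-- (Tame) Fredholm families: families of morphisms that are locally invertible modulo strongly
smoothing families. -/
def IsFredholmFamily (c : ScContext) (𝒮 : Set (ScStructure 𝕜 E))
    (𝒮₁ : Set (ScStructure 𝕜 E₁)) (𝒮₂ : Set (ScStructure 𝕜 E₂)) (U : Set E)
    (φ : E → E₁ →ₗ[𝕜] E₂) : Prop :=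
  ∀ x₀ ∈ U, ∃ V : Set E, IsOpen V ∧ x₀ ∈ V ∧ V ⊆ U ∧
    ∃ (ψ : E → E₂ →ₗ[𝕜] E₁) (κ : E → E₁ →ₗ[𝕜] E₁) (κ' : E → E₂ →ₗ[𝕜] E₂),
      IsScFamily c 𝒮 𝒮₂ 𝒮₁ V ψ ∧ IsStronglySmoothingFamily c 𝒮 𝒮₁ 𝒮₁ V κ ∧
      IsStronglySmoothingFamily c 𝒮 𝒮₂ 𝒮₂ V κ' ∧
      ∀ x ∈ V, ψ x ∘ₗ φ x = LinearMap.id + κ x ∧ φ x ∘ₗ ψ x = LinearMap.id + κ' x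

/-- For splittings `E¹ = X ⊕ ker φ(x₀)` and `E² = im φ(x₀) ⊕ C`, the compressed family
`pr ∘ φ ∘ ι : X → im φ(x₀)` is invertible on some open neighbourhood of `x₀` in `U`. -/
def CompressionInvertibleNear (c : ScContext) (𝒮 : Set (ScStructure 𝕜 E))
    (𝒮₁ : Set (ScStructure 𝕜 E₁)) (𝒮₂ : Set (ScStructure 𝕜 E₂)) (U : Set E)
    (φ : E → E₁ →ₗ[𝕜] E₂) (x₀ : E) (X : Submodule 𝕜 E₁) {C : Submodule 𝕜 E₂}
    (σ₂ : ScSplitting c 𝒮₂ (LinearMap.range (φ x₀)) C) : Prop :=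
  ∃ V : Set E, IsOpen V ∧ x₀ ∈ V ∧ V ⊆ U ∧
    IsInvertibleFamily c 𝒮 (subClass c 𝒮₁ X) (subClass c 𝒮₂ (LinearMap.range (φ x₀))) V
      (fun x => LinearMap.fst 𝕜 _ _ ∘ₗ σ₂.proj ∘ₗ φ x ∘ₗ X.subtype)

end

-- The analytic core is a perturbation statement (`SmoothNear.exists_inverse`). If `κ` is a strongly
-- smoothing family and `id + κ x₀` is injective, then `id + κ x` is invertible for `x` near `x₀`,
-- with inverse `id + μ x` for another strongly smoothing family `μ`. Families are only jointly
-- continuous in `(x, u)`, not continuous in operator norm, so a Neumann series is not available.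
-- But `κ` maps one fixed level `b` into all levels, hence factors through the compact inclusion of
-- level `b + 1` into level `b`. The perturbations at level `b` are therefore collectively compact
-- near `x₀`, and a sequence argument gives a lower bound for `id + κ x` that is uniform in `x`
-- (`exists_uniform_lower_bound`). The Fredholm alternative turns this into inverses `M x` at level
-- `b`, which are uniformly bounded and hence strongly continuous, and `μ x = -κ x ∘ M x` is
-- smoothing again. Inversion happens at a single level, so the neighbourhood of `x₀` does not
-- shrink as the level grows.
--
-- A family with a two-sided parametrix that is bijective at `x₀` is then invertible near `x₀`
-- (`FamNear.exists_inverse`). A constant smoothing correction makes the parametrix equal to the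
-- inverse at `x₀`; both products with the family become strongly smoothing perturbations of the
-- identity that are trivial at `x₀`, and the core statement applies.
--
-- A parametrix of `φ` compresses to a parametrix of the compressed family, because the projections
-- onto the finite-dimensional kernel and cokernel are smoothing; at `x₀` the compression is
-- bijective. This gives 1 → 3. For 3 → 2 one needs splittings to exist, which is Riesz theory for
-- `1 + K` at one level. For 2 → 1 the inverse of the compression, extended by zero on `C`, is a
-- parametrix: the errors contain a projection of finite rank and are smoothing.
--
-- All this is done for fixed sc-structures and germs at `x₀` (`FamNear`, `SmoothNear`), described
-- by extensions to the levels and, in the tame context, by estimates that are linear in `u`.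
-- Linearity in `u` allows the passage from envelopes near `(x₀, 0)` to such extensions
-- (`famNear_of_isScFamily`), and density of the limit in the levels gives the way back.

universe u₃

/-! ### Density arguments -/

/-- An open set meets a dense range in a dense subset of itself. This transfers identities from the
limit space to open domains in the levels. -/
theorem DenseRange.eqOn_of_isOpen {A X Y : Type*} [TopologicalSpace X] [TopologicalSpace Y]
    [T2Space Y] {e : A → X} (he : DenseRange e) {O : Set X} (hO : IsOpen O) {f g : X → Y}
    (hf : ContinuousOn f O) (hg : ContinuousOn g O) (h : ∀ a, e a ∈ O → f (e a) = g (e a)) :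
    EqOn f g O := by
  have h1 : EqOn f g (O ∩ range e) := by
    rintro _ ⟨hz, a, rfl⟩
    exact h a hz
  exact h1.of_subset_closure hf hg inter_subset_left (he.open_subset_closure_inter hO)

theorem DenseRange.le_of_isOpen {A X : Type*} [TopologicalSpace X]
    {e : A → X} (he : DenseRange e) {O : Set X} (hO : IsOpen O) {f g : X → ℝ}
    (hf : ContinuousOn f O) (hg : ContinuousOn g O) (h : ∀ a, e a ∈ O → f (e a) ≤ g (e a))
    {z : X} (hz : z ∈ O) : f z ≤ g z := by
  refine ContinuousWithinAt.closure_le (he.open_subset_closure_inter hO hz)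
    ((hf z hz).mono inter_subset_left) ((hg z hz).mono inter_subset_left) ?_
  rintro _ ⟨hz, a, rfl⟩
  exact h a hz

/-! ### Rescalings -/

namespace ScContext.IsRescaling

variable {c : ScContext} {a b : ℕ → ℕ}

theorem id (c : ScContext) : c.IsRescaling (fun j => j) :=
  ⟨strictMono_id, fun _ => ⟨0, fun _ => le_rfl⟩⟩

theorem shift (c : ScContext) (m : ℕ) : c.IsRescaling (fun j => j + m) :=
  ⟨fun _ _ h => by simpa using h, fun _ => ⟨m, fun _ => le_rfl⟩⟩

theorem comp (ha : c.IsRescaling a) (hb : c.IsRescaling b) : c.IsRescaling (fun j => a (b j)) := by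
  refine ⟨ha.strictMono.comp hb.strictMono, fun h => ?_⟩
  obtain ⟨r, hr⟩ := ha.tame h
  obtain ⟨r', hr'⟩ := hb.tame h
  refine ⟨r + r', fun j => ?_⟩
  have := hr (b j); have := hr' j; omega

theorem add_const (ha : c.IsRescaling a) (m : ℕ) : c.IsRescaling (fun j => a j + m) :=
  (shift c m).comp ha

theorem sup (ha : c.IsRescaling a) (hb : c.IsRescaling b) :
    c.IsRescaling (fun j => max (a j) (b j)) := by
  refine ⟨fun i j h => max_lt_max (ha.strictMono h) (hb.strictMono h), fun h => ?_⟩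
  obtain ⟨r, hr⟩ := ha.tame h
  obtain ⟨r', hr'⟩ := hb.tame h
  refine ⟨r + r', fun j => ?_⟩
  have := hr j; have := hr' j; omega

theorem le_apply (ha : c.IsRescaling a) (j : ℕ) : j ≤ a j := ha.strictMono.le_apply

theorem mono (ha : c.IsRescaling a) {i j : ℕ} (h : i ≤ j) : a i ≤ a j := ha.strictMono.monotone h

end ScContext.IsRescaling

/-! ### The levels of an sc-chain -/

namespace ScChain

variable {𝕜 : Type w} [RCLike 𝕜]

theorem norm_incl_le (E : ScChain.{w, u} 𝕜) {k l : ℕ} (h : k ≤ l) (x : E.space l) :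
    ‖E.incl h x‖ ≤ ‖x‖ := by
  simpa using (E.incl h).le_of_opNorm_le (E.incl_norm_le h) x

theorem ι_eq_incl (E : ScChain.{w, u} 𝕜) (k : ℕ) : E.ι k = E.incl (Nat.le_succ k) := by
  rw [E.incl_succ le_rfl, incl_self]; rfl

theorem exists_approx (E : ScChain.{w, u} 𝕜) (k : ℕ) (x : E.space k) (ε : ℝ) (hε : 0 < ε) :
    ∃ y : E.space (k + 1), ‖E.ι k y - x‖ ≤ ε := by
  obtain ⟨y, hy⟩ := (E.ι_denseRange k).exists_dist_lt x hε
  exact ⟨y, by rw [← dist_eq_norm, dist_comm]; exact hy.le⟩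

/-- The limit of an sc-chain is dense in every level. -/
theorem limit_denseRange (E : ScChain.{w, u} 𝕜) (k : ℕ) :
    DenseRange (fun x : E.limit => x.1 k) := by
  intro x
  rw [Metric.mem_closure_iff]
  intro ε hε
  -- Successive approximation: each vector is approximated in its own level by one from the next
  -- level. The errors are summable with sum at most `ε / 2`, and since the inclusions have norm at
  -- most one they stay summable in every lower level.
  choose g hg using fun (n : ℕ) (z : E.space (k + n)) =>
    E.exists_approx (k + n) z (ε / 2 / 2 / 2 ^ n) (by positivity)
  let y : ∀ n, E.space (k + n) := fun n => Nat.rec x (fun n z => g n z) n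
  have hy : ∀ n, ‖E.ι (k + n) (y (n + 1)) - y n‖ ≤ ε / 2 / 2 / 2 ^ n := fun n => hg n (y n)
  -- the image of the sequence at a fixed level
  let z : ∀ i n : ℕ, E.space i := fun i n => E.incl (show i ≤ k + (n + i) by omega) (y (n + i))
  have hz : ∀ i n, dist (z i n) (z i (n + 1)) ≤ (ε / 2) / 2 / 2 ^ n := by
    intro i n
    have h1 : z i (n + 1) = E.incl (show i ≤ k + (n + i) by omega)
        (E.ι (k + (n + i)) (y (n + i + 1))) := by
      have h0 : ∀ m (hm : m = n + i + 1), E.incl (show i ≤ k + m by omega) (y m) =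
          E.incl (show i ≤ k + (n + i) by omega) (E.ι (k + (n + i)) (y (n + i + 1))) := by
        rintro m rfl
        rw [E.ι_eq_incl, E.incl_trans]
      exact h0 _ (by omega)
    rw [h1, dist_comm, dist_eq_norm, ← map_sub]
    refine (E.norm_incl_le _ _).trans ((hy (n + i)).trans ?_)
    gcongr
    · norm_num
    · omega
  choose a ha using fun i => cauchySeq_tendsto_of_complete (cauchySeq_of_le_geometric_two (hz i))
  have hcompat : ∀ i, E.ι i (a (i + 1)) = a i := by
    intro i
    have h1 : Tendsto (fun n => E.ι i (z (i + 1) n)) atTop (𝓝 (E.ι i (a (i + 1)))) :=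
      ((E.ι i).continuous.tendsto _).comp (ha (i + 1))
    have h2 : Tendsto (fun n => z i (n + 1)) atTop (𝓝 (a i)) :=
      (ha i).comp (tendsto_add_atTop_nat 1)
    refine tendsto_nhds_unique h1 (h2.congr fun n => ?_)
    have h0 : ∀ m m' (_ : m = m') (h : i ≤ k + m) (h' : i + 1 ≤ k + m'), E.incl h (y m) =
          E.ι i (E.incl h' (y m')) := by
      rintro m _ rfl h h'
      rw [E.ι_eq_incl, E.incl_trans]
    exact h0 _ _ (by omega) _ _
  refine ⟨a k, ⟨⟨a, hcompat⟩, rfl⟩, ?_⟩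
  -- compare with the sequence at level `k` that starts at `x`
  let z' : ℕ → E.space k := fun n => E.incl (show k ≤ k + n by omega) (y n)
  have hz' : ∀ n, dist (z' n) (z' (n + 1)) ≤ (ε / 2) / 2 / 2 ^ n := by
    intro n
    have h1 : z' (n + 1) = E.incl (show k ≤ k + n by omega) (E.ι (k + n) (y (n + 1))) := by
      rw [E.ι_eq_incl, E.incl_trans]
    rw [h1, dist_comm, dist_eq_norm, ← map_sub]
    exact (E.norm_incl_le _ _).trans (hy n)
  have hlim : Tendsto z' atTop (𝓝 (a k)) := by
    rw [← tendsto_add_atTop_iff_nat k]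
    exact ha k
  have := dist_le_of_le_geometric_two_of_tendsto₀ hz' hlim
  have h0 : z' 0 = x := by
    change E.incl (le_refl k) x = x
    rw [E.incl_self]; rfl
  rw [h0] at this
  linarith

end ScChain

/-! ### Levels of an sc-structure -/

namespace ScStructure

variable {𝕜 : Type w} [RCLike 𝕜]
variable {E : Type u} [AddCommGroup E] [Module 𝕜 E] [TopologicalSpace E]
variable {F : Type v} [AddCommGroup F] [Module 𝕜 F] [TopologicalSpace F]

/-- The canonical map of `E ≅ E_∞` to the `k`-th level of the chain. -/
noncomputable def lev (s : ScStructure 𝕜 E) (k : ℕ) : E →L[𝕜] s.chain.space k :=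
  ((ContinuousLinearMap.proj k).comp s.chain.limit.subtypeL).comp
    (s.equiv.symm : E →L[𝕜] s.chain.limit)

variable (s : ScStructure 𝕜 E)

theorem lev_apply (k : ℕ) (x : E) : s.lev k x = (s.equiv.symm x).1 k := rfl

theorem lev_equiv (k : ℕ) (x : s.chain.limit) : s.lev k (s.equiv x) = x.1 k := by
  simp [lev_apply]

@[simp] theorem incl_lev {k l : ℕ} (h : k ≤ l) (x : E) :
    s.chain.incl h (s.lev l x) = s.lev k x :=
  s.chain.incl_limit h _

theorem ι_lev (k : ℕ) (x : E) : s.chain.ι k (s.lev (k + 1) x) = s.lev k x :=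
  (s.equiv.symm x).2 k

theorem norm_lev_mono {k l : ℕ} (h : k ≤ l) (x : E) : ‖s.lev k x‖ ≤ ‖s.lev l x‖ := by
  rw [← s.incl_lev h]
  exact s.chain.norm_incl_le h _

theorem ext_lev {x y : E} (h : ∀ k, s.lev k x = s.lev k y) : x = y :=
  s.equiv.symm.injective (Subtype.ext (funext h))

theorem lev_injective (k : ℕ) : Function.Injective (s.lev k) := by
  intro x y h
  refine s.ext_lev fun l => ?_
  rcases le_total k l with hl | hl
  · apply s.chain.incl_injective hl
    simpa using h
  · rw [← s.incl_lev hl, h, s.incl_lev]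

theorem lev_denseRange (k : ℕ) : DenseRange (s.lev k) := by
  have h : range (s.lev k) = range fun x : s.chain.limit => x.1 k :=
    s.equiv.symm.surjective.range_comp fun x : s.chain.limit => x.1 k
  rw [DenseRange, h]
  exact s.chain.limit_denseRange k

theorem exists_lev (y : ∀ k, s.chain.space k)
    (hy : ∀ k l (h : k ≤ l), s.chain.incl h (y l) = y k) : ∃ x : E, ∀ k, s.lev k x = y k :=
  ⟨s.equiv ⟨y, fun k => by rw [s.chain.ι_eq_incl]; exact hy _ _ _⟩, fun k => by
    rw [lev_equiv]⟩

/-- The ball around `x` of radius `ε` with respect to the `m`-th norm. -/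
def ball (m : ℕ) (x : E) (ε : ℝ) : Set E := {y | ‖s.lev m y - s.lev m x‖ < ε}

theorem isOpen_ball (m : ℕ) (x : E) (ε : ℝ) : IsOpen (s.ball m x ε) :=
  isOpen_lt (by fun_prop) continuous_const

theorem mem_ball_self (m : ℕ) (x : E) {ε : ℝ} (h : 0 < ε) : x ∈ s.ball m x ε := by
  simpa [ball] using h

theorem ball_subset {m m' : ℕ} (h : m ≤ m') (x : E) {ε ε' : ℝ} (h' : ε' ≤ ε) :
    s.ball m' x ε' ⊆ s.ball m x ε := by
  intro y hy
  have := s.norm_lev_mono h (y - x)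
  simp only [map_sub] at this
  exact this.trans_lt (lt_of_lt_of_le hy h')

theorem isInducing_lev : Topology.IsInducing (fun (x : E) (k : ℕ) => s.lev k x) :=
  Topology.IsInducing.subtypeVal.comp s.equiv.symm.toHomeomorph.isInducing

theorem continuous_of_lev {X : Type*} [TopologicalSpace X] {f : X → E}
    (h : ∀ k, Continuous fun x => s.lev k (f x)) : Continuous f :=
  s.isInducing_lev.continuous_iff.2 (continuous_pi h)

/-- The norms increase with the level, so the finitely many conditions that define a basic
neighbourhood are all implied by one condition at the highest level involved. -/
theorem exists_ball_subset {V : Set E} {x : E} (hV : V ∈ 𝓝 x) :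
    ∃ m, ∃ ε > 0, s.ball m x ε ⊆ V := by
  rw [s.isInducing_lev.nhds_eq_comap, mem_comap] at hV
  obtain ⟨W, hW, hWV⟩ := hV
  rw [nhds_pi, Filter.mem_pi] at hW
  obtain ⟨I, hI, t, ht, htW⟩ := hW
  choose δ hδ hδt using fun k => Metric.mem_nhds_iff.1 (ht k)
  obtain ⟨M, hM⟩ := hI.bddAbove
  obtain ⟨ε, hε, hεδ⟩ : ∃ ε > 0, ∀ k ∈ I, ε ≤ δ k := by
    rcases I.eq_empty_or_nonempty with rfl | hne
    · exact ⟨1, one_pos, by simp⟩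
    · obtain ⟨k, hk, hk'⟩ := hI.exists_minimalFor δ I hne
      refine ⟨δ k, hδ k, fun i hi => ?_⟩
      by_contra hlt
      exact hlt (hk' hi (not_le.1 hlt).le)
  refine ⟨M, ε, hε, fun y hy => hWV (htW fun k hk => hδt k ?_)⟩
  rw [Metric.mem_ball, dist_eq_norm]
  exact s.ball_subset (hM hk) x (hεδ k hk) hy

end ScStructure

/-! ### Morphisms in terms of norm estimates -/

namespace ScStructure

variable {𝕜 : Type w} [RCLike 𝕜]
variable {E : Type u} [AddCommGroup E] [Module 𝕜 E] [TopologicalSpace E]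
variable {F : Type v} [AddCommGroup F] [Module 𝕜 F] [TopologicalSpace F]
variable {G : Type u₁} [AddCommGroup G] [Module 𝕜 G] [TopologicalSpace G]
variable {s s' : ScStructure 𝕜 E} {t t' : ScStructure 𝕜 F} {r : ScStructure 𝕜 G}

/-- `T` is bounded with respect to the `i`-th norm on the source and the `j`-th norm on the
target. -/
def IsBdd (s : ScStructure 𝕜 E) (t : ScStructure 𝕜 F) (T : E →ₗ[𝕜] F) (i j : ℕ) : Prop :=
  ∃ C : ℝ, ∀ x, ‖t.lev j (T x)‖ ≤ C * ‖s.lev i x‖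

theorem IsBdd.of_clm {T : E →ₗ[𝕜] F} {i j : ℕ} (f : s.chain.space i →L[𝕜] t.chain.space j)
    (h : ∀ x, f (s.lev i x) = t.lev j (T x)) : IsBdd s t T i j :=
  ⟨‖f‖, fun x => by rw [← h]; exact f.le_opNorm _⟩

/-- Extension by continuity: `lev i` has dense range and the target level is complete. -/
theorem IsBdd.exists_clm {T : E →ₗ[𝕜] F} {i j : ℕ} (h : IsBdd s t T i j) :
    ∃ f : s.chain.space i →L[𝕜] t.chain.space j, ∀ x, f (s.lev i x) = t.lev j (T x) :=
  ⟨((t.lev j : F →ₗ[𝕜] t.chain.space j) ∘ₗ T).extendOfNorm (s.lev i : E →ₗ[𝕜] s.chain.space i),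
    fun x => LinearMap.extendOfNorm_eq (f := (t.lev j : F →ₗ[𝕜] t.chain.space j) ∘ₗ T)
      (e := (s.lev i : E →ₗ[𝕜] s.chain.space i)) (s.lev_denseRange i) h x⟩

theorem IsBdd.exists_pos {T : E →ₗ[𝕜] F} {i j : ℕ} (h : IsBdd s t T i j) :
    ∃ C > 0, ∀ x, ‖t.lev j (T x)‖ ≤ C * ‖s.lev i x‖ := by
  obtain ⟨C, hC⟩ := h
  refine ⟨|C| + 1, by positivity, fun x => (hC x).trans ?_⟩
  gcongr
  linarith [le_abs_self C]

theorem IsBdd.mono {T : E →ₗ[𝕜] F} {i j i' j' : ℕ} (h : IsBdd s t T i j) (hi : i ≤ i')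
    (hj : j' ≤ j) : IsBdd s t T i' j' := by
  obtain ⟨C, hC0, hC⟩ := h.exists_pos
  refine ⟨C, fun x => (t.norm_lev_mono hj _).trans ((hC x).trans ?_)⟩
  gcongr
  exact s.norm_lev_mono hi x

theorem IsBdd.comp {T : E →ₗ[𝕜] F} {S : F →ₗ[𝕜] G} {i j k : ℕ} (hS : IsBdd t r S j k)
    (hT : IsBdd s t T i j) : IsBdd s r (S ∘ₗ T) i k := by
  obtain ⟨C, hC0, hC⟩ := hS.exists_pos
  obtain ⟨C', hC'⟩ := hT
  refine ⟨C * C', fun x => (hC _).trans ?_⟩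
  rw [mul_assoc]
  gcongr
  exact hC' x

theorem IsBdd.add {T S : E →ₗ[𝕜] F} {i j : ℕ} (hT : IsBdd s t T i j) (hS : IsBdd s t S i j) :
    IsBdd s t (T + S) i j := by
  obtain ⟨C, hC⟩ := hT
  obtain ⟨C', hC'⟩ := hS
  refine ⟨C + C', fun x => ?_⟩
  rw [LinearMap.add_apply, map_add, add_mul]
  exact (norm_add_le _ _).trans (add_le_add (hC x) (hC' x))

theorem IsBdd.neg {T : E →ₗ[𝕜] F} {i j : ℕ} (hT : IsBdd s t T i j) : IsBdd s t (-T) i j := by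
  obtain ⟨C, hC⟩ := hT
  refine ⟨C, fun x => ?_⟩
  rw [LinearMap.neg_apply, map_neg, norm_neg]
  exact hC x

theorem IsBdd.id {i j : ℕ} (h : j ≤ i) : IsBdd s s LinearMap.id i j :=
  ⟨1, fun x => by simpa using s.norm_lev_mono h x⟩

/-- Estimates that characterise morphisms. -/
def IsMor (c : ScContext) (s : ScStructure 𝕜 E) (t : ScStructure 𝕜 F) (T : E →ₗ[𝕜] F) : Prop :=
  ∃ a, c.IsRescaling a ∧ ∀ j, IsBdd s t T (a j) j

/-- Estimates that characterise strongly smoothing morphisms. -/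
def IsSmoothing (s : ScStructure 𝕜 E) (t : ScStructure 𝕜 F) (T : E →ₗ[𝕜] F) : Prop :=
  ∃ b, ∀ j, IsBdd s t T b j

variable {c : ScContext}

theorem IsMor.id (c : ScContext) (s : ScStructure 𝕜 E) : IsMor c s s LinearMap.id :=
  ⟨_, .id c, fun _ => IsBdd.id le_rfl⟩

theorem IsMor.comp {T : E →ₗ[𝕜] F} {S : F →ₗ[𝕜] G} (hS : IsMor c t r S) (hT : IsMor c s t T) :
    IsMor c s r (S ∘ₗ T) := by
  obtain ⟨a, ha, h⟩ := hS
  obtain ⟨b, hb, h'⟩ := hT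
  exact ⟨_, hb.comp ha, fun j => (h j).comp (h' (a j))⟩

theorem IsMor.neg {T : E →ₗ[𝕜] F} (hT : IsMor c s t T) : IsMor c s t (-T) := by
  obtain ⟨a, ha, h⟩ := hT
  exact ⟨a, ha, fun j => (h j).neg⟩

theorem IsMor.continuous {T : E →ₗ[𝕜] F} (hT : IsMor c s t T) : Continuous T := by
  obtain ⟨a, ha, h⟩ := hT
  refine t.continuous_of_lev fun k => ?_
  obtain ⟨f, hf⟩ := (h k).exists_clm
  simp only [← hf]
  fun_prop

theorem IsSmoothing.isMor {T : E →ₗ[𝕜] F} (hT : IsSmoothing s t T) (c : ScContext) :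
    IsMor c s t T := by
  obtain ⟨b, h⟩ := hT
  exact ⟨_, .shift c b, fun j => (h j).mono (by omega) le_rfl⟩

theorem IsSmoothing.comp_isMor {T : E →ₗ[𝕜] F} {S : F →ₗ[𝕜] G} (hS : IsSmoothing t r S)
    (hT : IsMor c s t T) : IsSmoothing s r (S ∘ₗ T) := by
  obtain ⟨b, h⟩ := hS
  obtain ⟨a, ha, h'⟩ := hT
  exact ⟨a b, fun j => (h j).comp (h' b)⟩

theorem IsMor.comp_isSmoothing {T : E →ₗ[𝕜] F} {S : F →ₗ[𝕜] G} (hS : IsMor c t r S)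
    (hT : IsSmoothing s t T) : IsSmoothing s r (S ∘ₗ T) := by
  obtain ⟨b, h⟩ := hT
  obtain ⟨a, ha, h'⟩ := hS
  exact ⟨b, fun j => (h' j).comp (h (a j))⟩

theorem IsSmoothing.neg {T : E →ₗ[𝕜] F} (hT : IsSmoothing s t T) : IsSmoothing s t (-T) := by
  obtain ⟨a, h⟩ := hT
  exact ⟨a, fun j => (h j).neg⟩

/-- A morphism with finite-dimensional range is smoothing. -/
theorem IsMor.isSmoothing_of_finiteDimensional {T : E →ₗ[𝕜] F} (hT : IsMor c s t T)
    [FiniteDimensional 𝕜 (LinearMap.range T)] : IsSmoothing s t T := by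
  obtain ⟨a, ha, h⟩ := hT
  refine ⟨a 0, fun j => ?_⟩
  -- `lev 0` is injective, so it identifies the range with a finite-dimensional normed space, on
  -- which every linear map into level `j` is bounded. The estimate for `T` into level `0` thus
  -- controls all levels.
  let p : LinearMap.range T →ₗ[𝕜] t.chain.space 0 :=
    (t.lev 0 : F →ₗ[𝕜] t.chain.space 0) ∘ₗ (LinearMap.range T).subtype
  have hp : LinearMap.ker p = ⊥ :=
    LinearMap.ker_eq_bot.2 ((t.lev_injective 0).comp Subtype.val_injective)
  let e := LinearEquiv.ofInjective p (LinearMap.ker_eq_bot.1 hp)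
  let q : LinearMap.range p →ₗ[𝕜] t.chain.space j :=
    ((t.lev j : F →ₗ[𝕜] t.chain.space j) ∘ₗ (LinearMap.range T).subtype) ∘ₗ e.symm.toLinearMap
  let Q : LinearMap.range p →L[𝕜] t.chain.space j := ⟨q, q.continuous_of_finiteDimensional⟩
  obtain ⟨C, hC⟩ := h 0
  refine ⟨‖Q‖ * C, fun x => ?_⟩
  have h1 : Q (e ⟨T x, x, rfl⟩) = t.lev j (T x) := by
    simp [Q, q]
  have h2 : ‖e ⟨T x, x, rfl⟩‖ = ‖t.lev 0 (T x)‖ := rfl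
  rw [← h1, mul_assoc]
  refine (Q.le_opNorm _).trans ?_
  gcongr
  rw [h2]
  exact hC x

/-! #### Operators between chains and estimates -/

theorem isBdd_of_hom_extends {k l : ℕ → ℕ} {hk : StrictMono k} {hl : StrictMono l}
    {H : ScChain.Hom (s.chain.rescale k hk) (t.chain.rescale l hl)} {T : E →ₗ[𝕜] F}
    (h : H.Extends (s.conj t T)) (j : ℕ) : IsBdd s t T (k j) (l j) := by
  refine .of_clm (H.map j) fun x => ?_
  have := h (s.equiv.symm x) j
  simpa [conj, lev_apply] using this

/-- Levelwise bounded linear maps are induced by operators of sc-chains. -/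
theorem exists_hom_extends {k l : ℕ → ℕ} (hk : StrictMono k) (hl : StrictMono l) {T : E →ₗ[𝕜] F}
    (h : ∀ j, IsBdd s t T (k j) (l j)) :
    ∃ H : ScChain.Hom (s.chain.rescale k hk) (t.chain.rescale l hl),
      ∀ j x, H.map j (s.lev (k j) x) = t.lev (l j) (T x) := by
  choose f hf using fun j => (h j).exists_clm
  refine ⟨⟨f, fun j => ?_⟩, hf⟩
  refine ContinuousLinearMap.coeFn_injective
    ((s.lev_denseRange (k (j + 1))).equalizer (ContinuousLinearMap.continuous _)
    (ContinuousLinearMap.continuous _) (funext fun x => ?_))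
  change f j (s.chain.incl _ (s.lev _ x)) = t.chain.incl _ (f (j + 1) (s.lev _ x))
  rw [s.incl_lev, hf, hf, t.incl_lev]

theorem hom_extends_of_lev {k l : ℕ → ℕ} {hk : StrictMono k} {hl : StrictMono l} {T : E →ₗ[𝕜] F}
    {H : ScChain.Hom (s.chain.rescale k hk) (t.chain.rescale l hl)}
    (h : ∀ j x, H.map j (s.lev (k j) x) = t.lev (l j) (T x)) : H.Extends (s.conj t T) := by
  intro x j
  have := h j (s.equiv x)
  rw [lev_equiv] at this
  exact this

/-- A rescaling of the target only strengthens the estimates because `j ≤ l j`; it can be dropped,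
and conversely the identity rescaling serves for the target. -/
theorem isWeakMorphism_iff {T : E →ₗ[𝕜] F} :
    ScChain.IsWeakMorphism c (s.conj t T) ↔ IsMor c s t T := by
  constructor
  · rintro ⟨k, l, hk, hl, H, hH⟩
    exact ⟨k, hk, fun j => (isBdd_of_hom_extends hH j).mono le_rfl (hl.le_apply j)⟩
  · rintro ⟨a, ha, h⟩
    obtain ⟨H, hH⟩ := exists_hom_extends ha.strictMono
      (ScContext.IsRescaling.id c).strictMono h
    exact ⟨_, _, ha, .id c, H, hom_extends_of_lev hH⟩

/-- Injectivity on the levels does not follow from one estimate alone. With estimates in both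
directions, the extended identity followed by an extension of its inverse is an inclusion of the
chain, which is injective. -/
theorem equivalent_iff :
    s.Equivalent c s' ↔ IsMor c s s' LinearMap.id ∧ IsMor c s' s LinearMap.id := by
  have key : ∀ {s s' : ScStructure 𝕜 E}, IsMor c s s' LinearMap.id → IsMor c s' s LinearMap.id →
      ScChain.IsWeakEmbedding c (s.conj s' id) := by
    rintro s s' ⟨a, ha, h⟩ ⟨b, hb, h'⟩
    obtain ⟨H, hH⟩ := exists_hom_extends (ha.comp hb).strictMono hb.strictMono
      (fun j => h (b j))
    refine ⟨_, _, ha.comp hb, hb, H, hom_extends_of_lev hH, fun j => ?_⟩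
    obtain ⟨f, hf⟩ := (h' j).exists_clm
    have hcomp : (fun x => f (H.map j x)) =
        s.chain.incl (((ha.comp hb).le_apply j)) := by
      refine (s.lev_denseRange (a (b j))).equalizer
        (f.continuous.comp (H.map j).continuous) (ContinuousLinearMap.continuous _)
        (funext fun x => ?_)
      change f (H.map j (s.lev (a (b j)) x)) = s.chain.incl _ (s.lev _ x)
      rw [s.incl_lev, hH]
      exact hf x
    have hinj := s.chain.incl_injective ((ha.comp hb).le_apply j)
    rw [← hcomp] at hinj
    exact hinj.of_comp
  have key' : ∀ {s s' : ScStructure 𝕜 E}, ScChain.IsWeakEmbedding c (s.conj s' id) →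
      IsMor c s s' LinearMap.id := by
    rintro s s' ⟨k, l, hk, hl, H, hH, -⟩
    exact isWeakMorphism_iff.1 ⟨k, l, hk, hl, H, hH⟩
  exact ⟨fun h => ⟨key' h.1, key' h.2⟩, fun h => ⟨key h.1 h.2, key h.2 h.1⟩⟩

theorem Equivalent.symm (h : s.Equivalent c s') : s'.Equivalent c s := ⟨h.2, h.1⟩

theorem Equivalent.refl (c : ScContext) (s : ScStructure 𝕜 E) : s.Equivalent c s :=
  equivalent_iff.2 ⟨.id c s, .id c s⟩

theorem Equivalent.trans {s'' : ScStructure 𝕜 E} (h : s.Equivalent c s')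
    (h' : s'.Equivalent c s'') : s.Equivalent c s'' := by
  rw [equivalent_iff] at *
  exact ⟨h'.1.comp h.1, h.2.comp h'.2⟩

theorem lev_rescale (s : ScStructure 𝕜 E) (k : ℕ → ℕ) (hk : StrictMono k) (j : ℕ) (x : E) :
    (s.rescale k hk).lev j x = s.lev (k j) x := rfl

theorem norm_lev_restrict (s : ScStructure 𝕜 E) (S : s.chain.Subchain) (X : Submodule 𝕜 E)
    (h : s.Realizes S X) (j : ℕ) (x : X) :
    ‖(s.restrict S X h).lev j x‖ = ‖s.lev j x‖ := rfl

theorem equivalent_rescale (s : ScStructure 𝕜 E) {k : ℕ → ℕ} (hk : c.IsRescaling k) :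
    s.Equivalent c (s.rescale k hk.strictMono) := by
  refine equivalent_iff.2
    ⟨⟨k, hk, fun j => ⟨1, fun x => ?_⟩⟩, ⟨_, .id c, fun j => ⟨1, fun x => ?_⟩⟩⟩
  · rw [lev_rescale, one_mul]; rfl
  · rw [lev_rescale, one_mul]; exact s.norm_lev_mono (hk.le_apply j) x

end ScStructure

/-! ### Equivalence classes of sc-structures -/

section

open ScStructure

variable {𝕜 : Type w} [RCLike 𝕜]
variable {E : Type u} [AddCommGroup E] [Module 𝕜 E] [TopologicalSpace E]
variable {F : Type v} [AddCommGroup F] [Module 𝕜 F] [TopologicalSpace F]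
variable {c : ScContext} {𝒮 : Set (ScStructure 𝕜 E)} {𝒯 : Set (ScStructure 𝕜 F)}
variable {s s' : ScStructure 𝕜 E} {t t' : ScStructure 𝕜 F}

theorem IsScClass.isMor_id (h : IsScClass c 𝒮) (hs : s ∈ 𝒮) (hs' : s' ∈ 𝒮) :
    IsMor c s s' LinearMap.id :=
  (equivalent_iff.1 ((h.mem_iff s hs s').1 hs')).1

theorem IsScClass.rescale_mem (h : IsScClass c 𝒮) (hs : s ∈ 𝒮) {k : ℕ → ℕ}
    (hk : c.IsRescaling k) : s.rescale k hk.strictMono ∈ 𝒮 :=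
  (h.mem_iff s hs _).2 (s.equivalent_rescale hk)

theorem isScMorphism_iff (h𝒮 : IsScClass c 𝒮) (h𝒯 : IsScClass c 𝒯) (hs : s ∈ 𝒮) (ht : t ∈ 𝒯)
    {T : E →ₗ[𝕜] F} : IsScMorphism c 𝒮 𝒯 T ↔ IsMor c s t T := by
  constructor
  · rintro ⟨-, s', hs', t', ht', h⟩
    exact ((h𝒯.isMor_id ht' ht).comp (isWeakMorphism_iff.1 h)).comp (h𝒮.isMor_id hs hs')
  · intro h
    exact ⟨h.continuous, s, hs, t, ht, isWeakMorphism_iff.2 h⟩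

/-- Factoring only the zeroth operator through the shift by `j` already gives a bound from one fixed
source level into level `j`. Shifts are tame, so the argument is the same in both contexts.
Conversely, bounds from a fixed level into all `m j` provide the factorisation through the rescaling
`m`. -/
theorem isStronglySmoothingMorphism_iff (h𝒮 : IsScClass c 𝒮) (h𝒯 : IsScClass c 𝒯) (hs : s ∈ 𝒮)
    (ht : t ∈ 𝒯) {T : E →ₗ[𝕜] F} :
    IsStronglySmoothingMorphism c 𝒮 𝒯 T ↔ IsSmoothing s t T := by
  constructor
  · rintro ⟨-, s', hs', t', ht', k, l, hk, hl, H, hH, hsm⟩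
    have h1 : IsSmoothing s' t' T := by
      refine ⟨k 0, fun j => ?_⟩
      obtain ⟨L, hL⟩ := hsm _ (ScContext.IsRescaling.shift c j)
      have h2 : IsBdd s' t' T (k 0) (l (0 + j)) := by
        refine .of_clm (L.map 0) fun x => ?_
        have h3 := hL 0 (s'.lev (k 0) x)
        have h4 := hH (s'.equiv.symm x) 0
        have h5 : H.map 0 (s'.lev (k 0) x) = t'.lev (l 0) (T x) := by
          simpa [conj, lev_apply] using h4
        rw [h5] at h3
        apply t'.chain.incl_injective (hl.mono (Nat.zero_le (0 + j)))
        rw [t'.incl_lev, h3, t'.chain.rescale_incl]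
      exact h2.mono le_rfl ((by omega : j ≤ 0 + j).trans (hl.le_apply _))
    exact ((h𝒯.isMor_id ht' ht).comp_isSmoothing h1).comp_isMor (h𝒮.isMor_id hs hs')
  · rintro ⟨b, hb⟩
    refine ⟨(isScMorphism_iff h𝒮 h𝒯 hs ht).2 (IsSmoothing.isMor ⟨b, hb⟩ c), s, hs, t, ht, _, _,
      .shift c b, .id c, ?_⟩
    obtain ⟨H, hH⟩ := exists_hom_extends (s := s) (t := t) (T := T)
      (ScContext.IsRescaling.shift c b).strictMono (ScContext.IsRescaling.id c).strictMono
      (fun j => (hb j).mono (by omega) le_rfl)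
    refine ⟨H, hom_extends_of_lev hH, fun m hm => ?_⟩
    obtain ⟨L, hL⟩ := exists_hom_extends (s := s) (t := t) (T := T)
      (ScContext.IsRescaling.shift c b).strictMono hm.strictMono
      (fun j => (hb (m j)).mono (by omega) le_rfl)
    let L' : ScChain.Hom (s.chain.rescale _ (ScContext.IsRescaling.shift c b).strictMono)
      ((t.chain.rescale _ (ScContext.IsRescaling.id c).strictMono).rescale m hm.strictMono) :=
      ⟨L.map, fun j => by
        refine (L.comm j).trans ?_
        congr 1
        exact (t.chain.rescale_incl (fun j => j) (ScContext.IsRescaling.id c).strictMono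
          (hm.strictMono (Nat.lt_succ_self j)).le).symm⟩
    refine ⟨L', fun j x => ?_⟩
    have : (fun x => H.map j x) = fun x => t.chain.incl (hm.le_apply j) (L.map j x) := by
      refine (s.lev_denseRange (j + b)).equalizer (H.map j).continuous
        ((ContinuousLinearMap.continuous _).comp (L.map j).continuous) (funext fun x => ?_)
      change H.map j (s.lev (j + b) x) = t.chain.incl (hm.le_apply j) (L.map j (s.lev (j + b) x))
      rw [hH, hL, t.incl_lev]
    rw [t.chain.rescale_incl]
    exact congrFun this x

theorem isMor_fst (c : ScContext) (s : ScStructure 𝕜 E) (t : ScStructure 𝕜 F) :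
    IsMor c (s.prod t) s (LinearMap.fst 𝕜 E F) :=
  ⟨_, .id c, fun j => ⟨1, fun z => by rw [one_mul]; exact le_max_left _ _⟩⟩

theorem isMor_snd (c : ScContext) (s : ScStructure 𝕜 E) (t : ScStructure 𝕜 F) :
    IsMor c (s.prod t) t (LinearMap.snd 𝕜 E F) :=
  ⟨_, .id c, fun j => ⟨1, fun z => by rw [one_mul]; exact le_max_right _ _⟩⟩

theorem ScStructure.IsMor.prod {G : Type u₁} [AddCommGroup G] [Module 𝕜 G] [TopologicalSpace G]
    {r : ScStructure 𝕜 G} {T : G →ₗ[𝕜] E} {S : G →ₗ[𝕜] F} (hT : IsMor c r s T)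
    (hS : IsMor c r t S) : IsMor c r (s.prod t) (T.prod S) := by
  obtain ⟨a, ha, h⟩ := hT
  obtain ⟨b, hb, h'⟩ := hS
  refine ⟨_, ha.sup hb, fun j => ?_⟩
  obtain ⟨C, hC0, hC⟩ := ((h j).mono (le_max_left (a j) (b j)) le_rfl).exists_pos
  obtain ⟨C', hC0', hC'⟩ := ((h' j).mono (le_max_right (a j) (b j)) le_rfl).exists_pos
  refine ⟨max C C', fun x => max_le ((hC x).trans ?_) ((hC' x).trans ?_)⟩
  · gcongr; exact le_max_left _ _
  · gcongr; exact le_max_right _ _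

theorem equivalent_prod (hs : s.Equivalent c s') (ht : t.Equivalent c t') :
    (s.prod t).Equivalent c (s'.prod t') := by
  rw [equivalent_iff] at *
  have key : ∀ {s s' : ScStructure 𝕜 E} {t t' : ScStructure 𝕜 F}, IsMor c s s' LinearMap.id →
      IsMor c t t' LinearMap.id → IsMor c (s.prod t) (s'.prod t') LinearMap.id :=
    fun {s s' t t'} h h' => by
      have h1 := (h.comp (isMor_fst c s t)).prod (h'.comp (isMor_snd c s t))
      rwa [LinearMap.id_comp, LinearMap.id_comp,
        show (LinearMap.fst 𝕜 E F).prod (LinearMap.snd 𝕜 E F) = LinearMap.id from rfl] at h1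
  exact ⟨key hs.1 ht.1, key hs.2 ht.2⟩

theorem IsScClass.prodClass (h𝒮 : IsScClass c 𝒮) (h𝒯 : IsScClass c 𝒯) :
    IsScClass c (prodClass c 𝒮 𝒯) := by
  refine ⟨?_, ?_⟩
  · obtain ⟨s, hs⟩ := h𝒮.nonempty
    obtain ⟨t, ht⟩ := h𝒯.nonempty
    exact ⟨s.prod t, s, hs, t, ht, .refl c _⟩
  · rintro r ⟨s, hs, t, ht, h⟩ r'
    constructor
    · rintro ⟨s', hs', t', ht', h'⟩
      exact (h.symm.trans (equivalent_prod ((h𝒮.mem_iff s hs s').1 hs')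
        ((h𝒯.mem_iff t ht t').1 ht'))).trans h'
    · intro h'
      exact ⟨s, hs, t, ht, h.trans h'⟩

theorem prod_mem_prodClass (c : ScContext) (hs : s ∈ 𝒮) (ht : t ∈ 𝒯) :
    s.prod t ∈ prodClass c 𝒮 𝒯 := ⟨s, hs, t, ht, .refl c _⟩

/-- The norms on a subchain are the ambient ones, so estimates for the identity of `E` hold on `X`
with the same constants. Hence the class depends neither on the chain nor on the subchain. -/
theorem IsScClass.subClass (h𝒮 : IsScClass c 𝒮) {X : Submodule 𝕜 E} (hX : IsScSubspace 𝒮 X) :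
    IsScClass c (subClass c 𝒮 X) := by
  refine ⟨?_, ?_⟩
  · obtain ⟨-, s, hs, S, h⟩ := hX
    exact ⟨_, s, hs, S, h, .refl c _⟩
  · rintro r ⟨s, hs, S, hS, h⟩ r'
    constructor
    · rintro ⟨s', hs', S', hS', h'⟩
      refine (h.symm.trans ?_).trans h'
      have key : ∀ {s s' : ScStructure 𝕜 E} {S : s.chain.Subchain} {S' : s'.chain.Subchain}
          (h : s.Realizes S X) (h' : s'.Realizes S' X), IsMor c s s' LinearMap.id →
          IsMor c (s.restrict S X h) (s'.restrict S' X h') LinearMap.id := by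
        rintro s s' S S' h h' ⟨a, ha, hb⟩
        refine ⟨a, ha, fun j => ?_⟩
        obtain ⟨C, hC⟩ := hb j
        exact ⟨C, fun x => hC x.1⟩
      exact equivalent_iff.2 ⟨key _ _ (h𝒮.isMor_id hs hs'), key _ _ (h𝒮.isMor_id hs' hs)⟩
    · intro h'
      exact ⟨s, hs, S, hS, h.trans h'⟩

theorem isMor_subtype (h𝒮 : IsScClass c 𝒮) {X : Submodule 𝕜 E} (hs : s ∈ 𝒮)
    {r : ScStructure 𝕜 X} (hr : r ∈ subClass c 𝒮 X) : IsMor c r s X.subtype := by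
  obtain ⟨s', hs', S, h, he⟩ := hr
  have h1 : IsMor c (s'.restrict S X h) s' X.subtype :=
    ⟨_, .id c, fun j => ⟨1, fun x => by rw [one_mul]; exact (norm_lev_restrict s' S X h j x).ge⟩⟩
  exact (h𝒮.isMor_id hs' hs).comp (h1.comp (equivalent_iff.1 he).2)

/-- A map into an sc-subspace is a morphism if it is one as a map to the ambient space. -/
theorem isMor_of_subtype (h𝒮 : IsScClass c 𝒮) {X : Submodule 𝕜 E} (hs : s ∈ 𝒮)
    {r : ScStructure 𝕜 X} (hr : r ∈ subClass c 𝒮 X) {T : F →ₗ[𝕜] X}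
    (hT : IsMor c t s (X.subtype ∘ₗ T)) : IsMor c t r T := by
  obtain ⟨s', hs', S, h, he⟩ := hr
  have h1 : IsMor c t (s'.restrict S X h) T := by
    obtain ⟨a, ha, hb⟩ := (h𝒮.isMor_id hs hs').comp hT
    exact ⟨a, ha, fun j => hb j⟩
  exact (equivalent_iff.1 he).1.comp h1

end

/-! ### Germs of families of morphisms -/

namespace ScStructure

variable {𝕜 : Type w} [RCLike 𝕜]
variable {E : Type u} [AddCommGroup E] [Module 𝕜 E] [TopologicalSpace E]
variable {E₁ : Type u₁} [AddCommGroup E₁] [Module 𝕜 E₁] [TopologicalSpace E₁]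
variable {E₂ : Type u₂} [AddCommGroup E₂] [Module 𝕜 E₂] [TopologicalSpace E₂]
variable {E₃ : Type u₃} [AddCommGroup E₃] [Module 𝕜 E₃] [TopologicalSpace E₃]
variable {s : ScStructure 𝕜 E} {s₁ : ScStructure 𝕜 E₁} {s₂ : ScStructure 𝕜 E₂}
  {s₃ : ScStructure 𝕜 E₃} {c : ScContext} {V : Set E} {x₀ : E}

/-- The family `φ` over `V` extends to a family of bounded operators `E¹_q → E²_j` over an open
subset of `E_p` whose intersection with `E` is `V`. -/
def LevelExt (s : ScStructure 𝕜 E) (s₁ : ScStructure 𝕜 E₁) (s₂ : ScStructure 𝕜 E₂) (V : Set E)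
    (φ : E → E₁ →ₗ[𝕜] E₂) (p q j : ℕ) : Prop :=
  ∃ D : Set (s.chain.space p), IsOpen D ∧ (∀ x, s.lev p x ∈ D ↔ x ∈ V) ∧
    ∃ f : s.chain.space p → s₁.chain.space q →L[𝕜] s₂.chain.space j,
      ContinuousOn (fun z : s.chain.space p × s₁.chain.space q => f z.1 z.2) (D ×ˢ univ) ∧
      ∀ x ∈ V, ∀ u, f (s.lev p x) (s₁.lev q u) = s₂.lev j (φ x u)

theorem LevelExt.mono {φ : E → E₁ →ₗ[𝕜] E₂} {p q j p' q' j' : ℕ}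
    (h : LevelExt s s₁ s₂ V φ p q j) (hp : p ≤ p') (hq : q ≤ q') (hj : j' ≤ j) :
    LevelExt s s₁ s₂ V φ p' q' j' := by
  obtain ⟨D, hD, hDV, f, hf, hfφ⟩ := h
  refine ⟨s.chain.incl hp ⁻¹' D, hD.preimage (ContinuousLinearMap.continuous _), fun x => ?_,
    fun x => ((s₂.chain.incl hj).comp (f (s.chain.incl hp x))).comp (s₁.chain.incl hq), ?_,
    fun x hx u => ?_⟩
  · rw [mem_preimage, incl_lev, hDV]
  · refine (s₂.chain.incl hj).continuous.comp_continuousOn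
      (hf.comp (f := fun z : s.chain.space p' × s₁.chain.space q' =>
        (s.chain.incl hp z.1, s₁.chain.incl hq z.2)) (by fun_prop) ?_)
    rintro ⟨x, u⟩ ⟨hx, -⟩
    exact ⟨hx, trivial⟩
  · simp [hfφ x hx u]

theorem LevelExt.ball {φ : E → E₁ →ₗ[𝕜] E₂} {p q j m : ℕ} {ε : ℝ}
    (h : LevelExt s s₁ s₂ V φ p q j) (hm : m ≤ p) (hV : s.ball m x₀ ε ⊆ V) :
    LevelExt s s₁ s₂ (s.ball m x₀ ε) φ p q j := by
  obtain ⟨D, hD, hDV, f, hf, hfφ⟩ := h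
  refine ⟨D ∩ {x | ‖s.chain.incl hm x - s.lev m x₀‖ < ε},
    hD.inter (isOpen_lt (by fun_prop) continuous_const), fun x => ?_, f,
    hf.mono (prod_mono inter_subset_left subset_rfl), fun x hx u => hfφ x (hV hx) u⟩
  simp only [mem_inter_iff, hDV, mem_ofPred_eq, incl_lev]
  exact ⟨fun h => h.2, fun h => ⟨hV h, h⟩⟩

theorem LevelExt.comp {φ : E → E₁ →ₗ[𝕜] E₂} {ψ : E → E₂ →ₗ[𝕜] E₃} {p q j k : ℕ}
    (hψ : LevelExt s s₂ s₃ V ψ p j k) (hφ : LevelExt s s₁ s₂ V φ p q j) :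
    LevelExt s s₁ s₃ V (fun x => ψ x ∘ₗ φ x) p q k := by
  obtain ⟨D, hD, hDV, f, hf, hfφ⟩ := hφ
  obtain ⟨D', hD', hDV', g, hg, hgψ⟩ := hψ
  refine ⟨D ∩ D', hD.inter hD', fun x => by simp [hDV, hDV'], fun x => (g x).comp (f x), ?_,
    fun x hx u => by simp [hfφ x hx, hgψ x hx]⟩
  refine hg.comp (f := fun z : s.chain.space p × s₁.chain.space q => (z.1, f z.1 z.2))
    (continuousOn_fst.prodMk (hf.mono (prod_mono inter_subset_left subset_rfl))) ?_
  rintro ⟨x, u⟩ ⟨hx, -⟩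
  exact ⟨hx.2, trivial⟩

theorem LevelExt.add {φ φ' : E → E₁ →ₗ[𝕜] E₂} {p q j : ℕ} (hφ : LevelExt s s₁ s₂ V φ p q j)
    (hφ' : LevelExt s s₁ s₂ V φ' p q j) :
    LevelExt s s₁ s₂ V (fun x => φ x + φ' x) p q j := by
  obtain ⟨D, hD, hDV, f, hf, hfφ⟩ := hφ
  obtain ⟨D', hD', hDV', g, hg, hgψ⟩ := hφ'
  refine ⟨D ∩ D', hD.inter hD', fun x => by simp [hDV, hDV'], fun x => f x + g x, ?_,
    fun x hx u => by simp [hfφ x hx, hgψ x hx]⟩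
  exact (hf.mono (prod_mono inter_subset_left subset_rfl)).add
    (hg.mono (prod_mono inter_subset_right subset_rfl))

theorem LevelExt.neg {φ : E → E₁ →ₗ[𝕜] E₂} {p q j : ℕ} (hφ : LevelExt s s₁ s₂ V φ p q j) :
    LevelExt s s₁ s₂ V (fun x => -φ x) p q j := by
  obtain ⟨D, hD, hDV, f, hf, hfφ⟩ := hφ
  exact ⟨D, hD, hDV, fun x => -f x, hf.neg, fun x hx u => by simp [hfφ x hx]⟩

theorem LevelExt.const {T : E₁ →ₗ[𝕜] E₂} {p q j m : ℕ} (hT : IsBdd s₁ s₂ T q j) (hm : m ≤ p)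
    (x₀ : E) (ε : ℝ) : LevelExt s s₁ s₂ (s.ball m x₀ ε) (fun _ => T) p q j := by
  obtain ⟨f, hf⟩ := hT.exists_clm
  refine LevelExt.ball (V := univ) ?_ hm (subset_univ _)
  exact ⟨univ, isOpen_univ, fun x => by simp, fun _ => f, by fun_prop, fun x _ u => hf u⟩

theorem LevelExt.isBdd {φ : E → E₁ →ₗ[𝕜] E₂} {p q j : ℕ} (hφ : LevelExt s s₁ s₂ V φ p q j)
    {x : E} (hx : x ∈ V) : IsBdd s₁ s₂ (φ x) q j := by
  obtain ⟨D, hD, hDV, f, hf, hfφ⟩ := hφ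
  exact .of_clm (f (s.lev p x)) (hfφ x hx)

/-- Change of the structure on the parameter space. -/
theorem LevelExt.change_base {s' : ScStructure 𝕜 E} {φ : E → E₁ →ₗ[𝕜] E₂} {p q j p' : ℕ}
    (hφ : LevelExt s s₁ s₂ V φ p q j) (h : IsBdd s' s LinearMap.id p' p) :
    LevelExt s' s₁ s₂ V φ p' q j := by
  obtain ⟨D, hD, hDV, f, hf, hfφ⟩ := hφ
  obtain ⟨A, hA⟩ := h.exists_clm
  refine ⟨A ⁻¹' D, hD.preimage A.continuous, fun x => ?_, fun x => f (A x), ?_, fun x hx u => ?_⟩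
  · rw [mem_preimage, hA, LinearMap.id_apply, hDV]
  · refine hf.comp (f := fun z : s'.chain.space p' × s₁.chain.space q => (A z.1, z.2))
      (by fun_prop) ?_
    rintro ⟨x, u⟩ ⟨hx, -⟩
    exact ⟨hx, trivial⟩
  · change f (A (s'.lev p' x)) _ = _
    rw [hA, LinearMap.id_apply, hfφ x hx]

/-- A (tame) family of morphisms over `V`, with loss of derivatives given by `a`. -/
structure FamOn (c : ScContext) (s : ScStructure 𝕜 E) (s₁ : ScStructure 𝕜 E₁)
    (s₂ : ScStructure 𝕜 E₂) (V : Set E) (φ : E → E₁ →ₗ[𝕜] E₂) (a : ℕ → ℕ) : Prop where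
  levelExt : ∀ j, LevelExt s s₁ s₂ V φ (a j) (a j) j
  tame : c = ScContext.tame → ∀ j, ∃ C ≥ 0, ∀ x ∈ V, ∀ u,
    ‖s₂.lev j (φ x u)‖ ≤ C * (‖s₁.lev (a j) u‖ + ‖s.lev (a j) x‖ * ‖s₁.lev (a 0) u‖)

/-- A (tame) strongly smoothing family of morphisms over `V`. -/
structure SmoothOn (c : ScContext) (s : ScStructure 𝕜 E) (s₁ : ScStructure 𝕜 E₁)
    (s₂ : ScStructure 𝕜 E₂) (V : Set E) (φ : E → E₁ →ₗ[𝕜] E₂) (a : ℕ → ℕ) : Prop where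
  levelExt : ∀ j, LevelExt s s₁ s₂ V φ (a j) (a 0) j
  tame : c = ScContext.tame → ∀ j, ∃ C ≥ 0, ∀ x ∈ V, ∀ u,
    ‖s₂.lev j (φ x u)‖ ≤ C * ((1 + ‖s.lev (a j) x‖) * ‖s₁.lev (a 0) u‖)

/-- Germs at `x₀` of (tame) families of morphisms. -/
def FamNear (c : ScContext) (s : ScStructure 𝕜 E) (s₁ : ScStructure 𝕜 E₁)
    (s₂ : ScStructure 𝕜 E₂) (x₀ : E) (φ : E → E₁ →ₗ[𝕜] E₂) : Prop :=
  ∃ a, c.IsRescaling a ∧ ∃ ε > 0, FamOn c s s₁ s₂ (s.ball (a 0) x₀ ε) φ a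

/-- Germs at `x₀` of (tame) strongly smoothing families of morphisms. -/
def SmoothNear (c : ScContext) (s : ScStructure 𝕜 E) (s₁ : ScStructure 𝕜 E₁)
    (s₂ : ScStructure 𝕜 E₂) (x₀ : E) (φ : E → E₁ →ₗ[𝕜] E₂) : Prop :=
  ∃ a, c.IsRescaling a ∧ ∃ ε > 0, SmoothOn c s s₁ s₂ (s.ball (a 0) x₀ ε) φ a

theorem FamOn.mono {φ : E → E₁ →ₗ[𝕜] E₂} {a a' : ℕ → ℕ} {m : ℕ} {ε : ℝ}
    (h : FamOn c s s₁ s₂ V φ a) (ha' : c.IsRescaling a') (haa' : ∀ j, a j ≤ a' j) (hm : m ≤ a' 0)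
    (hV : s.ball m x₀ ε ⊆ V) : FamOn c s s₁ s₂ (s.ball m x₀ ε) φ a' := by
  refine ⟨fun j => ((h.levelExt j).mono (haa' j) (haa' j) le_rfl).ball
    (hm.trans (ha'.mono (Nat.zero_le j))) hV, fun hc j => ?_⟩
  obtain ⟨C, hC0, hC⟩ := h.tame hc j
  refine ⟨C, hC0, fun x hx u => (hC x (hV hx) u).trans ?_⟩
  gcongr
  · exact s₁.norm_lev_mono (haa' j) u
  · exact s.norm_lev_mono (haa' j) x
  · exact s₁.norm_lev_mono (haa' 0) u

theorem SmoothOn.mono {φ : E → E₁ →ₗ[𝕜] E₂} {a a' : ℕ → ℕ} {m : ℕ} {ε : ℝ}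
    (h : SmoothOn c s s₁ s₂ V φ a) (ha' : c.IsRescaling a') (haa' : ∀ j, a j ≤ a' j)
    (hm : m ≤ a' 0) (hV : s.ball m x₀ ε ⊆ V) : SmoothOn c s s₁ s₂ (s.ball m x₀ ε) φ a' := by
  refine ⟨fun j => ((h.levelExt j).mono (haa' j) (haa' 0) le_rfl).ball
    (hm.trans (ha'.mono (Nat.zero_le j))) hV, fun hc j => ?_⟩
  obtain ⟨C, hC0, hC⟩ := h.tame hc j
  refine ⟨C, hC0, fun x hx u => (hC x (hV hx) u).trans ?_⟩
  gcongr
  · exact s.norm_lev_mono (haa' j) x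
  · exact s₁.norm_lev_mono (haa' 0) u

theorem SmoothOn.famOn {φ : E → E₁ →ₗ[𝕜] E₂} {a : ℕ → ℕ} (ha : c.IsRescaling a)
    (h : SmoothOn c s s₁ s₂ V φ a) : FamOn c s s₁ s₂ V φ a := by
  refine ⟨fun j => (h.levelExt j).mono le_rfl (ha.mono (Nat.zero_le j)) le_rfl, fun hc j => ?_⟩
  obtain ⟨C, hC0, hC⟩ := h.tame hc j
  refine ⟨C, hC0, fun x hx u => (hC x hx u).trans ?_⟩
  rw [add_mul, one_mul]
  gcongr
  exact s₁.norm_lev_mono (ha.mono (Nat.zero_le j)) u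

theorem SmoothNear.famNear {φ : E → E₁ →ₗ[𝕜] E₂} (h : SmoothNear c s s₁ s₂ x₀ φ) :
    FamNear c s s₁ s₂ x₀ φ := by
  obtain ⟨a, ha, ε, hε, h⟩ := h
  exact ⟨a, ha, ε, hε, h.famOn ha⟩

theorem norm_lev_le_of_mem_ball {m : ℕ} {ε : ℝ} {x : E} (hx : x ∈ s.ball m x₀ ε) :
    ‖s.lev m x‖ ≤ ‖s.lev m x₀‖ + ε := by
  have h1 : ‖s.lev m x - s.lev m x₀‖ < ε := hx
  have h2 := norm_le_norm_add_norm_sub' (s.lev m x) (s.lev m x₀)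
  linarith

/-- The shape of the tame estimate is stable under composition because low norms of `x` are bounded
by a constant `M` on the ball. The term `‖x‖ * ‖φ x u‖` pairs a high norm of `x` with a low norm of
`φ x u`, and the latter is at most a constant times a low norm of `u`; products of two high norms
never occur. -/
theorem FamNear.comp {φ : E → E₁ →ₗ[𝕜] E₂} {ψ : E → E₂ →ₗ[𝕜] E₃}
    (hψ : FamNear c s s₂ s₃ x₀ ψ) (hφ : FamNear c s s₁ s₂ x₀ φ) :
    FamNear c s s₁ s₃ x₀ (fun x => ψ x ∘ₗ φ x) := by
  obtain ⟨a₁, ha₁, ε₁, hε₁, h₁⟩ := hφ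
  obtain ⟨a₂, ha₂, ε₂, hε₂, h₂⟩ := hψ
  have ha := ha₁.sup ha₂
  set a := fun j => max (a₁ j) (a₂ j) with ha_def
  have haa : ∀ j, a j ≤ a (a j) := fun j => ha.le_apply _
  have h₁'' : ∀ j, LevelExt s s₁ s₂ (s.ball (a (a 0)) x₀ (min ε₁ ε₂)) φ (a (a j)) (a (a j)) (a j) :=
    fun j => ((h₁.levelExt (a j)).mono (le_max_left _ _) (le_max_left _ _) le_rfl).ball
      (ha.mono (ha.mono (Nat.zero_le j)))
      (s.ball_subset ((le_max_left _ _).trans (haa 0)) x₀ (min_le_left _ _))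
  have hsub₂ : s.ball (a (a 0)) x₀ (min ε₁ ε₂) ⊆ s.ball (a₂ 0) x₀ ε₂ :=
    s.ball_subset ((le_max_right _ _).trans (haa 0)) x₀ (min_le_right _ _)
  have hsub₁ : s.ball (a (a 0)) x₀ (min ε₁ ε₂) ⊆ s.ball (a₁ 0) x₀ ε₁ :=
    s.ball_subset ((le_max_left _ _).trans (haa 0)) x₀ (min_le_left _ _)
  have h₂' : ∀ j, LevelExt s s₂ s₃ (s.ball (a (a 0)) x₀ (min ε₁ ε₂)) ψ (a (a j)) (a j) j :=
    fun j => ((h₂.levelExt j).mono ((le_max_right _ _).trans (haa j)) (le_max_right _ _)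
      le_rfl).ball (ha.mono (ha.mono (Nat.zero_le j))) hsub₂
  refine ⟨_, ha.comp ha, min ε₁ ε₂, lt_min hε₁ hε₂, fun j => (h₂' j).comp (h₁'' j),
    fun hc j => ?_⟩
  obtain ⟨C, hC0, hC⟩ := h₂.tame hc j
  obtain ⟨C₁, hC₁0, hC₁⟩ := h₁.tame hc (a j)
  obtain ⟨C₂, hC₂0, hC₂⟩ := h₁.tame hc (a 0)
  set M := ‖s.lev (a (a 0)) x₀‖ + min ε₁ ε₂ with hM
  have hM0 : 0 ≤ M := add_nonneg (norm_nonneg _) (lt_min hε₁ hε₂).le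
  refine ⟨C * (C₁ + C₂ * (1 + M)), by positivity, fun x hx u => ?_⟩
  have hxM : ‖s.lev (a (a 0)) x‖ ≤ M := norm_lev_le_of_mem_ball hx
  have e0 : ‖s₁.lev (a₁ 0) u‖ ≤ ‖s₁.lev (a (a 0)) u‖ :=
    s₁.norm_lev_mono ((le_max_left _ _).trans (haa 0)) u
  have e1 : ‖s₂.lev (a₂ j) (φ x u)‖ ≤
      C₁ * (‖s₁.lev (a (a j)) u‖ + ‖s.lev (a (a j)) x‖ * ‖s₁.lev (a (a 0)) u‖) := by
    refine (s₂.norm_lev_mono (le_max_right (a₁ j) (a₂ j)) _).trans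
      ((hC₁ x (hsub₁ hx) u).trans ?_)
    gcongr
    · exact s₁.norm_lev_mono (le_max_left _ _) u
    · exact s.norm_lev_mono (le_max_left _ _) x
  have e2 : ‖s₂.lev (a₂ 0) (φ x u)‖ ≤ C₂ * ((1 + M) * ‖s₁.lev (a (a 0)) u‖) := by
    refine (s₂.norm_lev_mono (le_max_right (a₁ 0) (a₂ 0)) _).trans
      ((hC₂ x (hsub₁ hx) u).trans ?_)
    rw [add_mul, one_mul]
    gcongr
    · exact s₁.norm_lev_mono (le_max_left _ _) u
    · exact (s.norm_lev_mono (le_max_left _ _) x).trans hxM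
  have e3 : ‖s.lev (a₂ j) x‖ ≤ ‖s.lev (a (a j)) x‖ :=
    s.norm_lev_mono ((le_max_right _ _).trans (haa j)) x
  calc ‖s₃.lev j (ψ x (φ x u))‖
      ≤ C * (‖s₂.lev (a₂ j) (φ x u)‖ + ‖s.lev (a₂ j) x‖ * ‖s₂.lev (a₂ 0) (φ x u)‖) :=
        hC x (hsub₂ hx) _
    _ ≤ C * (C₁ * (‖s₁.lev (a (a j)) u‖ + ‖s.lev (a (a j)) x‖ * ‖s₁.lev (a (a 0)) u‖) +
          ‖s.lev (a (a j)) x‖ * (C₂ * ((1 + M) * ‖s₁.lev (a (a 0)) u‖))) := by gcongr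
    _ ≤ C * (C₁ * (‖s₁.lev (a (a j)) u‖ + ‖s.lev (a (a j)) x‖ * ‖s₁.lev (a (a 0)) u‖) +
          C₂ * (1 + M) * (‖s₁.lev (a (a j)) u‖ +
            ‖s.lev (a (a j)) x‖ * ‖s₁.lev (a (a 0)) u‖)) := by
        have : 0 ≤ C₂ * (1 + M) * ‖s₁.lev (a (a j)) u‖ := by positivity
        refine mul_le_mul_of_nonneg_left ?_ hC0
        linarith
    _ = _ := by ring

/-- The smoothing factor reads only one fixed level of `φ x u`, whatever the target level is, so `φ`
is needed at that single level and the source level of the composition stays fixed. -/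
theorem SmoothNear.comp_fam {φ : E → E₁ →ₗ[𝕜] E₂} {κ : E → E₂ →ₗ[𝕜] E₃}
    (hκ : SmoothNear c s s₂ s₃ x₀ κ) (hφ : FamNear c s s₁ s₂ x₀ φ) :
    SmoothNear c s s₁ s₃ x₀ (fun x => κ x ∘ₗ φ x) := by
  obtain ⟨a₁, ha₁, ε₁, hε₁, h₁⟩ := hφ
  obtain ⟨a₂, ha₂, ε₂, hε₂, h₂⟩ := hκ
  have ha := ha₁.sup ha₂
  set a := fun j => max (a₁ j) (a₂ j) with ha_def
  have haa : ∀ j, a j ≤ a (a j) := fun j => ha.le_apply _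
  have hsub₂ : s.ball (a (a 0)) x₀ (min ε₁ ε₂) ⊆ s.ball (a₂ 0) x₀ ε₂ :=
    s.ball_subset ((le_max_right _ _).trans (haa 0)) x₀ (min_le_right _ _)
  have hsub₁ : s.ball (a (a 0)) x₀ (min ε₁ ε₂) ⊆ s.ball (a₁ 0) x₀ ε₁ :=
    s.ball_subset ((le_max_left _ _).trans (haa 0)) x₀ (min_le_left _ _)
  have haj : ∀ j, a (a 0) ≤ a (a j) := fun j => ha.mono (ha.mono (Nat.zero_le j))
  refine ⟨_, ha.comp ha, min ε₁ ε₂, lt_min hε₁ hε₂, fun j => ?_, fun hc j => ?_⟩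
  · refine LevelExt.comp (j := a 0)
      (((h₂.levelExt j).mono ((le_max_right _ _).trans (haa j)) (le_max_right _ _)
        le_rfl).ball (haj j) hsub₂) ?_
    exact ((h₁.levelExt (a 0)).mono ((le_max_left _ _).trans (haj j)) (le_max_left _ _)
      le_rfl).ball (haj j) hsub₁
  · obtain ⟨C, hC0, hC⟩ := h₂.tame hc j
    obtain ⟨C₂, hC₂0, hC₂⟩ := h₁.tame hc (a 0)
    set M := ‖s.lev (a (a 0)) x₀‖ + min ε₁ ε₂ with hM
    have hM0 : 0 ≤ M := add_nonneg (norm_nonneg _) (lt_min hε₁ hε₂).le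
    refine ⟨C * (C₂ * (1 + M)), by positivity, fun x hx u => ?_⟩
    have hxM : ‖s.lev (a (a 0)) x‖ ≤ M := norm_lev_le_of_mem_ball hx
    have e0 : ‖s₁.lev (a₁ 0) u‖ ≤ ‖s₁.lev (a (a 0)) u‖ :=
      s₁.norm_lev_mono ((le_max_left _ _).trans (haa 0)) u
    have e2 : ‖s₂.lev (a₂ 0) (φ x u)‖ ≤ C₂ * ((1 + M) * ‖s₁.lev (a (a 0)) u‖) := by
      refine (s₂.norm_lev_mono (le_max_right (a₁ 0) (a₂ 0)) _).trans
        ((hC₂ x (hsub₁ hx) u).trans ?_)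
      rw [add_mul, one_mul]
      gcongr
      · exact s₁.norm_lev_mono (le_max_left _ _) u
      · exact (s.norm_lev_mono (le_max_left _ _) x).trans hxM
    have e3 : ‖s.lev (a₂ j) x‖ ≤ ‖s.lev (a (a j)) x‖ :=
      s.norm_lev_mono ((le_max_right _ _).trans (haa j)) x
    calc ‖s₃.lev j (κ x (φ x u))‖
        ≤ C * ((1 + ‖s.lev (a₂ j) x‖) * ‖s₂.lev (a₂ 0) (φ x u)‖) := hC x (hsub₂ hx) _
      _ ≤ C * ((1 + ‖s.lev (a (a j)) x‖) * (C₂ * ((1 + M) * ‖s₁.lev (a (a 0)) u‖))) := by gcongr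
      _ = _ := by ring

/-- The smoothing factor reaches every level from one source level, so the loss of derivatives of
`φ` costs nothing in `u`; it only raises the norm of `x`. -/
theorem FamNear.comp_smooth {κ : E → E₁ →ₗ[𝕜] E₂} {φ : E → E₂ →ₗ[𝕜] E₃}
    (hφ : FamNear c s s₂ s₃ x₀ φ) (hκ : SmoothNear c s s₁ s₂ x₀ κ) :
    SmoothNear c s s₁ s₃ x₀ (fun x => φ x ∘ₗ κ x) := by
  obtain ⟨a₁, ha₁, ε₁, hε₁, h₁⟩ := hκ
  obtain ⟨a₂, ha₂, ε₂, hε₂, h₂⟩ := hφ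
  have ha := ha₁.sup ha₂
  set a := fun j => max (a₁ j) (a₂ j) with ha_def
  have haa : ∀ j, a j ≤ a (a j) := fun j => ha.le_apply _
  have hsub₂ : s.ball (a (a 0)) x₀ (min ε₁ ε₂) ⊆ s.ball (a₂ 0) x₀ ε₂ :=
    s.ball_subset ((le_max_right _ _).trans (haa 0)) x₀ (min_le_right _ _)
  have hsub₁ : s.ball (a (a 0)) x₀ (min ε₁ ε₂) ⊆ s.ball (a₁ 0) x₀ ε₁ :=
    s.ball_subset ((le_max_left _ _).trans (haa 0)) x₀ (min_le_left _ _)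
  have haj : ∀ j, a (a 0) ≤ a (a j) := fun j => ha.mono (ha.mono (Nat.zero_le j))
  refine ⟨_, ha.comp ha, min ε₁ ε₂, lt_min hε₁ hε₂, fun j => ?_, fun hc j => ?_⟩
  · refine LevelExt.comp (j := a j)
      (((h₂.levelExt j).mono ((le_max_right _ _).trans (haa j)) (le_max_right _ _)
        le_rfl).ball (haj j) hsub₂) ?_
    exact ((h₁.levelExt (a j)).mono (le_max_left _ _) ((le_max_left _ _).trans (haa 0))
      le_rfl).ball (haj j) hsub₁
  · obtain ⟨C, hC0, hC⟩ := h₂.tame hc j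
    obtain ⟨C₁, hC₁0, hC₁⟩ := h₁.tame hc (a j)
    obtain ⟨C₂, hC₂0, hC₂⟩ := h₁.tame hc (a 0)
    set M := ‖s.lev (a (a 0)) x₀‖ + min ε₁ ε₂ with hM
    have hM0 : 0 ≤ M := add_nonneg (norm_nonneg _) (lt_min hε₁ hε₂).le
    refine ⟨C * (C₁ + C₂ * (1 + M)), by positivity, fun x hx u => ?_⟩
    have hxM : ‖s.lev (a (a 0)) x‖ ≤ M := norm_lev_le_of_mem_ball hx
    have e0 : ‖s₁.lev (a₁ 0) u‖ ≤ ‖s₁.lev (a (a 0)) u‖ :=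
      s₁.norm_lev_mono ((le_max_left _ _).trans (haa 0)) u
    have e1 : ‖s₂.lev (a₂ j) (κ x u)‖ ≤
        C₁ * ((1 + ‖s.lev (a (a j)) x‖) * ‖s₁.lev (a (a 0)) u‖) := by
      refine (s₂.norm_lev_mono (le_max_right (a₁ j) (a₂ j)) _).trans
        ((hC₁ x (hsub₁ hx) u).trans ?_)
      gcongr
      exact s.norm_lev_mono (le_max_left _ _) x
    have e2 : ‖s₂.lev (a₂ 0) (κ x u)‖ ≤ C₂ * ((1 + M) * ‖s₁.lev (a (a 0)) u‖) := by
      refine (s₂.norm_lev_mono (le_max_right (a₁ 0) (a₂ 0)) _).trans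
        ((hC₂ x (hsub₁ hx) u).trans ?_)
      gcongr
      exact (s.norm_lev_mono (le_max_left _ _) x).trans hxM
    have e3 : ‖s.lev (a₂ j) x‖ ≤ ‖s.lev (a (a j)) x‖ :=
      s.norm_lev_mono ((le_max_right _ _).trans (haa j)) x
    calc ‖s₃.lev j (φ x (κ x u))‖
        ≤ C * (‖s₂.lev (a₂ j) (κ x u)‖ + ‖s.lev (a₂ j) x‖ * ‖s₂.lev (a₂ 0) (κ x u)‖) :=
          hC x (hsub₂ hx) _
      _ ≤ C * (C₁ * ((1 + ‖s.lev (a (a j)) x‖) * ‖s₁.lev (a (a 0)) u‖) +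
            ‖s.lev (a (a j)) x‖ * (C₂ * ((1 + M) * ‖s₁.lev (a (a 0)) u‖))) := by gcongr
      _ ≤ C * (C₁ * ((1 + ‖s.lev (a (a j)) x‖) * ‖s₁.lev (a (a 0)) u‖) +
            (1 + ‖s.lev (a (a j)) x‖) * (C₂ * ((1 + M) * ‖s₁.lev (a (a 0)) u‖))) := by
          gcongr
          linarith
      _ = _ := by ring

theorem FamNear.add {φ ψ : E → E₁ →ₗ[𝕜] E₂} (hφ : FamNear c s s₁ s₂ x₀ φ)
    (hψ : FamNear c s s₁ s₂ x₀ ψ) : FamNear c s s₁ s₂ x₀ (fun x => φ x + ψ x) := by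
  obtain ⟨a₁, ha₁, ε₁, hε₁, h₁⟩ := hφ
  obtain ⟨a₂, ha₂, ε₂, hε₂, h₂⟩ := hψ
  have h₁' := h₁.mono (ha₁.sup ha₂) (fun j => le_max_left _ _) le_rfl
    (s.ball_subset (le_max_left (a₁ 0) (a₂ 0)) x₀ (min_le_left ε₁ ε₂))
  have h₂' := h₂.mono (ha₁.sup ha₂) (fun j => le_max_right _ _) le_rfl
    (s.ball_subset (le_max_right (a₁ 0) (a₂ 0)) x₀ (min_le_right ε₁ ε₂))
  refine ⟨_, ha₁.sup ha₂, min ε₁ ε₂, lt_min hε₁ hε₂,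
    fun j => (h₁'.levelExt j).add (h₂'.levelExt j), fun hc j => ?_⟩
  obtain ⟨C₁, hC₁0, hC₁⟩ := h₁'.tame hc j
  obtain ⟨C₂, hC₂0, hC₂⟩ := h₂'.tame hc j
  refine ⟨C₁ + C₂, by positivity, fun x hx u => ?_⟩
  rw [LinearMap.add_apply, map_add, add_mul]
  exact (norm_add_le _ _).trans (add_le_add (hC₁ x hx u) (hC₂ x hx u))

theorem SmoothNear.add {φ ψ : E → E₁ →ₗ[𝕜] E₂} (hφ : SmoothNear c s s₁ s₂ x₀ φ)
    (hψ : SmoothNear c s s₁ s₂ x₀ ψ) : SmoothNear c s s₁ s₂ x₀ (fun x => φ x + ψ x) := by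
  obtain ⟨a₁, ha₁, ε₁, hε₁, h₁⟩ := hφ
  obtain ⟨a₂, ha₂, ε₂, hε₂, h₂⟩ := hψ
  have h₁' := h₁.mono (ha₁.sup ha₂) (fun j => le_max_left _ _) le_rfl
    (s.ball_subset (le_max_left (a₁ 0) (a₂ 0)) x₀ (min_le_left ε₁ ε₂))
  have h₂' := h₂.mono (ha₁.sup ha₂) (fun j => le_max_right _ _) le_rfl
    (s.ball_subset (le_max_right (a₁ 0) (a₂ 0)) x₀ (min_le_right ε₁ ε₂))
  refine ⟨_, ha₁.sup ha₂, min ε₁ ε₂, lt_min hε₁ hε₂,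
    fun j => (h₁'.levelExt j).add (h₂'.levelExt j), fun hc j => ?_⟩
  obtain ⟨C₁, hC₁0, hC₁⟩ := h₁'.tame hc j
  obtain ⟨C₂, hC₂0, hC₂⟩ := h₂'.tame hc j
  refine ⟨C₁ + C₂, by positivity, fun x hx u => ?_⟩
  rw [LinearMap.add_apply, map_add, add_mul]
  exact (norm_add_le _ _).trans (add_le_add (hC₁ x hx u) (hC₂ x hx u))

theorem SmoothNear.neg {φ : E → E₁ →ₗ[𝕜] E₂} (hφ : SmoothNear c s s₁ s₂ x₀ φ) :
    SmoothNear c s s₁ s₂ x₀ (fun x => -φ x) := by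
  obtain ⟨a, ha, ε, hε, h⟩ := hφ
  refine ⟨a, ha, ε, hε, fun j => (h.levelExt j).neg, fun hc j => ?_⟩
  obtain ⟨C, hC0, hC⟩ := h.tame hc j
  refine ⟨C, hC0, fun x hx u => ?_⟩
  rw [LinearMap.neg_apply, map_neg, norm_neg]
  exact hC x hx u

theorem IsMor.famNear {T : E₁ →ₗ[𝕜] E₂} (hT : IsMor c s₁ s₂ T) (s : ScStructure 𝕜 E) (x₀ : E) :
    FamNear c s s₁ s₂ x₀ (fun _ => T) := by
  obtain ⟨a, ha, h⟩ := hT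
  refine ⟨a, ha, 1, one_pos, fun j => LevelExt.const (h j) (ha.mono (Nat.zero_le j)) x₀ 1,
    fun _ j => ?_⟩
  obtain ⟨C, hC0, hC⟩ := (h j).exists_pos
  refine ⟨C, hC0.le, fun x _ u => (hC u).trans ?_⟩
  gcongr
  exact le_add_of_nonneg_right (by positivity)

theorem IsSmoothing.smoothNear {T : E₁ →ₗ[𝕜] E₂} (hT : IsSmoothing s₁ s₂ T) (c : ScContext)
    (s : ScStructure 𝕜 E) (x₀ : E) : SmoothNear c s s₁ s₂ x₀ (fun _ => T) := by
  obtain ⟨b, h⟩ := hT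
  have hb : ∀ j, IsBdd s₁ s₂ T (0 + b) j := fun j => (h j).mono (by omega) le_rfl
  refine ⟨_, .shift c b, 1, one_pos, fun j => LevelExt.const (hb j) (by omega) x₀ 1,
    fun _ j => ?_⟩
  obtain ⟨C, hC0, hC⟩ := (hb j).exists_pos
  refine ⟨C, hC0.le, fun x _ u => (hC u).trans ?_⟩
  gcongr
  exact le_mul_of_one_le_left (norm_nonneg _) (le_add_of_nonneg_right (norm_nonneg _))

theorem FamNear.isMor {φ : E → E₁ →ₗ[𝕜] E₂} (hφ : FamNear c s s₁ s₂ x₀ φ) :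
    IsMor c s₁ s₂ (φ x₀) := by
  obtain ⟨a, ha, ε, hε, hφ⟩ := hφ
  exact ⟨a, ha, fun j => (hφ.levelExt j).isBdd (s.mem_ball_self _ _ hε)⟩

theorem SmoothNear.isSmoothing {φ : E → E₁ →ₗ[𝕜] E₂} (hφ : SmoothNear c s s₁ s₂ x₀ φ) :
    IsSmoothing s₁ s₂ (φ x₀) := by
  obtain ⟨a, ha, ε, hε, hφ⟩ := hφ
  exact ⟨a 0, fun j => (hφ.levelExt j).isBdd (s.mem_ball_self _ _ hε)⟩

end ScStructure

/-! ### From local envelopes to bounded operators on the levels. -/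

/-- A map that is linear near the origin agrees there with a linear map. -/
theorem exists_linearMap_eq_on_ball {𝕜 F G : Type*} [RCLike 𝕜] [NormedAddCommGroup F]
    [NormedSpace 𝕜 F] [AddCommGroup G] [Module 𝕜 G] (g : F → G) {δ : ℝ} (hδ : 0 < δ)
    (hadd : ∀ u v, ‖u‖ < δ → ‖v‖ < δ → ‖u + v‖ < δ → g (u + v) = g u + g v)
    (hsmul : ∀ (α : 𝕜) u, ‖u‖ < δ → ‖α • u‖ < δ → g (α • u) = α • g u) :
    ∃ L : F →ₗ[𝕜] G, ∀ u, ‖u‖ < δ → L u = g u := by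
  -- The scalar `r M` brings all vectors of norm at most `M` into the ball; it is `δ / (|M| + 1)`.
  have hr : ∀ M : ℝ, ∃ r : 𝕜, r ≠ 0 ∧ ∀ u : F, ‖u‖ ≤ M → ‖r • u‖ < δ := by
    intro M
    have hM : 0 < |M| + 1 := by positivity
    refine ⟨((δ / (|M| + 1) : ℝ) : 𝕜), ?_, fun u hu => ?_⟩
    · exact_mod_cast (div_pos hδ hM).ne'
    · rw [norm_smul, RCLike.norm_ofReal, abs_of_pos (div_pos hδ hM), div_mul_eq_mul_div,
        div_lt_iff₀ hM]
      have : ‖u‖ < |M| + 1 := by linarith [le_abs_self M]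
      gcongr
  choose r hr0 hr using hr
  -- The value `ρ⁻¹ • g (ρ • u)` does not depend on the scalar `ρ`. To compare several vectors, one
  -- common scalar can therefore be used.
  have key : ∀ u : F, ∀ ρ : 𝕜, ρ ≠ 0 → ‖ρ • u‖ < δ →
      (r ‖u‖)⁻¹ • g (r ‖u‖ • u) = ρ⁻¹ • g (ρ • u) := by
    intro u ρ hρ hu
    have h1 := hsmul ((r ‖u‖) * ρ⁻¹) (ρ • u) hu (by
      rw [smul_smul, inv_mul_cancel_right₀ hρ]; exact hr _ _ le_rfl)
    rw [smul_smul, inv_mul_cancel_right₀ hρ] at h1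
    rw [h1, smul_smul, inv_mul_cancel_left₀ (hr0 _)]
  refine ⟨{ toFun := fun u => (r ‖u‖)⁻¹ • g (r ‖u‖ • u), map_add' := fun u v => ?_,
            map_smul' := fun α u => ?_ }, fun u hu => ?_⟩
  · set M := max ‖u‖ (max ‖v‖ ‖u + v‖)
    have hu := hr M u (le_max_left _ _)
    have hv := hr M v ((le_max_left _ _).trans (le_max_right _ _))
    have huv := hr M (u + v) ((le_max_right _ _).trans (le_max_right _ _))
    rw [key u _ (hr0 M) hu, key v _ (hr0 M) hv, key (u + v) _ (hr0 M) huv, smul_add (r M),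
      hadd _ _ hu hv (by rwa [← smul_add]), smul_add]
  · set M := max ‖u‖ ‖α • u‖
    have hu := hr M u (le_max_left _ _)
    have hv := hr M (α • u) (le_max_right _ _)
    rw [key u _ (hr0 M) hu, key (α • u) _ (hr0 M) hv, smul_comm (r M) α,
      hsmul _ _ hu (by rwa [smul_comm]), smul_comm]
    rfl
  · have := key u 1 one_ne_zero (by simpa using hu)
    simpa using this

namespace ScStructure

variable {𝕜 : Type w} [RCLike 𝕜]
variable {E : Type u} [AddCommGroup E] [Module 𝕜 E] [TopologicalSpace E]
variable {E₁ : Type u₁} [AddCommGroup E₁] [Module 𝕜 E₁] [TopologicalSpace E₁]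
variable {E₂ : Type u₂} [AddCommGroup E₂] [Module 𝕜 E₂] [TopologicalSpace E₂]
variable {s : ScStructure 𝕜 E} {s₁ : ScStructure 𝕜 E₁} {s₂ : ScStructure 𝕜 E₂}
  {c : ScContext} {V : Set E} {x₀ : E}

/-- An extension to some level that is defined near the zero section yields an extension by bounded
operators. -/
theorem levelExt_of_continuousOn {φ : E → E₁ →ₗ[𝕜] E₂} {m m' p q j : ℕ} {ε : ℝ} (hm : m ≤ p)
    (hm' : m' ≤ q)
    (hε : 0 < ε) {D : Set (s.chain.space p × s₁.chain.space q)} (hD : IsOpen D)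
    {g : s.chain.space p × s₁.chain.space q → s₂.chain.space j} (hg : ContinuousOn g D)
    (hV : ∀ x ∈ s.ball m x₀ ε, ∀ u, ‖s₁.lev m' u‖ < ε →
      (s.lev p x, s₁.lev q u) ∈ D ∧ g (s.lev p x, s₁.lev q u) = s₂.lev j (φ x u)) :
    LevelExt s s₁ s₂ (s.ball m x₀ ε) φ p q j := by
  classical
  -- The domain is cut down so that its points from the limit spaces are exactly the pairs for which
  -- `g` is known to agree with `φ`.
  set O : Set (s.chain.space p × s₁.chain.space q) :=
    D ∩ ({z | ‖s.chain.incl hm z.1 - s.lev m x₀‖ < ε} ∩ {z | ‖s₁.chain.incl hm' z.2‖ < ε}) with hO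
  have hOo : IsOpen O := hD.inter ((isOpen_lt (by fun_prop) continuous_const).inter
    (isOpen_lt (by fun_prop) continuous_const))
  have hgO : ContinuousOn g O := hg.mono inter_subset_left
  have hmem : ∀ x u, (s.lev p x, s₁.lev q u) ∈ O ↔ x ∈ s.ball m x₀ ε ∧ ‖s₁.lev m' u‖ < ε := by
    intro x u
    simp only [hO, mem_inter_iff, mem_ofPred_eq, incl_lev]
    exact ⟨fun h => h.2, fun h => ⟨(hV x h.1 u h.2).1, h⟩⟩
  have hgφ : ∀ x u, (s.lev p x, s₁.lev q u) ∈ O → g (s.lev p x, s₁.lev q u) = s₂.lev j (φ x u) :=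
    fun x u h => (hV x ((hmem x u).1 h).1 u ((hmem x u).1 h).2).2
  -- Homogeneity and, below, additivity of `g` hold at points of the limit because `φ x` is linear.
  -- They extend by density to the open sets on which both sides are defined.
  have hsmul : ∀ (α : 𝕜) (y : s.chain.space p) (u : s₁.chain.space q), (y, u) ∈ O →
      (y, α • u) ∈ O → g (y, α • u) = α • g (y, u) := by
    intro α y u h h'
    have hc : Continuous fun z : s.chain.space p × s₁.chain.space q => (z.1, α • z.2) := by
      fun_prop
    refine DenseRange.eqOn_of_isOpen ((s.lev_denseRange p).prodMap (s₁.lev_denseRange q))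
      (O := O ∩ (fun z => (z.1, α • z.2)) ⁻¹' O) (hOo.inter (hOo.preimage hc))
      (f := fun z => g (z.1, α • z.2)) (g := fun z => α • g z)
      (hgO.comp hc.continuousOn fun z hz => hz.2)
      ((hgO.mono inter_subset_left).const_smul α) ?_ (x := (y, u)) ⟨h, h'⟩
    rintro ⟨x, v⟩ ⟨h1, h2⟩
    change (s.lev p x, α • s₁.lev q v) ∈ O at h2
    change g (s.lev p x, α • s₁.lev q v) = α • g (s.lev p x, s₁.lev q v)
    rw [← map_smul] at h2 ⊢
    rw [hgφ _ _ h1, hgφ _ _ h2, map_smul, map_smul]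
  have hadd : ∀ (y : s.chain.space p) (u v : s₁.chain.space q), (y, u) ∈ O → (y, v) ∈ O →
      (y, u + v) ∈ O → g (y, u + v) = g (y, u) + g (y, v) := by
    intro y u v h h' h''
    have hc₁ : Continuous fun z : s.chain.space p × s₁.chain.space q × s₁.chain.space q =>
      (z.1, z.2.1) := by fun_prop
    have hc₂ : Continuous fun z : s.chain.space p × s₁.chain.space q × s₁.chain.space q =>
      (z.1, z.2.2) := by fun_prop
    have hc₃ : Continuous fun z : s.chain.space p × s₁.chain.space q × s₁.chain.space q =>
      (z.1, z.2.1 + z.2.2) := by fun_prop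
    refine DenseRange.eqOn_of_isOpen
      ((s.lev_denseRange p).prodMap ((s₁.lev_denseRange q).prodMap (s₁.lev_denseRange q)))
      (O := ((fun z => (z.1, z.2.1)) ⁻¹' O ∩ (fun z => (z.1, z.2.2)) ⁻¹' O) ∩
        (fun z => (z.1, z.2.1 + z.2.2)) ⁻¹' O)
      (((hOo.preimage hc₁).inter (hOo.preimage hc₂)).inter (hOo.preimage hc₃))
      (f := fun z => g (z.1, z.2.1 + z.2.2)) (g := fun z => g (z.1, z.2.1) + g (z.1, z.2.2))
      (hgO.comp hc₃.continuousOn fun z hz => hz.2)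
      ((hgO.comp hc₁.continuousOn fun z hz => hz.1.1).add
        (hgO.comp hc₂.continuousOn fun z hz => hz.1.2)) ?_ (x := (y, u, v)) ⟨⟨h, h'⟩, h''⟩
    rintro ⟨x, v, w⟩ ⟨⟨h1, h2⟩, h3⟩
    change (s.lev p x, s₁.lev q v) ∈ O at h1
    change (s.lev p x, s₁.lev q w) ∈ O at h2
    change (s.lev p x, s₁.lev q v + s₁.lev q w) ∈ O at h3
    change g (s.lev p x, s₁.lev q v + s₁.lev q w) =
      g (s.lev p x, s₁.lev q v) + g (s.lev p x, s₁.lev q w)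
    rw [← map_add] at h3 ⊢
    rw [hgφ _ _ h1, hgφ _ _ h2, hgφ _ _ h3, map_add, map_add]
  have hL : ∀ y : s.chain.space p, (y, 0) ∈ O → ∃ L : s₁.chain.space q →L[𝕜] s₂.chain.space j,
      ∀ v, (y, v) ∈ O → L v = g (y, v) := by
    intro y hy
    have hcy : Continuous fun v : s₁.chain.space q => (y, v) := by fun_prop
    obtain ⟨δ, hδ, hδO⟩ := Metric.isOpen_iff.1 (hOo.preimage hcy) 0 hy
    have hδO' : ∀ v, ‖v‖ < δ → (y, v) ∈ O := fun v hv => hδO (by simpa using hv)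
    obtain ⟨L, hL⟩ := exists_linearMap_eq_on_ball (𝕜 := 𝕜) (fun v => g (y, v)) hδ
      (fun u v hu hv huv => hadd y u v (hδO' _ hu) (hδO' _ hv) (hδO' _ huv))
      (fun α u hu hu' => hsmul α y u (hδO' _ hu) (hδO' _ hu'))
    have hLc : Continuous L := by
      refine continuous_of_continuousAt_zero L ?_
      have h1 : ContinuousAt (fun v => g (y, v)) 0 :=
        ContinuousAt.comp (x := (0 : s₁.chain.space q)) (hgO.continuousAt (hOo.mem_nhds hy))
          hcy.continuousAt
      refine h1.congr ?_
      filter_upwards [Metric.ball_mem_nhds (0 : s₁.chain.space q) hδ] with v hv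
      exact (hL v (by simpa using hv)).symm
    -- The slice of `O` over `y` need not be a ball. A point `v` of it is scaled into the small
    -- ball, where `L` and `g` agree, and homogeneity of `g` needs only the two endpoints to lie in
    -- `O`.
    refine ⟨⟨L, hLc⟩, fun v hv => ?_⟩
    obtain ⟨t, ht0, ht⟩ : ∃ t : 𝕜, t ≠ 0 ∧ ‖t • v‖ < δ := by
      have : Tendsto (fun t : 𝕜 => ‖t • v‖) (𝓝 0) (𝓝 0) := by
        have : Continuous fun t : 𝕜 => ‖t • v‖ := by fun_prop
        simpa using this.tendsto 0
      have h1 : ∀ᶠ t : 𝕜 in 𝓝[≠] 0, ‖t • v‖ < δ :=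
        (this.eventually (gt_mem_nhds hδ)).filter_mono nhdsWithin_le_nhds
      obtain ⟨t, ht, ht'⟩ := (h1.and self_mem_nhdsWithin).exists
      exact ⟨t, ht', ht⟩
    have h1 := hsmul t y v hv (hδO' _ ht)
    have h2 := hL _ ht
    rw [map_smul, h1] at h2
    exact smul_right_injective _ ht0 h2
  -- The value `0` off this open set is a default that plays no role.
  refine ⟨{y | (y, 0) ∈ O}, hOo.preimage (by fun_prop), fun x => ?_,
    fun y => if hy : (y, 0) ∈ O then (hL y hy).choose else 0, ?_, fun x hx u => ?_⟩
  · have := hmem x 0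
    rw [map_zero, map_zero, norm_zero] at this
    exact this.trans (and_iff_left hε)
  · rintro ⟨y₀, u₀⟩ ⟨hy₀, -⟩
    refine ContinuousAt.continuousWithinAt ?_
    -- With `t` small enough that `(y₀, t • u₀)` lies in `O`, the extension equals `t⁻¹ • g (y, t •
    -- u)` near `(y₀, u₀)`, and joint continuity is inherited from `g`.
    obtain ⟨t, ht0, ht⟩ : ∃ t : 𝕜, t ≠ 0 ∧ (y₀, t • u₀) ∈ O := by
      have h1 : Continuous fun t : 𝕜 => (y₀, t • u₀) := by fun_prop
      have h2 : ∀ᶠ t : 𝕜 in 𝓝 0, (y₀, t • u₀) ∈ O :=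
        h1.continuousAt.eventually (hOo.mem_nhds (by simpa using hy₀))
      obtain ⟨t, ht, ht'⟩ :=
        ((h2.filter_mono nhdsWithin_le_nhds : ∀ᶠ t : 𝕜 in 𝓝[≠] 0, _).and
          self_mem_nhdsWithin).exists
      exact ⟨t, ht', ht⟩
    have hct : Continuous fun z : s.chain.space p × s₁.chain.space q => (z.1, t • z.2) := by
      fun_prop
    have h1 : ContinuousAt (fun z : s.chain.space p × s₁.chain.space q =>
        t⁻¹ • g (z.1, t • z.2)) (y₀, u₀) :=
      (ContinuousAt.comp (x := (y₀, u₀)) (f := fun z => (z.1, t • z.2))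
        (hgO.continuousAt (hOo.mem_nhds ht)) hct.continuousAt).const_smul _
    refine h1.congr ?_
    have h3 : Continuous fun z : s.chain.space p × s₁.chain.space q =>
      (z.1, (0 : s₁.chain.space q)) := by fun_prop
    filter_upwards [hct.continuousAt.eventually (hOo.mem_nhds ht),
      h3.continuousAt.eventually (hOo.mem_nhds hy₀)] with z hz hz'
    change (z.1, t • z.2) ∈ O at hz
    change (z.1, 0) ∈ O at hz'
    rw [dif_pos hz']
    have := (hL z.1 hz').choose_spec _ hz
    rw [← this, map_smul, inv_smul_smul₀ ht0]
  · have hx0 : (s.lev p x, (0 : s₁.chain.space q)) ∈ O := by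
      have := (hmem x 0).2 ⟨hx, by simpa using hε⟩
      rwa [map_zero] at this
    change (if hy : (s.lev p x, 0) ∈ O then (hL (s.lev p x) hy).choose else 0) (s₁.lev q u) = _
    rw [dif_pos hx0]
    obtain ⟨t, ht0, ht⟩ : ∃ t : 𝕜, t ≠ 0 ∧ ‖s₁.lev m' (t • u)‖ < ε := by
      have : Tendsto (fun t : 𝕜 => ‖t • s₁.lev m' u‖) (𝓝 0) (𝓝 0) := by
        have : Continuous fun t : 𝕜 => ‖t • s₁.lev m' u‖ := by fun_prop
        simpa using this.tendsto 0
      have h1 : ∀ᶠ t : 𝕜 in 𝓝[≠] 0, ‖t • s₁.lev m' u‖ < ε :=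
        (this.eventually (gt_mem_nhds hε)).filter_mono nhdsWithin_le_nhds
      obtain ⟨t, ht, ht'⟩ := (h1.and self_mem_nhdsWithin).exists
      exact ⟨t, ht', by rwa [map_smul]⟩
    have h1 := (hL _ hx0).choose_spec _ ((hmem x (t • u)).2 ⟨hx, ht⟩)
    rw [hgφ _ _ ((hmem x (t • u)).2 ⟨hx, ht⟩), map_smul, map_smul, map_smul, map_smul] at h1
    exact smul_right_injective _ ht0 h1

/-- Rescaling a linear estimate near the origin. -/
theorem norm_lev_le_of_small {φ : E₁ →ₗ[𝕜] E₂} {m p j : ℕ} {ε C M : ℝ} (hε : 0 < ε)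
    (h : ∀ u, ‖s₁.lev m u‖ < ε → ‖s₂.lev j (φ u)‖ ≤ C * (M + ‖s₁.lev p u‖)) (u : E₁) :
    ‖s₂.lev j (φ u)‖ ≤ C * (M * (2 / ε * ‖s₁.lev m u‖) + ‖s₁.lev p u‖) := by
  rcases eq_or_ne u 0 with rfl | hu
  · simp
  have hu' : 0 < ‖s₁.lev m u‖ := by
    rw [norm_pos_iff]
    intro h0
    exact hu (s₁.lev_injective m (by rw [h0, map_zero]))
  -- This `t` scales `u` to norm `ε / 2` at level `m`; its inverse is the factor `2 / ε * ‖s₁.lev m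
  -- u‖` of the conclusion.
  set t : ℝ := ε / (2 * ‖s₁.lev m u‖) with ht
  have ht0 : 0 < t := by positivity
  have htn : ‖(t : 𝕜)‖ = t := by rw [RCLike.norm_ofReal, abs_of_pos ht0]
  have h1 := h ((t : 𝕜) • u) (by
    rw [map_smul, norm_smul, htn, ht]
    field_simp
    norm_num)
  rw [map_smul, map_smul, map_smul, norm_smul, norm_smul, htn] at h1
  have h2 : ‖s₂.lev j (φ u)‖ ≤ t⁻¹ * (C * (M + t * ‖s₁.lev p u‖)) := by
    rw [inv_mul_eq_div, le_div_iff₀ ht0, mul_comm]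
    exact h1
  refine h2.trans_eq ?_
  rw [ht]
  field_simp

/-- Families of morphisms have germs with respect to any compatible structures. -/
theorem famNear_of_isScFamily {𝒮 : Set (ScStructure 𝕜 E)} {𝒮₁ : Set (ScStructure 𝕜 E₁)}
    {𝒮₂ : Set (ScStructure 𝕜 E₂)} (h𝒮 : IsScClass c 𝒮) (h𝒮₁ : IsScClass c 𝒮₁)
    (h𝒮₂ : IsScClass c 𝒮₂) (hs : s ∈ 𝒮) (hs₁ : s₁ ∈ 𝒮₁) (hs₂ : s₂ ∈ 𝒮₂) {U : Set E}
    {φ : E → E₁ →ₗ[𝕜] E₂} (hφ : IsScFamily c 𝒮 𝒮₁ 𝒮₂ U φ) (hx₀ : x₀ ∈ U) :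
    FamNear c s s₁ s₂ x₀ φ := by
  -- An envelope near `(x₀, 0)` suffices, since linearity in the second variable recovers all `u`.
  obtain ⟨W, hW, -, r, hr, t, ht, 𝓕, h𝓕⟩ := hφ (x₀, 0) ⟨hx₀, trivial⟩
  obtain ⟨a, ha, hA⟩ := (h𝒮.prodClass h𝒮₁).isMor_id (prod_mem_prodClass c hs hs₁) hr
  obtain ⟨b, hb, hB⟩ := h𝒮₂.isMor_id ht hs₂
  obtain ⟨W₁, hW₁, W₂, hW₂, hWW⟩ := mem_nhds_prod_iff.1 hW
  obtain ⟨m₁, ε₁, hε₁, hm₁⟩ := s.exists_ball_subset hW₁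
  obtain ⟨m₂, ε₂, hε₂, hm₂⟩ := s₁.exists_ball_subset hW₂
  set m := max m₁ m₂
  set ε := min ε₁ ε₂
  have hε : 0 < ε := lt_min hε₁ hε₂
  have hmem : ∀ x ∈ s.ball m x₀ ε, ∀ u, ‖s₁.lev m u‖ < ε → (x, u) ∈ W := by
    intro x hx u hu
    refine hWW ⟨hm₁ (s.ball_subset (le_max_left _ _) x₀ (min_le_left _ _) hx), hm₂ ?_⟩
    refine s₁.ball_subset (le_max_right m₁ m₂) 0 (min_le_right ε₁ ε₂) ?_
    change ‖s₁.lev m u - s₁.lev m 0‖ < ε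
    rwa [map_zero, sub_zero]
  have hlev : ∀ z ∈ W, ∀ j, 𝓕.map j (r.lev j z) = t.lev j (φ z.1 z.2) := by
    intro z hz j
    have := 𝓕.map_limit (r.equiv.symm z) (by simpa using hz) j
    simpa [conj, lev_apply] using this
  have hdom : ∀ z ∈ W, ∀ j, r.lev j z ∈ 𝓕.dom j := by
    intro z hz j
    exact (𝓕.mem_iff (r.equiv.symm z)).1 (by simpa using hz) j
  choose A hA' using fun j => (hA j).exists_clm
  choose B hB' using fun j => (hB j).exists_clm
  -- To reach level `j` of `s₂`, the envelope is used at level `b j`, which is fed from level `a (b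
  -- j)` of `s` and `s₁`. The summand `m` places the ball at a level below all those used.
  have hab := (ha.comp hb).add_const m
  have hm_le : m ≤ a (b 0) + m := Nat.le_add_left _ _
  refine ⟨_, hab, ε, hε, ?_, ?_⟩
  · intro j
    have hmj : m ≤ a (b j) + m := Nat.le_add_left _ _
    have haj : a (b j) ≤ a (b j) + m := Nat.le_add_right _ _
    refine LevelExt.ball (V := s.ball m x₀ ε) ?_ (hab.mono (Nat.zero_le j))
      (s.ball_subset hm_le x₀ le_rfl)
    let A' : s.chain.space (a (b j) + m) × s₁.chain.space (a (b j) + m) →L[𝕜] r.chain.space (b j) :=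
      (A (b j)).comp ((s.chain.incl haj).prodMap (s₁.chain.incl haj))
    have hA'' : ∀ x u, A' (s.lev _ x, s₁.lev _ u) = r.lev (b j) (x, u) := by
      intro x u
      change A (b j) (s.chain.incl haj (s.lev _ x), s₁.chain.incl haj (s₁.lev _ u)) = _
      rw [incl_lev, incl_lev]
      exact hA' (b j) (x, u)
    refine levelExt_of_continuousOn hmj hmj hε (D := A' ⁻¹' 𝓕.dom (b j))
      (g := fun z => B j (𝓕.map (b j) (A' z))) ((𝓕.isOpen (b j)).preimage A'.continuous)
      ((B j).continuous.comp_continuousOn ((𝓕.continuousOn (b j)).comp A'.continuous.continuousOn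
        fun z hz => hz)) ?_
    intro x hx u hu
    have hW := hmem x hx u hu
    refine ⟨?_, ?_⟩
    · rw [mem_preimage, hA'']
      exact hdom _ hW _
    · rw [hA'', hlev _ hW, hB']
      rfl
  · intro hc j
    obtain ⟨C, hC⟩ := h𝓕 hc (b j)
    obtain ⟨CA, hCA0, hCA⟩ := (hA (b j)).exists_pos
    obtain ⟨CB, hCB0, hCB⟩ := (hB j).exists_pos
    have hmj : m ≤ a (b j) + m := Nat.le_add_left _ _
    have haj : a (b j) ≤ a (b j) + m := Nat.le_add_right _ _
    set p := a (b j) + m with hp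
    set K := CB * (|C| * (1 + CA)) with hK
    have hK0 : 0 ≤ K := by positivity
    -- The tame estimate of the envelope is affine and holds for small `u`. Scaling by
    -- `norm_lev_le_of_small` makes it linear in `u`, and the constant term turns into the product
    -- of a norm of `x` with a low norm of `u`.
    have key : ∀ x ∈ s.ball m x₀ ε, ∀ u, ‖s₁.lev m u‖ < ε →
        ‖s₂.lev j (φ x u)‖ ≤ K * ((1 + ‖s.lev p x‖) + ‖s₁.lev p u‖) := by
      intro x hx u hu
      have hW := hmem x hx u hu
      have e1 : ‖r.lev (b j) (x, u)‖ ≤ CA * (‖s.lev p x‖ + ‖s₁.lev p u‖) := by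
        refine (hCA (x, u)).trans ?_
        gcongr
        change max ‖s.lev (a (b j)) x‖ ‖s₁.lev (a (b j)) u‖ ≤ _
        refine max_le ?_ ?_
        · exact (s.norm_lev_mono haj x).trans (le_add_of_nonneg_right (norm_nonneg _))
        · exact (s₁.norm_lev_mono haj u).trans (le_add_of_nonneg_left (norm_nonneg _))
      calc ‖s₂.lev j (φ x u)‖ ≤ CB * ‖t.lev (b j) (φ x u)‖ := hCB _
        _ ≤ CB * (|C| * (1 + ‖r.lev (b j) (x, u)‖)) := by
          gcongr
          rw [← hlev _ hW]
          refine (hC _ (hdom _ hW _)).trans ?_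
          gcongr
          exact le_abs_self C
        _ ≤ CB * (|C| * (1 + CA * (‖s.lev p x‖ + ‖s₁.lev p u‖))) := by gcongr
        _ ≤ CB * (|C| * ((1 + CA) * ((1 + ‖s.lev p x‖) + ‖s₁.lev p u‖))) := by
          have h1 := norm_nonneg (s.lev p x)
          have h2 := norm_nonneg (s₁.lev p u)
          refine mul_le_mul_of_nonneg_left (mul_le_mul_of_nonneg_left ?_ (abs_nonneg C)) hCB0.le
          nlinarith
        _ = _ := by rw [hK]; ring
    refine ⟨K * (2 / ε + 1), by positivity, fun x hx u => ?_⟩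
    have hx' := s.ball_subset hm_le x₀ le_rfl hx
    refine (norm_lev_le_of_small hε (key x hx') u).trans ?_
    rw [mul_assoc K]
    refine mul_le_mul_of_nonneg_left ?_ hK0
    have e1 : ‖s₁.lev m u‖ ≤ ‖s₁.lev p u‖ := s₁.norm_lev_mono hmj u
    have e2 : ‖s₁.lev m u‖ ≤ ‖s₁.lev (a (b 0) + m) u‖ := s₁.norm_lev_mono hm_le u
    have e3 : 0 < 2 / ε := by positivity
    have e4 := norm_nonneg (s.lev p x)
    have e5 := norm_nonneg (s₁.lev (a (b 0) + m) u)
    calc (1 + ‖s.lev p x‖) * (2 / ε * ‖s₁.lev m u‖) + ‖s₁.lev p u‖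
        = 2 / ε * ‖s₁.lev m u‖ + 2 / ε * (‖s.lev p x‖ * ‖s₁.lev m u‖) + ‖s₁.lev p u‖ := by ring
      _ ≤ 2 / ε * ‖s₁.lev p u‖ + 2 / ε * (‖s.lev p x‖ * ‖s₁.lev (a (b 0) + m) u‖) +
          ‖s₁.lev p u‖ := by gcongr
      _ ≤ (2 / ε + 1) * (‖s₁.lev p u‖ + ‖s.lev p x‖ * ‖s₁.lev (a (b 0) + m) u‖) := by
        have : 0 ≤ ‖s.lev p x‖ * ‖s₁.lev (a (b 0) + m) u‖ := by positivity
        linarith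

end ScStructure

/-! ### From germs back to envelopes, and germs of strongly smoothing families. -/

theorem ScContext.IsRescaling.shift' (c : ScContext) (m : ℕ) :
    c.IsRescaling (fun j => m + j) :=
  ⟨fun _ _ h => by simpa using h, fun _ => ⟨m, fun j => by omega⟩⟩

namespace ScStructure

variable {𝕜 : Type w} [RCLike 𝕜]
variable {E : Type u} [AddCommGroup E] [Module 𝕜 E] [TopologicalSpace E]
variable {F : Type v} [AddCommGroup F] [Module 𝕜 F] [TopologicalSpace F]
variable {E₁ : Type u₁} [AddCommGroup E₁] [Module 𝕜 E₁] [TopologicalSpace E₁]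
variable {E₂ : Type u₂} [AddCommGroup E₂] [Module 𝕜 E₂] [TopologicalSpace E₂]
variable {s s' : ScStructure 𝕜 E} {s₁ s₁' : ScStructure 𝕜 E₁} {s₂ s₂' : ScStructure 𝕜 E₂}
  {c : ScContext} {V : Set E} {x₀ : E}

/-- An envelope is determined by continuous extensions to open subsets of the levels. -/
def mapEnvelope (r : ScStructure 𝕜 E) (t : ScStructure 𝕜 F) {A : Set E} {f : E → F}
    (dom : ∀ k, Set (r.chain.space k)) (isOpen : ∀ k, IsOpen (dom k))
    (mapsTo : ∀ k, ∀ x ∈ dom (k + 1), r.chain.ι k x ∈ dom k)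
    (mem_iff : ∀ k x, r.lev k x ∈ dom k ↔ x ∈ A)
    (map : ∀ k, r.chain.space k → t.chain.space k)
    (continuousOn : ∀ k, ContinuousOn (map k) (dom k))
    (map_lev : ∀ x ∈ A, ∀ k, map k (r.lev k x) = t.lev k (f x)) :
    ScChain.MapEnvelope r.chain t.chain (r.equiv ⁻¹' A) (r.conj t f) where
  dom := dom
  isOpen := isOpen
  mapsTo := mapsTo
  mem_iff x := by
    refine ⟨fun h k => ?_, fun h => ?_⟩
    · rw [← r.lev_equiv]
      exact (mem_iff k _).2 h
    · have := h 0
      rw [← r.lev_equiv] at this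
      exact (mem_iff 0 _).1 this
  map := map
  continuousOn := continuousOn
  map_limit x hx k := by
    rw [← r.lev_equiv]
    exact map_lev _ hx k
  comm k x hx := by
    refine (r.lev_denseRange (k + 1)).eqOn_of_isOpen (isOpen (k + 1))
      ((continuousOn k).comp (r.chain.ι k).continuous.continuousOn (mapsTo k))
      ((t.chain.ι k).continuous.comp_continuousOn (continuousOn (k + 1))) (fun y hy => ?_) hx
    have hyA := (mem_iff _ y).1 hy
    change map k (r.chain.ι k (r.lev (k + 1) y)) = t.chain.ι k (map (k + 1) (r.lev (k + 1) y))
    rw [r.ι_lev, map_lev y hyA, map_lev y hyA, t.ι_lev]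

/-- Extensions to the levels can be chosen with nested domains. -/
theorem exists_nested_levelExt {φ : E → E₁ →ₗ[𝕜] E₂} {a q : ℕ → ℕ} (ha : Monotone a)
    (h : ∀ j, LevelExt s s₁ s₂ V φ (a j) (q j) j) :
    ∃ (D : ∀ j, Set (s.chain.space (a j)))
      (f : ∀ j, s.chain.space (a j) → s₁.chain.space (q j) →L[𝕜] s₂.chain.space j),
      (∀ j, IsOpen (D j)) ∧
      (∀ i j (hij : i ≤ j), ∀ x ∈ D j, s.chain.incl (ha hij) x ∈ D i) ∧
      (∀ j x, s.lev (a j) x ∈ D j ↔ x ∈ V) ∧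
      (∀ j, ContinuousOn (fun z : s.chain.space (a j) × s₁.chain.space (q j) => f j z.1 z.2)
        (D j ×ˢ univ)) ∧
      ∀ j, ∀ x ∈ V, ∀ u, f j (s.lev (a j) x) (s₁.lev (q j) u) = s₂.lev j (φ x u) := by
  choose D hD hDV f hf hfφ using h
  -- Each `D i` already detects membership in `V`, so intersecting the preimages of the finitely
  -- many lower domains adds no condition at points of the limit.
  refine ⟨fun j => ⋂ i : Fin (j + 1), s.chain.incl (ha (Nat.lt_succ_iff.1 i.2)) ⁻¹' D i, f,
    fun j => isOpen_iInter_of_finite fun i => (hD i).preimage (ContinuousLinearMap.continuous _),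
    fun i j hij x hx => ?_, fun j x => ?_, fun j => (hf j).mono (prod_mono (fun x hx => ?_)
    subset_rfl), hfφ⟩
  · rw [mem_iInter] at hx ⊢
    intro l
    rw [mem_preimage, s.chain.incl_trans]
    exact hx ⟨l, by omega⟩
  · simp only [mem_iInter, mem_preimage, incl_lev, hDV]
    exact ⟨fun h => h 0, fun h _ => h⟩
  · have := mem_iInter.1 hx (Fin.last j)
    rw [mem_preimage] at this
    change s.chain.incl (le_refl (a j)) x ∈ D j at this
    rwa [s.chain.incl_self] at this

/-- A family of morphisms in the sense of estimates and extensions has local envelopes. -/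
theorem FamOn.isScFamily {𝒮 : Set (ScStructure 𝕜 E)} {𝒮₁ : Set (ScStructure 𝕜 E₁)}
    {𝒮₂ : Set (ScStructure 𝕜 E₂)} (h𝒮 : IsScClass c 𝒮) (h𝒮₁ : IsScClass c 𝒮₁)
    (hs : s ∈ 𝒮) (hs₁ : s₁ ∈ 𝒮₁) (hs₂ : s₂ ∈ 𝒮₂)
    {φ : E → E₁ →ₗ[𝕜] E₂} {a : ℕ → ℕ} (ha : c.IsRescaling a) (hφ : FamOn c s s₁ s₂ V φ a) :
    IsScFamily c 𝒮 𝒮₁ 𝒮₂ V φ := by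
  rintro ⟨x₁, u₁⟩ ⟨hx₁, -⟩
  obtain ⟨D, f, hD, hDD, hDV, hf, hfφ⟩ := exists_nested_levelExt ha.strictMono.monotone hφ.levelExt
  have hVo : IsOpen V := by
    have : V = s.lev (a 0) ⁻¹' D 0 := by ext x; exact (hDV 0 x).symm
    rw [this]
    exact (hD 0).preimage (s.lev (a 0)).continuous
  -- Bounding `u` in the norm of level `a 0` makes the product term of the tame estimate linear in
  -- `‖x‖`, as a tame envelope requires.
  set R := ‖s₁.lev (a 0) u₁‖ + 1 with hR
  set B : Set E₁ := {u | ‖s₁.lev (a 0) u‖ < R} with hB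
  have hBo : IsOpen B := isOpen_lt (by fun_prop) continuous_const
  have hu₁ : u₁ ∈ B := by simp [hB, hR]
  -- Rescaling both source chains by `a` absorbs the loss of derivatives.
  let r := (s.rescale a ha.strictMono).prod (s₁.rescale a ha.strictMono)
  have ha0 : ∀ j, a 0 ≤ a j := fun j => ha.mono (Nat.zero_le j)
  let dom : ∀ j, Set (s.chain.space (a j) × s₁.chain.space (a j)) :=
    fun j => D j ×ˢ {u | ‖s₁.chain.incl (ha0 j) u‖ < R}
  have hdomo : ∀ j, IsOpen (dom j) := fun j =>
    (hD j).prod (isOpen_lt (by fun_prop) continuous_const)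
  refine ⟨V ×ˢ B, (hVo.prod hBo).mem_nhds ⟨hx₁, hu₁⟩, prod_mono subset_rfl (subset_univ _),
    r, prod_mem_prodClass c (h𝒮.rescale_mem hs ha) (h𝒮₁.rescale_mem hs₁ ha), s₂, hs₂,
    mapEnvelope r s₂ dom hdomo ?_ ?_ (fun j z => f j z.1 z.2) ?_ ?_, ?_⟩
  · rintro j ⟨x, u⟩ ⟨hx, hu⟩
    refine ⟨hDD _ _ (Nat.le_succ j) x hx, ?_⟩
    change ‖s₁.chain.incl _ (s₁.chain.incl _ u)‖ < R
    rw [s₁.chain.incl_trans]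
    exact hu
  · rintro j ⟨x, u⟩
    change (s.lev (a j) x ∈ D j ∧ ‖s₁.chain.incl _ (s₁.lev (a j) u)‖ < R) ↔ _
    rw [hDV, incl_lev]
    rfl
  · intro j
    exact (hf j).mono (prod_mono subset_rfl (subset_univ _))
  · rintro ⟨x, u⟩ ⟨hx, -⟩ j
    exact hfφ j x hx u
  · intro hc j
    obtain ⟨C, hC0, hC⟩ := hφ.tame hc j
    refine ⟨C * (1 + R), fun z hz => ?_⟩
    have hz' : z ∈ D j ×ˢ (univ : Set (s₁.chain.space (a j))) := ⟨hz.1, trivial⟩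
    have key : ‖f j z.1 z.2‖ ≤ C * (‖z.2‖ + ‖z.1‖ * ‖s₁.chain.incl (ha0 j) z.2‖) := by
      refine ((s.lev_denseRange (a j)).prodMap (s₁.lev_denseRange (a j))).le_of_isOpen
        ((hD j).prod isOpen_univ) (f := fun z => ‖f j z.1 z.2‖)
        (g := fun z => C * (‖z.2‖ + ‖z.1‖ * ‖s₁.chain.incl (ha0 j) z.2‖))
        (hf j).norm (Continuous.continuousOn (by fun_prop)) ?_ hz'
      rintro ⟨x, u⟩ ⟨hx, -⟩
      have hx' := (hDV j x).1 hx
      simp only [Prod.map_fst, Prod.map_snd, incl_lev]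
      rw [hfφ j x hx']
      exact hC x hx' u
    refine key.trans ?_
    rw [mul_assoc]
    refine mul_le_mul_of_nonneg_left ?_ hC0
    have h1 : ‖z.1‖ ≤ ‖z‖ := le_max_left _ _
    have h2 : ‖z.2‖ ≤ ‖z‖ := le_max_right _ _
    have h3 : ‖s₁.chain.incl (ha0 j) z.2‖ < R := hz.2
    have h4 := norm_nonneg z.1
    have hR0 : 0 < R := by positivity
    nlinarith [mul_le_mul h1 h3.le (norm_nonneg _) (norm_nonneg _)]

/-- Every target level is reached from the single level `a 0` of the second variable, so the source
level `a 0 + j` and the target level `l` can be chosen independently. The diagonal `l = j` is the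
envelope itself, and `l = k j` is the one required for the rescaling `k`; they are compatible by
density. -/
theorem SmoothOn.hasStronglySmoothingEnvelope {𝒮 : Set (ScStructure 𝕜 E)}
    {𝒮₁ : Set (ScStructure 𝕜 E₁)} {𝒮₂ : Set (ScStructure 𝕜 E₂)} (h𝒮 : IsScClass c 𝒮)
    (h𝒮₁ : IsScClass c 𝒮₁) (hs : s ∈ 𝒮) (hs₁ : s₁ ∈ 𝒮₁) (hs₂ : s₂ ∈ 𝒮₂)
    {κ : E → E₁ →ₗ[𝕜] E₂} {a : ℕ → ℕ} (ha : c.IsRescaling a) (hκ : SmoothOn c s s₁ s₂ V κ a) :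
    HasStronglySmoothingEnvelope c 𝒮 𝒮₁ 𝒮₂ V κ := by
  obtain ⟨D, f, hD, hDD, hDV, hf, hfκ⟩ := exists_nested_levelExt ha.strictMono.monotone hκ.levelExt
  have hb := ScContext.IsRescaling.shift' c (a 0)
  let r := s.rescale a ha.strictMono
  let r₁ := s₁.rescale _ hb.strictMono
  have hb0 : ∀ j, a 0 ≤ a 0 + j := fun j => Nat.le_add_right _ _
  -- the value of the extension at level `l` on the `j`-th level of the second variable
  let g : ∀ l j, s.chain.space (a l) × s₁.chain.space (a 0 + j) → s₂.chain.space l :=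
    fun l j z => f l z.1 (s₁.chain.incl (hb0 j) z.2)
  have hg : ∀ l j, ContinuousOn (g l j) (D l ×ˢ univ) := fun l j =>
    (hf l).comp (f := fun z : s.chain.space (a l) × s₁.chain.space (a 0 + j) =>
      (z.1, s₁.chain.incl (hb0 j) z.2)) (by fun_prop) fun z hz => ⟨hz.1, trivial⟩
  have hgκ : ∀ l j, ∀ x ∈ V, ∀ u, g l j (s.lev (a l) x, s₁.lev (a 0 + j) u) =
      s₂.lev l (κ x u) := by
    intro l j x hx u
    change f l (s.lev (a l) x) (s₁.chain.incl (hb0 j) (s₁.lev (a 0 + j) u)) = _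
    rw [incl_lev]
    exact hfκ l x hx u
  have htame : c = ScContext.tame → ∀ l j (R : ℝ), ∃ C : ℝ, ∀ (x : s.chain.space (a l))
      (u : s₁.chain.space (a 0 + j)), x ∈ D l → ‖s₁.chain.incl (hb0 j) u‖ ≤ R →
      ‖g l j (x, u)‖ ≤ C * (1 + ‖x‖ + ‖u‖) := by
    intro hc l j R
    obtain ⟨C, hC0, hC⟩ := hκ.tame hc l
    refine ⟨C * |R|, fun x u hx hu => ?_⟩
    have key : ‖f l x (s₁.chain.incl (hb0 j) u)‖ ≤
        C * ((1 + ‖x‖) * ‖s₁.chain.incl (hb0 j) u‖) := by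
      refine ((s.lev_denseRange (a l)).prodMap (s₁.lev_denseRange (a 0))).le_of_isOpen
        ((hD l).prod isOpen_univ) (f := fun z => ‖f l z.1 z.2‖)
        (g := fun z => C * ((1 + ‖z.1‖) * ‖z.2‖))
        (hf l).norm (Continuous.continuousOn (by fun_prop)) ?_
        (z := (x, s₁.chain.incl (hb0 j) u)) ⟨hx, trivial⟩
      rintro ⟨x, u⟩ ⟨hx, -⟩
      have hx' := (hDV l x).1 hx
      simp only [Prod.map_fst, Prod.map_snd]
      rw [hfκ l x hx']
      exact hC x hx' u
    refine key.trans ?_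
    rw [mul_assoc]
    refine mul_le_mul_of_nonneg_left ?_ hC0
    rw [mul_comm]
    have h1 := norm_nonneg u
    have h2 : ‖s₁.chain.incl (hb0 j) u‖ ≤ |R| := hu.trans (le_abs_self R)
    exact mul_le_mul h2 (by linarith) (by positivity) (abs_nonneg R)
  have hι : ∀ j, ∀ x ∈ D (j + 1), r.chain.ι j x ∈ D j := fun j x hx =>
    hDD _ _ (Nat.le_succ j) x hx
  refine ⟨r, h𝒮.rescale_mem hs ha, r₁, h𝒮₁.rescale_mem hs₁ hb, s₂, hs₂,
    ⟨D, hD, hι, fun x => ?_⟩,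
    mapEnvelope (r.prod r₁) s₂ (fun j => D j ×ˢ univ) (fun j => (hD j).prod isOpen_univ)
      (fun j z hz => ⟨hι j z.1 hz.1, trivial⟩) (fun j z => ?_) (fun j => g j j) (fun j => hg j j)
      (fun z hz j => hgκ j j z.1 hz.1 z.2), fun j => rfl, ?_, ?_⟩
  · refine ⟨fun h k => ?_, fun h => ?_⟩
    · rw [← r.lev_equiv]
      exact (hDV k _).2 h
    · have := h 0
      rw [← r.lev_equiv] at this
      exact (hDV 0 _).1 this
  · exact and_congr (hDV j z.1) Iff.rfl
  · intro hc j R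
    obtain ⟨C, hC⟩ := htame hc j j R
    refine ⟨C, fun x u hx hu => hC x u hx.1 ?_⟩
    rw [ScChain.rescale_incl s₁.chain _ hb.strictMono] at hu
    exact hu
  · intro k hk
    refine ⟨mapEnvelope ((r.rescale k hk.strictMono).prod r₁) (s₂.rescale k hk.strictMono)
      (fun j => D (k j) ×ˢ univ) (fun j => (hD (k j)).prod isOpen_univ)
      (fun j z hz => ⟨?_, trivial⟩) (fun j z => ?_) (fun j => g (k j) j) (fun j => hg (k j) j)
      (fun z hz j => hgκ (k j) j z.1 hz.1 z.2), fun j => rfl, ?_, ?_⟩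
    · change r.chain.incl _ z.1 ∈ D (k j)
      rw [ScChain.rescale_incl s.chain a ha.strictMono]
      exact hDD _ _ (hk.mono (Nat.le_succ j)) _ hz.1
    · exact and_congr (hDV (k j) z.1) Iff.rfl
    · intro hc j R
      obtain ⟨C, hC⟩ := htame hc (k j) j R
      refine ⟨C, fun x u hx hu => hC x u hx.1 ?_⟩
      rw [ScChain.rescale_incl s₁.chain _ hb.strictMono] at hu
      exact hu
    · intro j x hx u
      change g j j (r.chain.incl _ x, u) = s₂.chain.incl (hk.le_apply j) (g (k j) j (x, u))
      rw [ScChain.rescale_incl s.chain a ha.strictMono]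
      have hc : Continuous fun z : s.chain.space (a (k j)) × s₁.chain.space (a 0 + j) =>
          (s.chain.incl (ha.mono (hk.le_apply j)) z.1, z.2) := by fun_prop
      refine ((s.lev_denseRange (a (k j))).prodMap (s₁.lev_denseRange (a 0 + j))).eqOn_of_isOpen
        ((hD (k j)).prod isOpen_univ)
        (f := fun z => g j j (s.chain.incl (ha.mono (hk.le_apply j)) z.1, z.2))
        (g := fun z => s₂.chain.incl (hk.le_apply j) (g (k j) j z))
        ((hg j j).comp hc.continuousOn fun z hz => ⟨hDD _ _ (hk.le_apply j) _ hz.1, trivial⟩)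
        ((ContinuousLinearMap.continuous _).comp_continuousOn (hg (k j) j)) ?_
        (x := (x, u)) ⟨hx, trivial⟩
      rintro ⟨y, v⟩ ⟨hy, -⟩
      have hy' := (hDV _ y).1 hy
      change g j j (s.chain.incl _ (s.lev _ y), s₁.lev _ v) =
        s₂.chain.incl _ (g (k j) j (s.lev _ y, s₁.lev _ v))
      rw [incl_lev, hgκ _ _ _ hy', hgκ _ _ _ hy', incl_lev]

theorem SmoothOn.isStronglySmoothingFamily {𝒮 : Set (ScStructure 𝕜 E)}
    {𝒮₁ : Set (ScStructure 𝕜 E₁)} {𝒮₂ : Set (ScStructure 𝕜 E₂)} (h𝒮 : IsScClass c 𝒮)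
    (h𝒮₁ : IsScClass c 𝒮₁) (hs : s ∈ 𝒮) (hs₁ : s₁ ∈ 𝒮₁) (hs₂ : s₂ ∈ 𝒮₂)
    {κ : E → E₁ →ₗ[𝕜] E₂} {a : ℕ → ℕ} (ha : c.IsRescaling a) (hκ : SmoothOn c s s₁ s₂ V κ a)
    (hV : IsOpen V) : IsStronglySmoothingFamily c 𝒮 𝒮₁ 𝒮₂ V κ :=
  ⟨(hκ.famOn ha).isScFamily h𝒮 h𝒮₁ hs hs₁ hs₂ ha, fun _ hx =>
    ⟨V, hV.mem_nhds hx, subset_rfl, hκ.hasStronglySmoothingEnvelope h𝒮 h𝒮₁ hs hs₁ hs₂ ha⟩⟩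

/-- Only the norms of the parameter change, and the balls of the two structures are neighbourhoods
for the same topology. Changes of structure on source and target are instead compositions with the
identity morphism. -/
theorem SmoothNear.change_base {κ : E → E₁ →ₗ[𝕜] E₂} (hκ : SmoothNear c s s₁ s₂ x₀ κ)
    (h : IsMor c s' s LinearMap.id) : SmoothNear c s' s₁ s₂ x₀ κ := by
  obtain ⟨a, ha, ε, hε, hκ⟩ := hκ
  obtain ⟨b, hb, h⟩ := h
  obtain ⟨m, δ, hδ, hm⟩ := s'.exists_ball_subset
    ((s.isOpen_ball (a 0) x₀ ε).mem_nhds (s.mem_ball_self _ _ hε))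
  have hab := (hb.comp ha).add_const m
  have hsub := (s'.ball_subset (Nat.le_add_left m (b (a 0))) x₀ le_rfl).trans hm
  refine ⟨_, hab, δ, hδ, fun j => ?_, fun hc j => ?_⟩
  · refine (((hκ.levelExt j).change_base (h (a j))).mono (Nat.le_add_right _ m) ?_ le_rfl).ball
      (hab.mono (Nat.zero_le j)) hsub
    exact (hb.le_apply _).trans (Nat.le_add_right _ m)
  · obtain ⟨C, hC0, hC⟩ := hκ.tame hc j
    obtain ⟨C', hC0', hC'⟩ := (h (a j)).exists_pos
    refine ⟨C * (1 + C'), by positivity, fun x hx u => (hC x (hsub hx) u).trans ?_⟩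
    rw [mul_assoc, ← mul_assoc (1 + C')]
    have e1 : ‖s.lev (a j) x‖ ≤ C' * ‖s'.lev (b (a j) + m) x‖ :=
      (hC' x).trans (by gcongr; exact s'.norm_lev_mono (Nat.le_add_right _ m) x)
    have e2 : ‖s₁.lev (a 0) u‖ ≤ ‖s₁.lev (b (a 0) + m) u‖ :=
      s₁.norm_lev_mono ((hb.le_apply _).trans (Nat.le_add_right _ m)) u
    have e3 := norm_nonneg (s'.lev (b (a j) + m) x)
    gcongr
    nlinarith

/-- Strongly smoothing families have strongly smoothing germs with respect to any compatible
structures. -/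
theorem smoothNear_of_isStronglySmoothingFamily {𝒮 : Set (ScStructure 𝕜 E)}
    {𝒮₁ : Set (ScStructure 𝕜 E₁)} {𝒮₂ : Set (ScStructure 𝕜 E₂)} (h𝒮 : IsScClass c 𝒮)
    (h𝒮₁ : IsScClass c 𝒮₁) (h𝒮₂ : IsScClass c 𝒮₂) (hs : s ∈ 𝒮) (hs₁ : s₁ ∈ 𝒮₁) (hs₂ : s₂ ∈ 𝒮₂)
    {U : Set E} {κ : E → E₁ →ₗ[𝕜] E₂} (hκ : IsStronglySmoothingFamily c 𝒮 𝒮₁ 𝒮₂ U κ)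
    (hx₀ : x₀ ∈ U) : SmoothNear c s s₁ s₂ x₀ κ := by
  obtain ⟨W, hW, -, r, hr, r₁, hr₁, r₂, hr₂, 𝒰, 𝒦, -, -, h𝒦⟩ := hκ.2 x₀ hx₀
  -- It is enough to work in the structures that carry the envelope.
  suffices h : SmoothNear c r r₁ r₂ x₀ κ by
    have h1 := ((h.change_base (h𝒮.isMor_id hs hr)).comp_fam
      ((h𝒮₁.isMor_id hs₁ hr₁).famNear s x₀))
    exact ((h𝒮₂.isMor_id hr₂ hs₂).famNear s x₀).comp_smooth h1
  obtain ⟨m, ε, hε, hm⟩ := r.exists_ball_subset hW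
  have hdomW : ∀ x ∈ W, ∀ n, r.lev n x ∈ 𝒰.dom n := fun x hx n =>
    (𝒰.mem_iff (r.equiv.symm x)).1 (by simpa using hx) n
  have key : ∀ n, ∃ g : r.chain.space n × r₁.chain.space 0 → r₂.chain.space n,
      ContinuousOn g (𝒰.dom n ×ˢ univ) ∧
      (∀ x ∈ W, ∀ u, g (r.lev n x, r₁.lev 0 u) = r₂.lev n (κ x u)) ∧
      (c = ScContext.tame → ∃ C : ℝ, ∀ x ∈ 𝒰.dom n, ∀ u, ‖u‖ ≤ 1 →
        ‖g (x, u)‖ ≤ C * (1 + ‖x‖ + ‖u‖)) := by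
    intro n
    -- The zeroth map of the envelope for the rescaling `n + j` goes from level `0` of the second
    -- variable to level `n` of the target. Varying `n` gives all target levels from one source
    -- level.
    obtain ⟨𝒦n, hdom, htame, -⟩ := h𝒦 _ (ScContext.IsRescaling.shift' c n)
    refine ⟨𝒦n.map 0, ?_, fun x hx u => ?_, fun hc => ?_⟩
    · have := 𝒦n.continuousOn 0
      rw [hdom] at this
      exact this
    · let R := (r.rescale _ (ScContext.IsRescaling.shift' c n).strictMono).prod r₁
      have := 𝒦n.map_limit (R.equiv.symm (x, u)) (by
        rw [mem_preimage, ContinuousLinearEquiv.apply_symm_apply]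
        exact ⟨hx, trivial⟩) 0
      refine this.trans ?_
      change r₂.lev n (κ (R.equiv (R.equiv.symm (x, u))).1 (R.equiv (R.equiv.symm (x, u))).2) = _
      rw [ContinuousLinearEquiv.apply_symm_apply]
    · obtain ⟨C, hC⟩ := htame hc 0 1
      refine ⟨C, fun x hx u hu => hC x u ?_ ?_⟩
      · rw [hdom]
        exact ⟨hx, trivial⟩
      · rw [ScChain.incl_self]
        exact hu
  choose g hg hgκ hgt using key
  have hshift := ScContext.IsRescaling.shift c m
  refine ⟨_, hshift, ε, hε, fun n => ?_, fun hc n => ?_⟩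
  · have hn : n ≤ n + m := Nat.le_add_right _ _
    have hm0 : m ≤ n + m := Nat.le_add_left _ _
    refine LevelExt.ball (m := 0 + m) (V := r.ball m x₀ ε) ?_ (by omega)
      (r.ball_subset (by omega) x₀ le_rfl)
    refine LevelExt.mono (q := 0) ?_ le_rfl (Nat.zero_le _) le_rfl
    refine levelExt_of_continuousOn (p := n + m) (q := 0) (m' := 0) hm0 le_rfl hε
      (D := (r.chain.incl hn ⁻¹' 𝒰.dom n) ×ˢ univ) (g := fun z => g n (r.chain.incl hn z.1, z.2))
      (((𝒰.isOpen n).preimage (ContinuousLinearMap.continuous _)).prod isOpen_univ) ?_ ?_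
    · exact (hg n).comp (f := fun z : r.chain.space (n + m) × r₁.chain.space 0 =>
        (r.chain.incl hn z.1, z.2)) (by fun_prop) fun z hz => ⟨hz.1, trivial⟩
    · intro x hx u _
      refine ⟨⟨?_, trivial⟩, ?_⟩
      · rw [mem_preimage, incl_lev]
        exact hdomW x (hm hx) n
      · rw [incl_lev]
        exact hgκ n x (hm hx) u
  · obtain ⟨C, hC⟩ := hgt n hc
    -- The estimate for `‖u‖ ≤ 1` is scaled with `ε = 1`, which contributes `2`; the term already
    -- linear in `u` contributes `1`.
    refine ⟨|C| * 3, by positivity, fun x hx u => ?_⟩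
    have hxW := hm (r.ball_subset (by omega : m ≤ 0 + m) x₀ le_rfl hx)
    have h1 := norm_lev_le_of_small (s₁ := r₁) (s₂ := r₂) (φ := κ x) (m := 0) (p := 0) (j := n)
      (C := |C|) (M := 1 + ‖r.lev n x‖) one_pos (fun v hv => by
        rw [← hgκ n x hxW]
        refine (hC _ (hdomW x hxW n) _ hv.le).trans ?_
        gcongr
        exact le_abs_self C) u
    refine h1.trans ?_
    rw [mul_assoc]
    refine mul_le_mul_of_nonneg_left ?_ (abs_nonneg C)
    have e1 : ‖r₁.lev 0 u‖ ≤ ‖r₁.lev (0 + m) u‖ := r₁.norm_lev_mono (Nat.zero_le _) u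
    have e2 : ‖r.lev n x‖ ≤ ‖r.lev (n + m) x‖ := r.norm_lev_mono (Nat.le_add_right _ _) x
    have e3 := norm_nonneg (r.lev n x)
    have e4 := norm_nonneg (r₁.lev 0 u)
    calc (1 + ‖r.lev n x‖) * (2 / 1 * ‖r₁.lev 0 u‖) + ‖r₁.lev 0 u‖
        ≤ 3 * ((1 + ‖r.lev n x‖) * ‖r₁.lev 0 u‖) := by nlinarith [mul_nonneg e3 e4]
      _ ≤ 3 * ((1 + ‖r.lev (n + m) x‖) * ‖r₁.lev (0 + m) u‖) := by gcongr

end ScStructure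

/-! ### Compact perturbations of the identity -/

/-- The Fredholm alternative for `1 + K`. -/
theorem IsCompactOperator.isUnit_one_add {𝕜 X : Type*} [RCLike 𝕜] [NormedAddCommGroup X]
    [NormedSpace 𝕜 X] [CompleteSpace X] {K : X →L[𝕜] X} (hK : IsCompactOperator K)
    (hinj : ∀ u, u + K u = 0 → u = 0) : IsUnit (1 + K) := by
  rcases hK.hasEigenvalue_or_mem_resolventSet (μ := (-1 : 𝕜)) (by simp) with h | h
  · obtain ⟨u, hu⟩ := h.exists_hasEigenvector
    refine absurd (hinj u ?_) hu.2
    have : K u = (-1 : 𝕜) • u := hu.apply_eq_smul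
    rw [this]; simp
  · rw [spectrum.mem_resolventSet_iff] at h
    have := h.neg
    simpa [add_comm] using this

/-- Collectively compact perturbations of the identity that are injective at one point are bounded
below uniformly near this point. -/
theorem exists_uniform_lower_bound {𝕜 P X Y : Type*} [RCLike 𝕜] [NormedAddCommGroup P]
    [NormedAddCommGroup X] [NormedSpace 𝕜 X] [NormedAddCommGroup Y] [NormedSpace 𝕜 Y]
    {J : Y →L[𝕜] X} (hJ : IsCompactOperator J) {D : Set P} (hD : IsOpen D) {x₀ : P}
    (hx₀ : x₀ ∈ D) {f : P → X →L[𝕜] Y}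
    (hf : ContinuousOn (fun z : P × X => f z.1 z.2) (D ×ˢ univ))
    (hinj : ∀ u, u + J (f x₀ u) = 0 → u = 0) :
    ∃ δ > 0, ∃ C > 0, ∀ x, ‖x - x₀‖ < δ → ∀ u, ‖u‖ ≤ C * ‖u + J (f x u)‖ := by
  have hat : ∀ u, ContinuousAt (fun z : P × X => f z.1 z.2) (x₀, u) := fun u =>
    hf.continuousAt ((hD.prod isOpen_univ).mem_nhds ⟨hx₀, trivial⟩)
  -- Joint continuity at `(x₀, 0)` already bounds the operators `f x` uniformly near `x₀`.
  obtain ⟨δ₀, hδ₀, hb⟩ : ∃ δ₀ > 0, ∀ x u, ‖x - x₀‖ < δ₀ → ‖u‖ < δ₀ → ‖f x u‖ < 1 := by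
    obtain ⟨δ₀, hδ₀, h⟩ := Metric.continuousAt_iff.1 (hat 0) 1 one_pos
    refine ⟨δ₀, hδ₀, fun x u hx hu => ?_⟩
    have := h (x := (x, u)) (by
      rw [Prod.dist_eq, dist_eq_norm, dist_zero_right]
      exact max_lt hx hu)
    simpa using this
  by_contra! hcon
  have hseq : ∀ n : ℕ, ∃ x u, ‖x - x₀‖ < min δ₀ (1 / (n + 1)) ∧ ‖u‖ = 1 ∧
      ‖u + J (f x u)‖ ≤ 1 / (n + 1) := by
    intro n
    have hn : (0 : ℝ) < 1 / (n + 1) := by positivity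
    obtain ⟨x, hx, u, hu⟩ := hcon (min δ₀ (1 / (n + 1))) (lt_min hδ₀ hn) (n + 1) (by positivity)
    have hu0 : 0 < ‖u‖ := lt_of_le_of_lt (by positivity) hu
    have hne : ((‖u‖⁻¹ : ℝ) : 𝕜) ≠ 0 := by exact_mod_cast (inv_pos.2 hu0).ne'
    have hnorm : ‖((‖u‖⁻¹ : ℝ) : 𝕜)‖ = ‖u‖⁻¹ := by
      rw [RCLike.norm_ofReal, abs_of_pos (inv_pos.2 hu0)]
    refine ⟨x, ((‖u‖⁻¹ : ℝ) : 𝕜) • u, hx, ?_, ?_⟩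
    · rw [norm_smul, hnorm, inv_mul_cancel₀ hu0.ne']
    · rw [map_smul, map_smul, ← smul_add, norm_smul, hnorm, inv_mul_le_iff₀ hu0,
        mul_one_div, le_div_iff₀ (by positivity), mul_comm]
      exact hu.le
  choose x u hx hu hS using hseq
  -- the vectors `f (x n) (u n)` are bounded
  have hbd : ∀ n, f (x n) (u n) ∈ Metric.closedBall (0 : Y) (2 / δ₀) := by
    intro n
    have hne : ‖((δ₀ / 2 : ℝ) : 𝕜)‖ = δ₀ / 2 := by
      rw [RCLike.norm_ofReal, abs_of_pos (by positivity)]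
    have h1 := hb (x n) (((δ₀ / 2 : ℝ) : 𝕜) • u n) ((hx n).trans_le (min_le_left _ _)) (by
      rw [norm_smul, hne, hu]; linarith)
    rw [map_smul, norm_smul, hne] at h1
    rw [mem_closedBall_zero_iff, le_div_iff₀ hδ₀]
    linarith
  -- Compactness of the fixed operator `J` makes `J (f (x n) (u n))` converge along a subsequence,
  -- hence also the unit vectors `u n`. By joint continuity their limit is killed by the operator at
  -- `x₀`, so it vanishes, although it has norm one.
  obtain ⟨Q, hQ, hQ'⟩ := hJ.image_closedBall_subset_compact (2 / δ₀)
  obtain ⟨y, -, θ, hθ, hy⟩ := hQ.tendsto_subseq (fun n => hQ' ⟨_, hbd n, rfl⟩)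
  have hlim0 : Tendsto (fun n => u (θ n) + J (f (x (θ n)) (u (θ n)))) atTop (𝓝 0) := by
    rw [tendsto_zero_iff_norm_tendsto_zero]
    refine squeeze_zero (fun n => norm_nonneg _) (fun n => hS (θ n)) ?_
    exact tendsto_one_div_add_atTop_nhds_zero_nat.comp hθ.tendsto_atTop
  have hulim : Tendsto (fun n => u (θ n)) atTop (𝓝 (0 - y)) := by
    refine (hlim0.sub hy).congr fun n => ?_
    simp
  have hxlim : Tendsto (fun n => x (θ n)) atTop (𝓝 x₀) := by
    rw [tendsto_iff_norm_sub_tendsto_zero]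
    refine squeeze_zero (fun n => norm_nonneg _)
      (fun n => ((hx (θ n)).trans_le (min_le_right _ _)).le) ?_
    exact tendsto_one_div_add_atTop_nhds_zero_nat.comp hθ.tendsto_atTop
  have hflim : Tendsto (fun n => f (x (θ n)) (u (θ n))) atTop (𝓝 (f x₀ (0 - y))) :=
    (hat (0 - y)).tendsto.comp (hxlim.prodMk_nhds hulim)
  have h1 := tendsto_nhds_unique hlim0 (hulim.add ((J.continuous.tendsto _).comp hflim))
  have h2 := hinj _ h1.symm
  have h3 : Tendsto (fun n => ‖u (θ n)‖) atTop (𝓝 ‖0 - y‖) := hulim.norm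
  simp only [hu, h2, norm_zero] at h3
  exact one_ne_zero (tendsto_nhds_unique tendsto_const_nhds h3)

/-! ### Inverting strongly smoothing perturbations of the identity. -/

namespace ScStructure

variable {𝕜 : Type w} [RCLike 𝕜]
variable {E : Type u} [AddCommGroup E] [Module 𝕜 E] [TopologicalSpace E]
variable {E₁ : Type u₁} [AddCommGroup E₁] [Module 𝕜 E₁] [TopologicalSpace E₁]
variable {E₂ : Type u₂} [AddCommGroup E₂] [Module 𝕜 E₂] [TopologicalSpace E₂]
variable {s : ScStructure 𝕜 E} {s₁ : ScStructure 𝕜 E₁} {s₂ : ScStructure 𝕜 E₂}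
  {c : ScContext} {V : Set E} {x₀ : E}

/-- The extensions of a smoothing operator to a fixed level take values in the limit. -/
theorem exists_lev_eq_of_smoothing {T : E₁ →ₗ[𝕜] E₂} {b : ℕ}
    (f : ∀ j, s₁.chain.space b →L[𝕜] s₂.chain.space j)
    (hf : ∀ j u, f j (s₁.lev b u) = s₂.lev j (T u)) (w : s₁.chain.space b) :
    ∃ y, ∀ j, s₂.lev j y = f j w := by
  refine s₂.exists_lev (fun j => f j w) fun i j hij => ?_
  have : (fun w => s₂.chain.incl hij (f j w)) = f i := by
    refine (s₁.lev_denseRange b).equalizer (by fun_prop) (f i).continuous (funext fun u => ?_)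
    simp [hf]
  exact congrFun this w

/-- The inverse of a strongly smoothing perturbation of the identity is again of this form. -/
theorem SmoothNear.exists_inverse {κ : E → E₁ →ₗ[𝕜] E₁} (hκ : SmoothNear c s s₁ s₁ x₀ κ)
    (hinj : ∀ u, u + κ x₀ u = 0 → u = 0) :
    ∃ μ : E → E₁ →ₗ[𝕜] E₁, SmoothNear c s s₁ s₁ x₀ μ ∧
      ∀ᶠ x in 𝓝 x₀, (LinearMap.id + μ x) ∘ₗ (LinearMap.id + κ x) = LinearMap.id ∧
        (LinearMap.id + κ x) ∘ₗ (LinearMap.id + μ x) = LinearMap.id := by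
  obtain ⟨a, ha, ε, hε, hκ⟩ := hκ
  set V := s.ball (a 0) x₀ ε with hV
  -- The extensions of `κ` into all levels are defined on this level, and it is the only one at
  -- which an operator is inverted.
  let b := a 0
  obtain ⟨D, f, hD, hDD, hDV, hf, hfκ⟩ :=
    exists_nested_levelExt (q := fun _ => b) ha.strictMono.monotone hκ.levelExt
  -- The extension into level `b + 1`, followed by the compact inclusion into level `b`, represents
  -- `κ x` at level `b`; this requires parameters in level `p`.
  set p := a (b + 1) with hp
  have hx₀V : x₀ ∈ V := s.mem_ball_self _ _ hε
  have hlim : ∀ x ∈ V, ∀ w : s₁.chain.space b, ∃ y, ∀ j, s₁.lev j y = f j (s.lev (a j) x) w :=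
    fun x hx w => exists_lev_eq_of_smoothing (fun j => f j (s.lev (a j) x))
      (fun j u => hfκ j x hx u) w
  have hι : ∀ x ∈ V, ∀ w, s₁.chain.ι b (f (b + 1) (s.lev p x) w) = f b (s.lev (a b) x) w := by
    intro x hx w
    obtain ⟨y, hy⟩ := hlim x hx w
    rw [← hy, ← hy, ι_lev]
  -- Injectivity passes from the limit to level `b`: a kernel vector is minus a value of the
  -- smoothing extension, so it comes from the limit.
  have hinj' : ∀ w, w + s₁.chain.ι b (f (b + 1) (s.lev p x₀) w) = 0 → w = 0 := by
    intro w hw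
    obtain ⟨y, hy⟩ := hlim x₀ hx₀V w
    have hw' : w = s₁.lev b (-y) := by
      rw [hι x₀ hx₀V, ← hy] at hw
      rw [map_neg]
      exact eq_neg_of_add_eq_zero_left hw
    have hyz : y = κ x₀ (-y) := by
      refine s₁.ext_lev fun j => ?_
      rw [hy, hw', hfκ j x₀ hx₀V]
    have := hinj (-y) (by rw [← hyz]; simp)
    rw [hw', this, map_zero]
  obtain ⟨δ, hδ, C, hC, hlow⟩ := exists_uniform_lower_bound (s₁.chain.ι_compact b) (hD (b + 1))
    ((hDV (b + 1) x₀).2 hx₀V) (hf (b + 1)) hinj'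
  set W : Set (s.chain.space p) := D (b + 1) ∩ {x | ‖x - s.lev p x₀‖ < min δ ε} with hW
  have hWo : IsOpen W := (hD (b + 1)).inter (isOpen_lt (by fun_prop) continuous_const)
  set V' := s.ball p x₀ (min δ ε) with hV'
  have hV'V : V' ⊆ V := s.ball_subset (ha.mono (Nat.zero_le _)) x₀ (min_le_right _ _)
  have hWV' : ∀ x, s.lev p x ∈ W ↔ x ∈ V' := fun x =>
    ⟨fun h => h.2, fun h => ⟨(hDV (b + 1) x).2 (hV'V h), h⟩⟩
  let S : s.chain.space p → s₁.chain.space b →L[𝕜] s₁.chain.space b :=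
    fun x => 1 + (s₁.chain.ι b).comp (f (b + 1) x)
  have hSc : ContinuousOn (fun z : s.chain.space p × s₁.chain.space b => S z.1 z.2)
      (W ×ˢ univ) := by
    refine continuousOn_snd.add ((s₁.chain.ι b).continuous.comp_continuousOn
      ((hf (b + 1)).mono (prod_mono inter_subset_left subset_rfl)))
  have hS : ∀ x ∈ W, ∃ M : s₁.chain.space b →L[𝕜] s₁.chain.space b,
      (∀ v, S x (M v) = v) ∧ (∀ v, M (S x v) = v) ∧ ∀ v, ‖M v‖ ≤ C * ‖v‖ := by
    intro x hx
    have hlow' : ∀ u, ‖u‖ ≤ C * ‖S x u‖ := hlow x (lt_of_lt_of_le hx.2 (min_le_left _ _))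
    have hu : IsUnit (S x) := by
      refine IsCompactOperator.isUnit_one_add ((s₁.chain.ι_compact b).comp_clm _) fun u hu => ?_
      have h1 := hlow' u
      have h2 : S x u = 0 := hu
      rw [h2, norm_zero, mul_zero] at h1
      exact norm_le_zero_iff.1 h1
    obtain ⟨U, hU⟩ := hu
    refine ⟨U.inv, fun v => ?_, fun v => ?_, fun v => ?_⟩
    · rw [← hU]; exact DFunLike.congr_fun U.val_inv v
    · rw [← hU]; exact DFunLike.congr_fun U.inv_val v
    · have h1 := hlow' (U.inv v)
      rwa [← hU, show (U : s₁.chain.space b →L[𝕜] s₁.chain.space b) (U.inv v) = v from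
        DFunLike.congr_fun U.val_inv v] at h1
  choose! M hM₁ hM₂ hM₃ using hS
  have hMc : ContinuousOn (fun z : s.chain.space p × s₁.chain.space b => M z.1 z.2)
      (W ×ˢ univ) := by
    rintro ⟨x₁, v₁⟩ ⟨hx₁, -⟩
    change Tendsto _ _ _
    rw [tendsto_iff_norm_sub_tendsto_zero]
    have h1 : Tendsto (fun z : s.chain.space p × s₁.chain.space b =>
        C * ‖z.2 - S z.1 (M x₁ v₁)‖) (𝓝[W ×ˢ univ] (x₁, v₁)) (𝓝 0) := by
      have h2 : ContinuousOn (fun z : s.chain.space p × s₁.chain.space b =>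
          C * ‖z.2 - S z.1 (M x₁ v₁)‖) (W ×ˢ univ) := by
        refine (continuousOn_snd.sub ?_).norm.const_mul C
        exact hSc.comp (f := fun z : s.chain.space p × s₁.chain.space b => (z.1, M x₁ v₁))
          (by fun_prop) fun z hz => ⟨hz.1, trivial⟩
      have h3 := (h2 (x₁, v₁) ⟨hx₁, trivial⟩).tendsto
      simpa [hM₁ x₁ hx₁] using h3
    refine squeeze_zero' (Eventually.of_forall fun z => norm_nonneg _) ?_ h1
    filter_upwards [self_mem_nhdsWithin] with z hz
    -- Strong continuity of the inverses follows from their uniform bound and the continuity of `S`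
    -- in `x` at the single vector `M x₁ v₁`.
    have h2 : M z.1 z.2 - M x₁ v₁ = M z.1 (z.2 - S z.1 (M x₁ v₁)) := by
      rw [map_sub, hM₂ z.1 hz.1]
    rw [h2]
    exact hM₃ z.1 hz.1 _
  -- This is the identity `(1 + κ)⁻¹ = 1 - κ (1 + κ)⁻¹`: the inverse at level `b` is followed by the
  -- smoothing extensions of `κ x`, so the values lie in the limit.
  have hμ : ∀ x ∈ V', ∃ L : E₁ →ₗ[𝕜] E₁, ∀ v j, s₁.lev j (L v) =
      -f j (s.lev (a j) x) (M (s.lev p x) (s₁.lev b v)) := by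
    intro x hx
    choose y hy using fun v => hlim x (hV'V hx) (M (s.lev p x) (s₁.lev b v))
    refine ⟨{ toFun := fun v => -y v, map_add' := fun v v' => ?_, map_smul' := fun α v => ?_ },
      fun v j => ?_⟩
    · refine s₁.ext_lev fun j => ?_
      simp only [map_neg, map_add, hy, neg_add]
    · refine s₁.ext_lev fun j => ?_
      simp only [map_neg, map_smul, hy, smul_neg, RingHom.id_apply]
    · change s₁.lev j (-y v) = _
      rw [map_neg, hy]
  choose! μ hμ using hμ
  have hz : ∀ x ∈ V', ∀ v, s₁.lev b (v + μ x v) = M (s.lev p x) (s₁.lev b v) := by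
    intro x hx v
    have h1 := hM₁ _ ((hWV' x).2 hx) (s₁.lev b v)
    change M _ _ + s₁.chain.ι b (f (b + 1) (s.lev p x) _) = _ at h1
    rw [hι x (hV'V hx)] at h1
    rw [map_add, hμ x hx, ← sub_eq_add_neg, sub_eq_iff_eq_add]
    exact h1.symm
  have hμκ : ∀ x ∈ V', ∀ v j, s₁.lev j (μ x v) = -s₁.lev j (κ x (v + μ x v)) := by
    intro x hx v j
    rw [hμ x hx, ← hfκ j x (hV'V hx), hz x hx]
  have hpj : ∀ j, p ≤ a (b + 1 + j) := fun j => ha.mono (Nat.le_add_right _ _)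
  have haj : ∀ j, a j ≤ a (b + 1 + j) := fun j => ha.mono (Nat.le_add_left _ _)
  have hbp : b ≤ p := ha.mono (Nat.zero_le _)
  refine ⟨μ, ⟨_, ha.comp (.shift' c (b + 1)), min δ ε, lt_min hδ hε, fun j => ?_,
    fun hc j => ?_⟩, ?_⟩
  · change LevelExt s s₁ s₁ V' μ (a (b + 1 + j)) p j
    refine LevelExt.mono (q := b) ?_ le_rfl hbp le_rfl
    refine ⟨s.chain.incl (haj j) ⁻¹' D j ∩ s.chain.incl (hpj j) ⁻¹' W,
      ((hD j).preimage (ContinuousLinearMap.continuous _)).inter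
        (hWo.preimage (ContinuousLinearMap.continuous _)), fun x => ?_,
      fun x => -(f j (s.chain.incl (haj j) x)).comp (M (s.chain.incl (hpj j) x)), ?_,
      fun x hx u => ?_⟩
    · rw [mem_inter_iff, mem_preimage, mem_preimage, incl_lev, incl_lev, hDV, hWV']
      exact ⟨fun h => h.2, fun h => ⟨hV'V h, h⟩⟩
    · have h1 : ContinuousOn (fun z : s.chain.space (a (b + 1 + j)) × s₁.chain.space b =>
          M (s.chain.incl (hpj j) z.1) z.2)
          ((s.chain.incl (haj j) ⁻¹' D j ∩ s.chain.incl (hpj j) ⁻¹' W) ×ˢ univ) :=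
        hMc.comp (f := fun z : s.chain.space (a (b + 1 + j)) × s₁.chain.space b =>
          (s.chain.incl (hpj j) z.1, z.2)) (by fun_prop) fun z hz => ⟨hz.1.2, trivial⟩
      have h2 := (hf j).comp (f := fun z : s.chain.space (a (b + 1 + j)) × s₁.chain.space b =>
        (s.chain.incl (haj j) z.1, M (s.chain.incl (hpj j) z.1) z.2))
        ((show ContinuousOn (fun z : s.chain.space (a (b + 1 + j)) × s₁.chain.space b =>
          s.chain.incl (haj j) z.1) _ by fun_prop).prodMk h1) fun z hz => ⟨hz.1.1, trivial⟩
      exact h2.neg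
    · simp only [incl_lev, neg_apply, ContinuousLinearMap.comp_apply]
      rw [hμ x hx]
  -- Since `μ x v = -κ x (v + μ x v)`, the estimate for `κ` applies, and the uniform bound on `M`
  -- controls `v + μ x v` by `v` at level `b`.
  · obtain ⟨K, hK0, hK⟩ := hκ.tame hc j
    refine ⟨K * C, by positivity, fun x hx v => ?_⟩
    have hx' : x ∈ V' := hx
    have e1 : ‖s₁.lev b (v + μ x v)‖ ≤ C * ‖s₁.lev (a (b + 1 + 0)) v‖ := by
      rw [hz x hx']
      refine (hM₃ _ ((hWV' x).2 hx') _).trans ?_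
      gcongr
      exact s₁.norm_lev_mono hbp v
    rw [hμκ x hx', norm_neg]
    calc ‖s₁.lev j (κ x (v + μ x v))‖
        ≤ K * ((1 + ‖s.lev (a j) x‖) * ‖s₁.lev b (v + μ x v)‖) := hK x (hV'V hx') _
      _ ≤ K * ((1 + ‖s.lev (a (b + 1 + j)) x‖) * (C * ‖s₁.lev (a (b + 1 + 0)) v‖)) := by
        gcongr
        exact s.norm_lev_mono (haj j) x
      _ = _ := by ring
  · filter_upwards [(s.isOpen_ball p x₀ (min δ ε)).mem_nhds
      (s.mem_ball_self _ _ (lt_min hδ hε))] with x hx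
    refine ⟨LinearMap.ext fun u => s₁.ext_lev fun j => ?_,
      LinearMap.ext fun v => s₁.ext_lev fun j => ?_⟩
    · simp only [LinearMap.comp_apply, LinearMap.add_apply, LinearMap.id_apply]
      have h1 : M (s.lev p x) (s₁.lev b (u + κ x u)) = s₁.lev b u := by
        rw [← hM₂ _ ((hWV' x).2 hx) (s₁.lev b u)]
        congr 1
        change _ = s₁.lev b u + s₁.chain.ι b (f (b + 1) (s.lev p x) (s₁.lev b u))
        rw [hι x (hV'V hx), hfκ b x (hV'V hx), map_add]
      rw [map_add (s₁.lev j) (u + κ x u), hμ x hx, h1, hfκ j x (hV'V hx), map_add]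
      abel
    · simp only [LinearMap.comp_apply, LinearMap.add_apply, LinearMap.id_apply]
      rw [map_add (s₁.lev j) (v + μ x v), map_add (s₁.lev j) v, hμκ x hx]
      abel

end ScStructure

/-! ### Riesz theory of compact perturbations of the identity. -/

namespace IsCompactOperator

variable {𝕜 X : Type*} [RCLike 𝕜] [NormedAddCommGroup X] [NormedSpace 𝕜 X] [CompleteSpace X]
  {K : X →L[𝕜] X}

/-- On the kernel `K` is minus the identity, so the identity of the kernel is compact. -/
theorem finiteDimensional_ker_one_add (hK : IsCompactOperator K) :
    FiniteDimensional 𝕜 (LinearMap.ker (1 + K : X →L[𝕜] X).toLinearMap) := by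
  set N := LinearMap.ker (1 + K : X →L[𝕜] X).toLinearMap with hN
  have hN' : ∀ v ∈ N, K v = -v := by
    intro v hv
    have h1 : v + K v = 0 := hv
    exact eq_neg_of_add_eq_zero_right h1
  have hmaps : ∀ v ∈ N, (K : X →ₗ[𝕜] X) v ∈ N := by
    intro v hv
    change K v ∈ N
    rw [hN' v hv]
    exact N.neg_mem hv
  have hcl : IsClosed (N : Set X) := (1 + K).isClosed_ker
  have : CompleteSpace N := hcl.completeSpace_coe
  have h1 := (IsCompactOperator.restrict' (f := (K : X →ₗ[𝕜] X)) hK hmaps).neg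
  have h2 : (id : N → N) = -(K : X →ₗ[𝕜] X).restrict hmaps := by
    funext v
    refine Subtype.ext ?_
    change (v : X) = -K v
    rw [hN' v v.2, neg_neg]
  refine FiniteDimensional.of_isCompactOperator_id ?_
  change IsCompactOperator (id : N → N)
  rw [h2]
  exact h1

/-- If the cokernel were infinite-dimensional, the finite-dimensional kernel would embed into it.
Lifting this embedding to a finite-rank operator `F` makes `1 + K + F` injective, hence surjective
by the Fredholm alternative; then the embedding is onto, a contradiction. -/
theorem finiteDimensional_quotient_range_one_add (hK : IsCompactOperator K) :
    FiniteDimensional 𝕜 (X ⧸ LinearMap.range (1 + K : X →L[𝕜] X).toLinearMap) := by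
  set S : X →L[𝕜] X := 1 + K with hS
  set R := LinearMap.range S.toLinearMap with hR
  have hN : FiniteDimensional 𝕜 (LinearMap.ker S.toLinearMap) := hK.finiteDimensional_ker_one_add
  by_contra hinf
  have hrank : Module.rank 𝕜 (LinearMap.ker S.toLinearMap) ≤ Module.rank 𝕜 (X ⧸ R) :=
    (Module.rank_lt_aleph0_iff.2 hN).le.trans
      (not_lt.1 fun h => hinf (Module.rank_lt_aleph0_iff.1 h))
  obtain ⟨F', hF'⟩ := rank_le_iff_exists_linearMap.1 hrank
  -- The section need not be continuous: it is used only after a map from the finite-dimensional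
  -- kernel.
  obtain ⟨σ, hσ⟩ := LinearMap.exists_rightInverse_of_surjective R.mkQ R.range_mkQ
  have hσ' : ∀ q, R.mkQ (σ q) = q := fun q => LinearMap.congr_fun hσ q
  obtain ⟨p, hp⟩ := Submodule.ClosedComplemented.of_finiteDimensional (LinearMap.ker S.toLinearMap)
  let F₀ : LinearMap.ker S.toLinearMap →L[𝕜] X :=
    ⟨σ ∘ₗ F', LinearMap.continuous_of_finiteDimensional _⟩
  let F : X →L[𝕜] X := F₀.comp p
  have hF : ∀ x, R.mkQ (F x) = F' (p x) := fun x => hσ' _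
  have : LocallyCompactSpace (LinearMap.ker S.toLinearMap) :=
    have := FiniteDimensional.proper 𝕜 (LinearMap.ker S.toLinearMap)
    inferInstance
  have hpc : IsCompactOperator p := isCompactOperator_of_locallyCompactSpace_dom p
  have hFc : IsCompactOperator F := hpc.clm_comp F₀
  have hinj : ∀ u, u + (K + F) u = 0 → u = 0 := by
    intro u hu
    have h1 : S u + F u = 0 := by
      rw [← hu, hS]
      simp [add_assoc]
    have h2 : F' (p u) = 0 := by
      rw [← hF, eq_neg_of_add_eq_zero_right h1, map_neg, neg_eq_zero]
      exact (Submodule.Quotient.mk_eq_zero R).2 ⟨u, rfl⟩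
    have h3 : p u = 0 := hF' (by rw [h2, map_zero])
    have h4 : S u = 0 := by
      have : F u = 0 := by
        change σ (F' (p u)) = 0
        rw [h2, map_zero]
      rwa [this, add_zero] at h1
    have h5 := hp ⟨u, h4⟩
    rw [h3] at h5
    exact (congrArg Subtype.val h5).symm
  obtain ⟨U, hU⟩ := (hK.add hFc).isUnit_one_add hinj
  have hsurj : Function.Surjective F' := by
    intro q
    obtain ⟨y, rfl⟩ := R.mkQ_surjective q
    refine ⟨p (U.inv y), ?_⟩
    have h1 : (1 + (K + F)) (U.inv y) = y := by
      rw [← hU]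
      exact DFunLike.congr_fun U.val_inv y
    have h2 : S (U.inv y) + F (U.inv y) = y := by
      refine Eq.trans ?_ h1
      simp [hS, add_assoc]
    rw [← hF]
    conv_rhs => rw [← h2, map_add]
    rw [right_eq_add]
    exact (Submodule.Quotient.mk_eq_zero R).2 ⟨_, rfl⟩
  exact hinf (Module.Finite.of_surjective F' hsurj)

/-- Restricted to a closed complement of the kernel, the operator is injective with the same range.
This range has a finite-dimensional, hence closed, complement, so it is closed. -/
theorem isClosed_range_one_add (hK : IsCompactOperator K) :
    IsClosed (LinearMap.range (1 + K : X →L[𝕜] X).toLinearMap : Set X) := by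
  set S : X →L[𝕜] X := 1 + K with hS
  have hN : FiniteDimensional 𝕜 (LinearMap.ker S.toLinearMap) := hK.finiteDimensional_ker_one_add
  have hQ := hK.finiteDimensional_quotient_range_one_add
  obtain ⟨p, hp⟩ := Submodule.ClosedComplemented.of_finiteDimensional (LinearMap.ker S.toLinearMap)
  have hcl : IsClosed (LinearMap.ker p.toLinearMap : Set X) := p.isClosed_ker
  have : CompleteSpace (LinearMap.ker p.toLinearMap) := hcl.completeSpace_coe
  let S' := S.comp (LinearMap.ker p.toLinearMap).subtypeL
  have hrange : LinearMap.range S'.toLinearMap = LinearMap.range S.toLinearMap := by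
    refine le_antisymm ?_ ?_
    · rintro _ ⟨x, rfl⟩
      exact ⟨x, rfl⟩
    · rintro _ ⟨x, rfl⟩
      refine ⟨⟨x - p x, ?_⟩, ?_⟩
      · change p (x - p x) = 0
        rw [map_sub, hp, sub_self]
      · change S (x - p x) = S x
        have : S (p x) = 0 := (p x).2
        rw [map_sub, this, sub_zero]
  have hker : LinearMap.ker S'.toLinearMap = ⊥ := by
    rw [LinearMap.ker_eq_bot']
    intro x hx
    have h1 : S x = 0 := hx
    have h2 := hp ⟨x, h1⟩
    have h3 : p x = 0 := x.2
    rw [h3] at h2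
    exact Subtype.ext (congrArg Subtype.val h2).symm
  obtain ⟨G, hG⟩ := Submodule.exists_isCompl (LinearMap.range S'.toLinearMap)
  have : FiniteDimensional 𝕜 (X ⧸ LinearMap.range S'.toLinearMap) := by
    rw [hrange]; exact hQ
  have : FiniteDimensional 𝕜 G :=
    (Submodule.quotientEquivOfIsCompl _ _ hG).finiteDimensional
  rw [← hrange]
  exact S'.closed_complemented_range_of_isCompl_of_ker_eq_bot G hG
    (Submodule.closed_of_finiteDimensional G) hker

end IsCompactOperator

/-! ### Smoothing projections of finite rank. -/

namespace ScStructure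

variable {𝕜 : Type w} [RCLike 𝕜]
variable {E : Type u} [AddCommGroup E] [Module 𝕜 E] [TopologicalSpace E]
variable {F : Type v} [AddCommGroup F] [Module 𝕜 F] [TopologicalSpace F]
variable {s : ScStructure 𝕜 E} {t : ScStructure 𝕜 F} {c : ScContext}

/-- A smoothing operator acts compactly on some level; the limit is recovered as the preimage. -/
theorem IsSmoothing.exists_compact {K : E →ₗ[𝕜] E} (hK : IsSmoothing s s K) :
    ∃ b, ∃ k : s.chain.space b →L[𝕜] s.chain.space b, IsCompactOperator k ∧
      (∀ u, k (s.lev b u) = s.lev b (K u)) ∧ ∀ w, ∃ y, s.lev b y = k w := by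
  obtain ⟨b, hb⟩ := hK
  choose f hf using fun j => (hb j).exists_clm
  refine ⟨b, (s.chain.ι b).comp (f (b + 1)), (s.chain.ι_compact b).comp_clm _, fun u => ?_,
    fun w => ?_⟩
  · rw [ContinuousLinearMap.comp_apply, hf, ι_lev]
  · obtain ⟨y, hy⟩ := exists_lev_eq_of_smoothing f hf w
    exact ⟨y, by rw [ContinuousLinearMap.comp_apply, ← hy, ι_lev]⟩

/-- The map to level `b` embeds this kernel into that of a compact perturbation of the identity. -/
theorem IsSmoothing.finiteDimensional_ker {K : E →ₗ[𝕜] E} (hK : IsSmoothing s s K) :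
    FiniteDimensional 𝕜 (LinearMap.ker (LinearMap.id + K)) := by
  obtain ⟨b, k, hk, hkK, -⟩ := hK.exists_compact
  have := hk.finiteDimensional_ker_one_add
  let g : LinearMap.ker (LinearMap.id + K) →ₗ[𝕜] LinearMap.ker (1 + k).toLinearMap :=
    ((s.lev b : E →ₗ[𝕜] s.chain.space b) ∘ₗ (LinearMap.ker _).subtype).codRestrict _ (by
      intro x
      change s.lev b x + k (s.lev b x) = 0
      have hx : (x : E) + K x = 0 := x.2
      rw [hkK, ← map_add, hx, map_zero])
  refine FiniteDimensional.of_injective g fun x y h => ?_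
  exact Subtype.ext (s.lev_injective b (congrArg Subtype.val h))

/-- A finite-dimensional subspace is the range of a smoothing projection. -/
theorem exists_projection_of_finiteDimensional (s : ScStructure 𝕜 E) (N : Submodule 𝕜 E)
    [FiniteDimensional 𝕜 N] : ∃ P : E →ₗ[𝕜] E, IsSmoothing s s P ∧ LinearMap.range P = N ∧
      ∀ x, P (P x) = P x := by
  -- The projection is built at level `0`, where the image of `N` has a continuous projection. Going
  -- back to `N` and on to level `j` is bounded because the image is finite-dimensional.
  let l : N →ₗ[𝕜] s.chain.space 0 := (s.lev 0 : E →ₗ[𝕜] s.chain.space 0) ∘ₗ N.subtype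
  have hl : Function.Injective l := (s.lev_injective 0).comp Subtype.val_injective
  let e := LinearEquiv.ofInjective l hl
  obtain ⟨p, hp⟩ := Submodule.ClosedComplemented.of_finiteDimensional (LinearMap.range l)
  let P : E →ₗ[𝕜] E := N.subtype ∘ₗ e.symm.toLinearMap ∘ₗ p.toLinearMap ∘ₗ (s.lev 0).toLinearMap
  have hPN : ∀ x : N, P x = x := by
    intro x
    have h1 : p (s.lev 0 x) = e x := hp (e x)
    change ((e.symm (p (s.lev 0 x)) : N) : E) = x
    rw [h1, e.symm_apply_apply]
  have hrange : LinearMap.range P = N := by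
    refine le_antisymm ?_ fun x hx => ⟨x, hPN ⟨x, hx⟩⟩
    rintro _ ⟨x, rfl⟩
    exact (e.symm (p (s.lev 0 x))).2
  refine ⟨P, ⟨0, fun j => ?_⟩, hrange, fun x => hPN ⟨P x, by rw [← hrange]; exact ⟨x, rfl⟩⟩⟩
  let q : LinearMap.range l →ₗ[𝕜] s.chain.space j :=
    (s.lev j).toLinearMap ∘ₗ N.subtype ∘ₗ e.symm.toLinearMap
  exact .of_clm ((⟨q, q.continuous_of_finiteDimensional⟩ :
    LinearMap.range l →L[𝕜] s.chain.space j).comp p) fun x => rfl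

/-- A subspace that contains the range of a smoothing perturbation of the identity is the kernel of
a smoothing projection. -/
theorem IsSmoothing.exists_projection {K : E →ₗ[𝕜] E} (hK : IsSmoothing s s K)
    {R : Submodule 𝕜 E} (hR : ∀ x, x + K x ∈ R) : ∃ P : E →ₗ[𝕜] E, IsSmoothing s s P ∧
      FiniteDimensional 𝕜 (LinearMap.range P) ∧ LinearMap.ker P = R ∧ ∀ x, P (P x) = P x := by
  obtain ⟨b, k, hk, hkK, hklim⟩ := hK.exists_compact
  set R' := LinearMap.range (1 + k).toLinearMap with hR'
  have hfin : FiniteDimensional 𝕜 (s.chain.space b ⧸ R') :=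
    hk.finiteDimensional_quotient_range_one_add
  have hcl' : IsClosed (R' : Set (s.chain.space b)) := hk.isClosed_range_one_add
  -- Adding the image of `R` to the closed range of finite codimension at level `b` keeps both
  -- properties and makes `R` exactly the preimage of the sum.
  set R'' := R' ⊔ R.map (s.lev b).toLinearMap with hR''
  have hcl : IsClosed (R'' : Set (s.chain.space b)) :=
    Submodule.isClosed_mono_of_finiteDimensional_quotient hcl' le_sup_left
  have : FiniteDimensional 𝕜 (s.chain.space b ⧸ R'') :=
    Module.Finite.of_surjective (Submodule.factor (le_sup_left : R' ≤ R''))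
      (Submodule.factor_surjective _)
  -- Solving `lev b x = (w + k w) + lev b r` for `w` shows that `w` comes from the limit, as `k`
  -- takes values there. Hence `x - r` is a value of `id + K` on `E` and lies in `R`.
  have hcomap : ∀ x, s.lev b x ∈ R'' → x ∈ R := by
    intro x hx
    obtain ⟨_, ⟨w, rfl⟩, _, ⟨r, hr, rfl⟩, hxy⟩ := Submodule.mem_sup.1 hx
    change (w + k w) + s.lev b r = s.lev b x at hxy
    obtain ⟨y, hy⟩ := hklim w
    have hw : w = s.lev b (x - r - y) := by
      rw [map_sub, map_sub, ← hxy, hy]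
      abel
    have h1 : x - r = (x - r - y) + K (x - r - y) := by
      apply s.lev_injective b
      rw [map_add, ← hkK, ← hw, map_sub, ← hxy]
      abel
    have h2 : x - r ∈ R := by rw [h1]; exact hR _
    have h3 := R.add_mem h2 hr
    rwa [sub_add_cancel] at h3
  -- An algebraic complement embeds into the finite-dimensional quotient at level `b`; a left
  -- inverse of this embedding yields a projection that factors through level `b`, which makes it
  -- smoothing.
  obtain ⟨C, hC⟩ := Submodule.exists_isCompl R
  let h : C →ₗ[𝕜] s.chain.space b ⧸ R'' := R''.mkQ ∘ₗ (s.lev b).toLinearMap ∘ₗ C.subtype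
  have hker : LinearMap.ker h = ⊥ := by
    rw [LinearMap.ker_eq_bot']
    intro x hx
    have h1 : (x : E) ∈ R := hcomap _ ((Submodule.Quotient.mk_eq_zero R'').1 hx)
    exact Subtype.ext (Submodule.disjoint_def.1 hC.disjoint _ h1 x.2)
  have : FiniteDimensional 𝕜 C := FiniteDimensional.of_injective h (LinearMap.ker_eq_bot.1 hker)
  obtain ⟨g, hg⟩ := LinearMap.exists_leftInverse_of_injective h hker
  let P : E →ₗ[𝕜] E := C.subtype ∘ₗ g ∘ₗ R''.mkQ ∘ₗ (s.lev b).toLinearMap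
  have hPC : ∀ x : C, P x = x := fun x => congrArg Subtype.val (LinearMap.congr_fun hg x)
  have hPmem : ∀ x, P x ∈ C := fun x => (g _).2
  have hPR : ∀ x ∈ R, P x = 0 := by
    intro x hx
    change ((g (R''.mkQ (s.lev b x)) : C) : E) = 0
    have : R''.mkQ (s.lev b x) = 0 :=
      (Submodule.Quotient.mk_eq_zero R'').2 (le_sup_right (a := R') ⟨x, hx, rfl⟩)
    rw [this, map_zero]
    rfl
  refine ⟨P, ⟨b, fun j => ?_⟩, ?_, ?_, fun x => hPC ⟨P x, hPmem x⟩⟩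
  · let q : s.chain.space b ⧸ R'' →ₗ[𝕜] s.chain.space j :=
      (s.lev j).toLinearMap ∘ₗ C.subtype ∘ₗ g
    have hq : Continuous q := q.continuous_of_finiteDimensional
    exact .of_clm ⟨q ∘ₗ R''.mkQ, hq.comp continuous_quot_mk⟩ fun x => rfl
  · have hle : LinearMap.range P ≤ C := by
      rintro _ ⟨x, rfl⟩
      exact hPmem x
    exact Submodule.finiteDimensional_of_le hle
  · refine le_antisymm (fun x hx => ?_) hPR
    obtain ⟨y, hy, z, hz, rfl⟩ := Submodule.mem_sup.1 (hC.sup_eq_top ▸ Submodule.mem_top (x := x))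
    have h1 : P (y + z) = 0 := hx
    rw [map_add, hPR y hy, zero_add, hPC ⟨z, hz⟩] at h1
    change z = 0 at h1
    rw [h1, add_zero]
    exact hy

end ScStructure

/-! ### Splittings from smoothing projections. -/

section

open ScStructure

variable {𝕜 : Type w} [RCLike 𝕜]
variable {E : Type u} [AddCommGroup E] [Module 𝕜 E] [TopologicalSpace E]
variable {s : ScStructure 𝕜 E} {c : ScContext} {𝒮 : Set (ScStructure 𝕜 E)}

/-- The kernel of a projection that is bounded on every level is an sc-subspace. -/
theorem isScSubspace_ker (hs : s ∈ 𝒮) {P : E →ₗ[𝕜] E} (hP : ∀ j, IsBdd s s P j j)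
    (hPP : ∀ x, P (P x) = P x) : IsScSubspace 𝒮 (LinearMap.ker P) := by
  choose q hq using fun j => (hP j).exists_clm
  have hcomm : ∀ k x, q k (s.chain.ι k x) = s.chain.ι k (q (k + 1) x) := by
    intro k
    have h1 : Continuous fun x => q k (s.chain.ι k x) := by fun_prop
    have h2 : Continuous fun x => s.chain.ι k (q (k + 1) x) := by fun_prop
    refine congrFun ((s.lev_denseRange (k + 1)).equalizer h1 h2 (funext fun x => ?_))
    simp [ι_lev, hq]
  have hidem : ∀ k x, q k (q k x) = q k x := by
    intro k
    have h1 : Continuous fun x => q k (q k x) := by fun_prop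
    refine congrFun ((s.lev_denseRange k).equalizer h1 (q k).continuous (funext fun x => ?_))
    simp [hq, hPP]
  refine ⟨?_, s, hs, ⟨fun k => LinearMap.ker (q k).toLinearMap, fun k => (q k).isClosed_ker,
    fun k x hx => ?_, fun k x hx => ?_⟩, fun x => ?_⟩
  · have : (LinearMap.ker P : Set E) = {x | q 0 (s.lev 0 x) = 0} := by
      ext x
      change P x = 0 ↔ q 0 (s.lev 0 x) = 0
      rw [hq]
      exact ⟨fun h => by rw [h, map_zero], fun h => s.lev_injective 0 (by rw [h, map_zero])⟩
    rw [this]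
    exact isClosed_eq (by fun_prop) continuous_const
  · change q k (s.chain.ι k x) = 0
    have : q (k + 1) x = 0 := hx
    rw [hcomm, this, map_zero]
  · have hx' : q k x = 0 := hx
    have hc : Continuous fun y => y - q k y := by fun_prop
    -- Approximations of `x` from the next level are corrected by `y - q k y`, which moves them into
    -- the kernel and fixes `x`.
    have h1 := image_closure_subset_closure_image hc ⟨x, s.chain.ι_denseRange k x, rfl⟩
    simp only [hx', sub_zero] at h1
    refine closure_mono ?_ h1
    rintro _ ⟨_, ⟨y, rfl⟩, rfl⟩
    refine ⟨y - q (k + 1) y, ?_, ?_⟩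
    · change q (k + 1) (y - q (k + 1) y) = 0
      rw [map_sub, hidem, sub_self]
    · change _ = s.chain.ι k y - q k (s.chain.ι k y)
      rw [map_sub, hcomm]
  · change P (s.equiv x) = 0 ↔ ∀ k, q k (x.1 k) = 0
    simp only [← s.lev_equiv, hq]
    exact ⟨fun h k => by rw [h, map_zero], fun h => s.ext_lev fun k => by rw [h, map_zero]⟩

/-- A smoothing projection splits an sc-Fréchet space. -/
theorem nonempty_scSplitting (h𝒮 : IsScClass c 𝒮) (hs : s ∈ 𝒮) {P : E →ₗ[𝕜] E}
    (hP : IsSmoothing s s P) (hPP : ∀ x, P (P x) = P x) :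
    Nonempty (ScSplitting c 𝒮 (LinearMap.ker P) (LinearMap.range P)) ∧
      Nonempty (ScSplitting c 𝒮 (LinearMap.range P) (LinearMap.ker P)) := by
  obtain ⟨b, hb⟩ := hP
  have hsh := ScContext.IsRescaling.shift c b
  have hr := h𝒮.rescale_mem hs hsh
  set r := s.rescale _ hsh.strictMono with hr_def
  -- `P` maps level `b` into every level, so after the shift by `b` it is bounded on each level
  -- without loss, and so is `id - P`.
  have hPr : ∀ j, IsBdd r r P j j := fun j => (hb (j + b)).mono (Nat.le_add_left _ _) le_rfl
  set Q : E →ₗ[𝕜] E := LinearMap.id - P with hQ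
  have hQr : ∀ j, IsBdd r r Q j j := fun j => by
    rw [hQ, sub_eq_add_neg]
    exact (IsBdd.id le_rfl).add (hPr j).neg
  have hQQ : ∀ x, Q (Q x) = Q x := fun x => by simp [hQ, hPP]
  have hrange : LinearMap.range P = LinearMap.ker Q := by
    ext x
    rw [LinearMap.mem_range, LinearMap.mem_ker, hQ, LinearMap.sub_apply, LinearMap.id_apply,
      sub_eq_zero]
    exact ⟨fun ⟨y, hy⟩ => by rw [← hy, hPP], fun h => ⟨x, h.symm⟩⟩
  have key : ∀ {P Q : E →ₗ[𝕜] E}, (∀ j, IsBdd r r P j j) → (∀ j, IsBdd r r Q j j) →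
      (∀ x, P (P x) = P x) → (∀ x, Q (Q x) = Q x) → (∀ x, P x + Q x = x) →
      Nonempty (ScSplitting c 𝒮 (LinearMap.ker P) (LinearMap.ker Q)) := by
    intro P Q hP hQ hPP hQQ hPQ
    have hX := isScSubspace_ker hr hP hPP
    have hY := isScSubspace_ker hr hQ hQQ
    obtain ⟨r₁, hr₁⟩ := (h𝒮.subClass hX).nonempty
    obtain ⟨r₂, hr₂⟩ := (h𝒮.subClass hY).nonempty
    have hPQ0 : ∀ x, P (Q x) = 0 := fun x => by
      have h1 := hPQ x
      have h2 := congrArg P h1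
      rwa [map_add, hPP, add_eq_left] at h2
    have hQP0 : ∀ x, Q (P x) = 0 := fun x => by
      have h1 := hPQ x
      have h2 := congrArg Q h1
      rwa [map_add, hQQ, add_eq_right] at h2
    let q : E →ₗ[𝕜] LinearMap.ker P := Q.codRestrict _ hPQ0
    let p : E →ₗ[𝕜] LinearMap.ker Q := P.codRestrict _ hQP0
    have hq : IsMor c r r₁ q := isMor_of_subtype h𝒮 hr hr₁ ⟨_, .id c, hQ⟩
    have hp : IsMor c r r₂ p := isMor_of_subtype h𝒮 hr hr₂ ⟨_, .id c, hP⟩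
    refine ⟨⟨hX, hY, q.prod p, fun x y => Prod.ext (Subtype.ext ?_) (Subtype.ext ?_), fun e => ?_,
      ?_⟩⟩
    · change Q (x + y) = x
      have h1 : P x = 0 := x.2
      have h2 : Q y = 0 := y.2
      have h3 := hPQ x
      rw [h1, zero_add] at h3
      rw [map_add, h2, h3, add_zero]
    · change P (x + y) = y
      have h1 : P x = 0 := x.2
      have h2 : Q y = 0 := y.2
      have h3 := hPQ y
      rw [h2, add_zero] at h3
      rw [map_add, h1, h3, zero_add]
    · change Q e + P e = e
      rw [add_comm, hPQ]
    · exact (isScMorphism_iff h𝒮 ((h𝒮.subClass hX).prodClass (h𝒮.subClass hY)) hr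
        (prod_mem_prodClass c hr₁ hr₂)).2 (hq.prod hp)
  rw [hrange]
  exact ⟨key hPr hQr hPP hQQ fun x => by simp [hQ], key hQr hPr hQQ hPP fun x => by simp [hQ]⟩

end

/-! ### Inverting families that have a parametrix. -/

/-- If `1 + K` is a compact perturbation of the identity and `A` is injective on its kernel, then
`1 + K` and `A` together control the norm. -/
theorem exists_lower_bound_of_compact {𝕜 X Z : Type*} [RCLike 𝕜] [NormedAddCommGroup X]
    [NormedSpace 𝕜 X] [NormedAddCommGroup Z]
    [NormedSpace 𝕜 Z] {K : X →L[𝕜] X} (hK : IsCompactOperator K) (A : X →L[𝕜] Z)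
    (hinj : ∀ u, u + K u = 0 → A u = 0 → u = 0) :
    ∃ C > 0, ∀ u, ‖u‖ ≤ C * (‖u + K u‖ + ‖A u‖) := by
  by_contra! hcon
  have hseq : ∀ n : ℕ, ∃ u, ‖u‖ = 1 ∧ ‖u + K u‖ + ‖A u‖ ≤ 1 / (n + 1) := by
    intro n
    obtain ⟨u, hu⟩ := hcon (n + 1) (by positivity)
    have hu0 : 0 < ‖u‖ := lt_of_le_of_lt (by positivity) hu
    have hnorm : ‖((‖u‖⁻¹ : ℝ) : 𝕜)‖ = ‖u‖⁻¹ := by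
      rw [RCLike.norm_ofReal, abs_of_pos (inv_pos.2 hu0)]
    refine ⟨((‖u‖⁻¹ : ℝ) : 𝕜) • u, ?_, ?_⟩
    · rw [norm_smul, hnorm, inv_mul_cancel₀ hu0.ne']
    · rw [map_smul, map_smul, ← smul_add, norm_smul, norm_smul, hnorm, ← mul_add,
        inv_mul_le_iff₀ hu0, mul_one_div, le_div_iff₀ (by positivity), mul_comm]
      exact hu.le
  choose u hu hS using hseq
  obtain ⟨Q, hQ, hQ'⟩ := hK.image_closedBall_subset_compact 1
  obtain ⟨y, -, θ, hθ, hy⟩ := hQ.tendsto_subseq (x := fun n => K (u n))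
    (fun n => hQ' ⟨u n, by simp [hu], rfl⟩)
  have h0 := tendsto_one_div_add_atTop_nhds_zero_nat (𝕜 := ℝ) |>.comp hθ.tendsto_atTop
  have hlim0 : Tendsto (fun n => u (θ n) + K (u (θ n))) atTop (𝓝 0) := by
    rw [tendsto_zero_iff_norm_tendsto_zero]
    refine squeeze_zero (fun n => norm_nonneg _) (fun n => ?_) h0
    exact (le_add_of_nonneg_right (norm_nonneg _)).trans (hS (θ n))
  have hlimA : Tendsto (fun n => A (u (θ n))) atTop (𝓝 0) := by
    rw [tendsto_zero_iff_norm_tendsto_zero]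
    refine squeeze_zero (fun n => norm_nonneg _) (fun n => ?_) h0
    exact (le_add_of_nonneg_left (norm_nonneg _)).trans (hS (θ n))
  have hulim : Tendsto (fun n => u (θ n)) atTop (𝓝 (0 - y)) := by
    refine (hlim0.sub hy).congr fun n => ?_
    simp
  have h1 := tendsto_nhds_unique hlim0 (hulim.add ((K.continuous.tendsto _).comp hulim))
  have h2 := tendsto_nhds_unique hlimA ((A.continuous.tendsto _).comp hulim)
  have h3 := hinj _ h1.symm h2.symm
  have h4 : Tendsto (fun n => ‖u (θ n)‖) atTop (𝓝 ‖0 - y‖) := hulim.norm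
  simp only [hu, h3, norm_zero] at h4
  exact one_ne_zero (tendsto_nhds_unique tendsto_const_nhds h4)

namespace ScStructure

variable {𝕜 : Type w} [RCLike 𝕜]
variable {E : Type u} [AddCommGroup E] [Module 𝕜 E] [TopologicalSpace E]
variable {E₁ : Type u₁} [AddCommGroup E₁] [Module 𝕜 E₁] [TopologicalSpace E₁]
variable {E₂ : Type u₂} [AddCommGroup E₂] [Module 𝕜 E₂] [TopologicalSpace E₂]
variable {s : ScStructure 𝕜 E} {s₁ : ScStructure 𝕜 E₁} {s₂ : ScStructure 𝕜 E₂}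
  {c : ScContext} {x₀ : E}

/-- The inverse of a bijective morphism that has a left parametrix differs from the parametrix by a
smoothing operator. -/
theorem IsSmoothing.comp_symm (e : E₁ ≃ₗ[𝕜] E₂) {B : E₂ →ₗ[𝕜] E₁} {K : E₁ →ₗ[𝕜] E₁}
    (hK : IsSmoothing s₁ s₁ K) (he : IsMor c s₁ s₂ e.toLinearMap) (hB : IsMor c s₂ s₁ B)
    (h : B ∘ₗ e.toLinearMap = LinearMap.id + K) : IsSmoothing s₂ s₁ (K ∘ₗ e.symm.toLinearMap) := by
  obtain ⟨b₀, hb₀⟩ := hK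
  obtain ⟨a, ha, hea⟩ := he
  obtain ⟨d, hd, hBd⟩ := hB
  -- At this level `K` has extensions into all levels and `e` extends to an operator `A` into level
  -- `0`.
  set b := max b₀ (a 0) with hb
  have hKb : ∀ j, IsBdd s₁ s₁ K b j := fun j => (hb₀ j).mono (le_max_left _ _) le_rfl
  choose f hf using fun j => (hKb j).exists_clm
  obtain ⟨A, hA⟩ := ((hea 0).mono (le_max_right b₀ _) le_rfl).exists_clm
  have hcomp : IsCompactOperator ((s₁.chain.ι b).comp (f (b + 1))) :=
    (s₁.chain.ι_compact b).comp_clm _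
  -- Kernel vectors of `1 + K` at level `b` come from the limit, where `A` is given by the injective
  -- `e`. For `u = e.symm v` one has `u + K u = B v`, so the lower bound estimates `e.symm v` at
  -- level `b` by norms of `v`.
  obtain ⟨C, hC, hlow⟩ := exists_lower_bound_of_compact hcomp A (by
    intro w hw hAw
    obtain ⟨y, hy⟩ := exists_lev_eq_of_smoothing f hf w
    rw [ContinuousLinearMap.comp_apply, ← hy, ι_lev] at hw
    have hw' : w = s₁.lev b (-y) := by
      rw [map_neg]
      exact eq_neg_of_add_eq_zero_left hw
    rw [hw', hA] at hAw
    have h1 : e (-y) = 0 := s₂.lev_injective 0 (by rw [map_zero]; exact hAw)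
    rw [hw', e.map_eq_zero_iff.1 h1, map_zero])
  obtain ⟨C', hC'0, hC'⟩ := (hBd b).exists_pos
  have key : IsBdd s₂ s₁ e.symm.toLinearMap (d b) b := by
    refine ⟨C * (C' + 1), fun v => (hlow _).trans ?_⟩
    rw [mul_assoc]
    refine mul_le_mul_of_nonneg_left ?_ hC.le
    rw [add_mul, one_mul]
    refine add_le_add ?_ ?_
    · refine le_trans (le_of_eq ?_) (hC' v)
      rw [ContinuousLinearMap.comp_apply, hf, ι_lev, ← map_add]
      have := LinearMap.congr_fun h (e.symm v)
      simp only [LinearMap.comp_apply, LinearMap.add_apply, LinearMap.id_apply,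
        LinearEquiv.coe_coe, LinearEquiv.apply_symm_apply] at this
      rw [LinearEquiv.coe_coe, this]
    · rw [hA]
      simpa using s₂.norm_lev_mono (Nat.zero_le (d b)) v
  exact ⟨d b, fun j => (hKb j).comp key⟩

/-- A family with a two-sided parametrix that is bijective at `x₀` is invertible near `x₀`. -/
theorem FamNear.exists_inverse {φ : E → E₁ →ₗ[𝕜] E₂} {ψ : E → E₂ →ₗ[𝕜] E₁}
    {κ : E → E₁ →ₗ[𝕜] E₁} {κ' : E → E₂ →ₗ[𝕜] E₂} (hφ : FamNear c s s₁ s₂ x₀ φ)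
    (hψ : FamNear c s s₂ s₁ x₀ ψ) (hκ : SmoothNear c s s₁ s₁ x₀ κ)
    (hκ' : SmoothNear c s s₂ s₂ x₀ κ')
    (h : ∀ᶠ x in 𝓝 x₀, ψ x ∘ₗ φ x = LinearMap.id + κ x ∧ φ x ∘ₗ ψ x = LinearMap.id + κ' x)
    (hbij : Function.Bijective (φ x₀)) :
    ∃ γ : E → E₂ →ₗ[𝕜] E₁, FamNear c s s₂ s₁ x₀ γ ∧
      ∀ᶠ x in 𝓝 x₀, γ x ∘ₗ φ x = LinearMap.id ∧ φ x ∘ₗ γ x = LinearMap.id := by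
  let e := LinearEquiv.ofBijective (φ x₀) hbij
  obtain ⟨hl, hr⟩ := h.self_of_nhds
  -- The constant correction `σ` makes the parametrix equal to the inverse of `φ x₀` at `x₀`.
  set σ : E₂ →ₗ[𝕜] E₁ := -(κ x₀ ∘ₗ e.symm.toLinearMap) with hσ_def
  have hσ : IsSmoothing s₂ s₁ σ :=
    (IsSmoothing.comp_symm e hκ.isSmoothing hφ.isMor hψ.isMor hl).neg
  have hσ' := hσ.smoothNear c s x₀
  have hψσ : ∀ v, ψ x₀ v + σ v = e.symm v := by
    intro v
    have := LinearMap.congr_fun hl (e.symm v)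
    have h2 : φ x₀ (e.symm v) = v := e.apply_symm_apply v
    simp only [LinearMap.comp_apply, LinearMap.add_apply, LinearMap.id_apply, h2] at this
    rw [this, hσ_def]
    simp
  have hβ : FamNear c s s₂ s₁ x₀ (fun x => ψ x + σ) := hψ.add hσ'.famNear
  -- The error of the corrected parametrix is `κ x + σ ∘ φ x`; it vanishes at `x₀`, so the
  -- perturbation of the identity is injective there.
  obtain ⟨μ, hμ, hμ'⟩ := (hκ.add (hσ'.comp_fam hφ)).exists_inverse (by
    intro u hu
    have h1 := LinearMap.congr_fun hl u
    simp only [LinearMap.comp_apply, LinearMap.add_apply, LinearMap.id_apply] at h1 hu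
    rw [← add_assoc, ← h1, hψσ] at hu
    exact (e.symm_apply_apply u).symm.trans hu)
  -- On the other side only the existence of a right inverse matters; it must then coincide with the
  -- left inverse, whose regularity is already known.
  obtain ⟨ν, -, hν'⟩ := (hκ'.add (hφ.comp_smooth hσ')).exists_inverse (by
    intro v hv
    have h1 := LinearMap.congr_fun hr v
    simp only [LinearMap.comp_apply, LinearMap.add_apply, LinearMap.id_apply] at h1 hv
    rw [← add_assoc, ← h1, ← map_add, hψσ] at hv
    exact (e.apply_symm_apply v).symm.trans hv)
  refine ⟨fun x => (LinearMap.id + μ x) ∘ₗ (ψ x + σ),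
    (((IsMor.id c s₁).famNear s x₀).add hμ.famNear).comp hβ, ?_⟩
  filter_upwards [h, hμ', hν'] with x ⟨hx₁, hx₂⟩ hμx hνx
  have hleft : ((LinearMap.id + μ x) ∘ₗ (ψ x + σ)) ∘ₗ φ x = LinearMap.id := by
    rw [LinearMap.comp_assoc, LinearMap.add_comp _ σ, hx₁, add_assoc]
    exact hμx.1
  have hright : φ x ∘ₗ ((ψ x + σ) ∘ₗ (LinearMap.id + ν x)) = LinearMap.id := by
    rw [← LinearMap.comp_assoc, LinearMap.comp_add (ψ x), hx₂, add_assoc]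
    exact hνx.2
  refine ⟨hleft, ?_⟩
  have heq : (LinearMap.id + μ x) ∘ₗ (ψ x + σ) = (ψ x + σ) ∘ₗ (LinearMap.id + ν x) := by
    have h1 := congrArg (((LinearMap.id + μ x) ∘ₗ (ψ x + σ)) ∘ₗ ·) hright
    simp only [← LinearMap.comp_assoc _ (φ x), hleft, LinearMap.id_comp, LinearMap.comp_id] at h1
    exact h1.symm
  rw [heq]
  exact hright

/-- Along this filter on pairs of level and radius, balls around `x₀` shrink to a point. Finitely
many germ properties can then be realised on one common ball. -/
theorem eventually_ball {Q : ℕ × ℝ → Prop} (m : ℕ) {ε : ℝ} (hε : 0 < ε)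
    (h : ∀ m' δ, m ≤ m' → 0 < δ → δ ≤ ε → Q (m', δ)) : ∀ᶠ p in atTop ×ˢ 𝓝[>] 0, Q p :=
  ((eventually_ge_atTop m).prod_mk (Ioc_mem_nhdsGT hε)).mono fun p hp =>
    h p.1 p.2 hp.1 hp.2.1 hp.2.2

theorem eventually_ball_subset (s : ScStructure 𝕜 E) {V : Set E} (hV : V ∈ 𝓝 x₀) :
    ∀ᶠ p in atTop ×ˢ 𝓝[>] 0, x₀ ∈ s.ball p.1 x₀ p.2 ∧ s.ball p.1 x₀ p.2 ⊆ V := by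
  obtain ⟨m, ε, hε, h⟩ := s.exists_ball_subset hV
  exact eventually_ball m hε fun m' δ hm hδ hδε =>
    ⟨s.mem_ball_self _ _ hδ, (s.ball_subset hm x₀ hδε).trans h⟩

variable {𝒮 : Set (ScStructure 𝕜 E)} {𝒮₁ : Set (ScStructure 𝕜 E₁)} {𝒮₂ : Set (ScStructure 𝕜 E₂)}

theorem FamNear.eventually_isScFamily (h𝒮 : IsScClass c 𝒮) (h𝒮₁ : IsScClass c 𝒮₁) (hs : s ∈ 𝒮)
    (hs₁ : s₁ ∈ 𝒮₁) (hs₂ : s₂ ∈ 𝒮₂) {φ : E → E₁ →ₗ[𝕜] E₂} (hφ : FamNear c s s₁ s₂ x₀ φ) :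
    ∀ᶠ p in atTop ×ˢ 𝓝[>] 0, IsScFamily c 𝒮 𝒮₁ 𝒮₂ (s.ball p.1 x₀ p.2) φ := by
  obtain ⟨a, ha, ε, hε, h⟩ := hφ
  exact eventually_ball (a 0) hε fun m δ hm hδ hδε =>
    (h.mono (ha.add_const m) (fun j => Nat.le_add_right _ _) (Nat.le_add_left _ _)
      (s.ball_subset hm x₀ hδε)).isScFamily h𝒮 h𝒮₁ hs hs₁ hs₂ (ha.add_const m)

theorem SmoothNear.eventually_isStronglySmoothingFamily (h𝒮 : IsScClass c 𝒮)
    (h𝒮₁ : IsScClass c 𝒮₁) (hs : s ∈ 𝒮) (hs₁ : s₁ ∈ 𝒮₁) (hs₂ : s₂ ∈ 𝒮₂) {κ : E → E₁ →ₗ[𝕜] E₂}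
    (hκ : SmoothNear c s s₁ s₂ x₀ κ) :
    ∀ᶠ p in atTop ×ˢ 𝓝[>] 0, IsStronglySmoothingFamily c 𝒮 𝒮₁ 𝒮₂ (s.ball p.1 x₀ p.2) κ := by
  obtain ⟨a, ha, ε, hε, h⟩ := hκ
  exact eventually_ball (a 0) hε fun m δ hm hδ hδε =>
    (h.mono (ha.add_const m) (fun j => Nat.le_add_right _ _) (Nat.le_add_left _ _)
      (s.ball_subset hm x₀ hδε)).isStronglySmoothingFamily h𝒮 h𝒮₁ hs hs₁ hs₂ (ha.add_const m)
      (s.isOpen_ball _ _ _)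

end ScStructure

/-! ### Kernels, ranges and compressions of Fredholm families. -/

section

open ScStructure

variable {𝕜 : Type w} [RCLike 𝕜]
variable {E : Type u} [AddCommGroup E] [Module 𝕜 E] [TopologicalSpace E]
variable {E₁ : Type u₁} [AddCommGroup E₁] [Module 𝕜 E₁] [TopologicalSpace E₁]
variable {E₂ : Type u₂} [AddCommGroup E₂] [Module 𝕜 E₂] [TopologicalSpace E₂]
variable {s : ScStructure 𝕜 E} {s₁ : ScStructure 𝕜 E₁} {s₂ : ScStructure 𝕜 E₂} {c : ScContext}
variable {𝒮 : Set (ScStructure 𝕜 E)} {𝒮₁ : Set (ScStructure 𝕜 E₁)} {𝒮₂ : Set (ScStructure 𝕜 E₂)}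

namespace ScSplitting

variable {X Y : Submodule 𝕜 E}

theorem isMor_proj (σ : ScSplitting c 𝒮 X Y) (h𝒮 : IsScClass c 𝒮) (hs : s ∈ 𝒮)
    {r : ScStructure 𝕜 X} {t : ScStructure 𝕜 Y} (hr : r ∈ subClass c 𝒮 X)
    (ht : t ∈ subClass c 𝒮 Y) : IsMor c s (r.prod t) σ.proj :=
  (isScMorphism_iff h𝒮 ((h𝒮.subClass σ.isScSubspace_left).prodClass
    (h𝒮.subClass σ.isScSubspace_right)) hs (prod_mem_prodClass c hr ht)).1 σ.isScMorphism_proj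

/-- The projection onto the first summand. -/
def fst (σ : ScSplitting c 𝒮 X Y) : E →ₗ[𝕜] X := LinearMap.fst 𝕜 X Y ∘ₗ σ.proj

/-- The projection onto the second summand, as an endomorphism. -/
def sndEnd (σ : ScSplitting c 𝒮 X Y) : E →ₗ[𝕜] E := Y.subtype ∘ₗ LinearMap.snd 𝕜 X Y ∘ₗ σ.proj

theorem fst_add_sndEnd (σ : ScSplitting c 𝒮 X Y) (e : E) : (σ.fst e : E) + σ.sndEnd e = e :=
  σ.add_proj e

theorem sndEnd_mem (σ : ScSplitting c 𝒮 X Y) (e : E) : σ.sndEnd e ∈ Y := (σ.proj e).2.2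

theorem fst_coe (σ : ScSplitting c 𝒮 X Y) (x : X) : σ.fst x = x := by
  have := σ.proj_add x 0
  rw [Submodule.coe_zero, add_zero] at this
  exact congrArg Prod.fst this

theorem fst_of_mem (σ : ScSplitting c 𝒮 X Y) {y : E} (hy : y ∈ Y) : σ.fst y = 0 := by
  have := σ.proj_add 0 ⟨y, hy⟩
  rw [Submodule.coe_zero, zero_add] at this
  exact congrArg Prod.fst this

theorem eq_zero_of_mem (σ : ScSplitting c 𝒮 X Y) {e : E} (hX : e ∈ X) (hY : e ∈ Y) : e = 0 := by
  have h1 := σ.fst_coe ⟨e, hX⟩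
  rw [σ.fst_of_mem hY] at h1
  exact (congrArg Subtype.val h1).symm

theorem isMor_fst (σ : ScSplitting c 𝒮 X Y) (h𝒮 : IsScClass c 𝒮) (hs : s ∈ 𝒮)
    {r : ScStructure 𝕜 X} (hr : r ∈ subClass c 𝒮 X) : IsMor c s r σ.fst := by
  obtain ⟨t, ht⟩ := (h𝒮.subClass σ.isScSubspace_right).nonempty
  exact (_root_.isMor_fst c r t).comp (σ.isMor_proj h𝒮 hs hr ht)

theorem isSmoothing_sndEnd (σ : ScSplitting c 𝒮 X Y) (h𝒮 : IsScClass c 𝒮) (hs : s ∈ 𝒮)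
    [FiniteDimensional 𝕜 Y] : IsSmoothing s s σ.sndEnd := by
  obtain ⟨r, hr⟩ := (h𝒮.subClass σ.isScSubspace_left).nonempty
  obtain ⟨t, ht⟩ := (h𝒮.subClass σ.isScSubspace_right).nonempty
  have h1 : IsMor c s t (LinearMap.snd 𝕜 X Y ∘ₗ σ.proj) :=
    (isMor_snd c r t).comp (σ.isMor_proj h𝒮 hs hr ht)
  exact (isMor_subtype h𝒮 hs ht).comp_isSmoothing h1.isSmoothing_of_finiteDimensional

/-- `Y` meets `X`, hence `ker P`, only in zero, so `P` embeds it into its finite-dimensional range.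
-/
theorem finiteDimensional_right (σ : ScSplitting c 𝒮 X Y) {P : E →ₗ[𝕜] E}
    [FiniteDimensional 𝕜 (LinearMap.range P)] (hP : LinearMap.ker P ≤ X) :
    FiniteDimensional 𝕜 Y := by
  refine FiniteDimensional.of_injective (P.rangeRestrict ∘ₗ Y.subtype)
    (LinearMap.ker_eq_bot.1 (LinearMap.ker_eq_bot'.2 fun y hy => ?_))
  have h1 : P y = 0 := congrArg Subtype.val hy
  exact Subtype.ext (σ.eq_zero_of_mem (hP h1) y.2)

end ScSplitting

/-- The kernel of a Fredholm morphism is finite-dimensional. -/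
theorem IsFredholmMorphism.finiteDimensional_ker (h𝒮 : IsScClass c 𝒮) {T : E →ₗ[𝕜] E₁}
    (hT : IsFredholmMorphism c 𝒮 𝒮₁ T) : FiniteDimensional 𝕜 (LinearMap.ker T) := by
  obtain ⟨s, hs⟩ := h𝒮.nonempty
  obtain ⟨-, T', K, -, -, hK, -, h, -⟩ := hT
  have := ((isStronglySmoothingMorphism_iff h𝒮 h𝒮 hs hs).1 hK).finiteDimensional_ker
  refine Submodule.finiteDimensional_of_le (S₂ := LinearMap.ker (LinearMap.id + K)) ?_
  rw [← h]
  exact LinearMap.ker_le_ker_comp T T'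

/-- The range of a Fredholm morphism is the kernel of a smoothing projection of finite rank. -/
theorem IsFredholmMorphism.exists_projection (h𝒮₁ : IsScClass c 𝒮₁) (hs₁ : s₁ ∈ 𝒮₁)
    {T : E →ₗ[𝕜] E₁} (hT : IsFredholmMorphism c 𝒮 𝒮₁ T) : ∃ P : E₁ →ₗ[𝕜] E₁, IsSmoothing s₁ s₁ P ∧
      FiniteDimensional 𝕜 (LinearMap.range P) ∧ LinearMap.ker P = LinearMap.range T ∧
      ∀ x, P (P x) = P x := by
  obtain ⟨-, T', -, K', -, -, hK', -, h⟩ := hT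
  exact ((isStronglySmoothingMorphism_iff h𝒮₁ h𝒮₁ hs₁ hs₁).1 hK').exists_projection
    fun x => ⟨T' x, LinearMap.congr_fun h x⟩

theorem IsFredholmMorphism.exists_scSplitting (h𝒮 : IsScClass c 𝒮) (h𝒮₁ : IsScClass c 𝒮₁)
    {T : E →ₗ[𝕜] E₁} (hT : IsFredholmMorphism c 𝒮 𝒮₁ T) :
    (∃ X, Nonempty (ScSplitting c 𝒮 X (LinearMap.ker T))) ∧
      ∃ C, Nonempty (ScSplitting c 𝒮₁ (LinearMap.range T) C) := by
  obtain ⟨s, hs⟩ := h𝒮.nonempty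
  obtain ⟨s₁, hs₁⟩ := h𝒮₁.nonempty
  constructor
  · have := hT.finiteDimensional_ker h𝒮
    obtain ⟨P, hP, hrange, hPP⟩ := exists_projection_of_finiteDimensional s (LinearMap.ker T)
    exact ⟨LinearMap.ker P, hrange ▸ (nonempty_scSplitting h𝒮 hs hP hPP).1⟩
  · obtain ⟨P, hP, -, hker, hPP⟩ := hT.exists_projection h𝒮₁ hs₁
    exact ⟨LinearMap.range P, hker ▸ (nonempty_scSplitting h𝒮₁ hs₁ hP hPP).1⟩

variable {U : Set E} {φ : E → E₁ →ₗ[𝕜] E₂} {x₀ : E}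

/-- An inverse of the compression to complements of the kernel and the cokernel gives a
parametrix. -/
theorem exists_parametrix_of_compressionInvertibleNear (h𝒮 : IsScClass c 𝒮)
    (h𝒮₁ : IsScClass c 𝒮₁) (h𝒮₂ : IsScClass c 𝒮₂) (hφ : IsScFamily c 𝒮 𝒮₁ 𝒮₂ U φ) (hx₀ : x₀ ∈ U)
    (hF : IsFredholmMorphism c 𝒮₁ 𝒮₂ (φ x₀)) {X : Submodule 𝕜 E₁} {C : Submodule 𝕜 E₂}
    (σ₁ : ScSplitting c 𝒮₁ X (LinearMap.ker (φ x₀)))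
    (σ₂ : ScSplitting c 𝒮₂ (LinearMap.range (φ x₀)) C)
    (h : CompressionInvertibleNear c 𝒮 𝒮₁ 𝒮₂ U φ x₀ X σ₂) :
    ∃ V : Set E, IsOpen V ∧ x₀ ∈ V ∧ V ⊆ U ∧
      ∃ (ψ : E → E₂ →ₗ[𝕜] E₁) (κ : E → E₁ →ₗ[𝕜] E₁) (κ' : E → E₂ →ₗ[𝕜] E₂),
        IsScFamily c 𝒮 𝒮₂ 𝒮₁ V ψ ∧ IsStronglySmoothingFamily c 𝒮 𝒮₁ 𝒮₁ V κ ∧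
        IsStronglySmoothingFamily c 𝒮 𝒮₂ 𝒮₂ V κ' ∧
        ∀ x ∈ V, ψ x ∘ₗ φ x = LinearMap.id + κ x ∧ φ x ∘ₗ ψ x = LinearMap.id + κ' x := by
  obtain ⟨W, hW, hx₀W, hWU, -, γ, hγ, hγinv⟩ := h
  obtain ⟨s, hs⟩ := h𝒮.nonempty
  obtain ⟨s₁, hs₁⟩ := h𝒮₁.nonempty
  obtain ⟨s₂, hs₂⟩ := h𝒮₂.nonempty
  have hX := h𝒮₁.subClass σ₁.isScSubspace_left
  have hR := h𝒮₂.subClass σ₂.isScSubspace_left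
  obtain ⟨rX, hrX⟩ := hX.nonempty
  obtain ⟨rR, hrR⟩ := hR.nonempty
  have := hF.finiteDimensional_ker h𝒮₁
  obtain ⟨P, -, hPfin, hPker, -⟩ := hF.exists_projection h𝒮₂ hs₂
  have := σ₂.finiteDimensional_right hPker.le
  have hφ' := famNear_of_isScFamily h𝒮 h𝒮₁ h𝒮₂ hs hs₁ hs₂ hφ hx₀
  have hγ' := famNear_of_isScFamily h𝒮 hR hX hs hrR hrX hγ hx₀W
  have hψ : FamNear c s s₂ s₁ x₀ (fun x => X.subtype ∘ₗ γ x ∘ₗ σ₂.fst) :=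
    ((isMor_subtype h𝒮₁ hs₁ hrX).famNear s x₀).comp
      (hγ'.comp ((σ₂.isMor_fst h𝒮₂ hs₂ hrR).famNear s x₀))
  set ψ : E → E₂ →ₗ[𝕜] E₁ := fun x => X.subtype ∘ₗ γ x ∘ₗ σ₂.fst with hψ_def
  -- `ψ x ∘ φ x - id` vanishes on `X` because `γ x` inverts the compression. It therefore equals its
  -- composition with the finite-rank projection onto the kernel, which is smoothing.
  have hκ : SmoothNear c s s₁ s₁ x₀ (fun x => (ψ x ∘ₗ φ x + -LinearMap.id) ∘ₗ σ₁.sndEnd) :=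
    ((hψ.comp hφ').add ((IsMor.id c s₁).neg.famNear s x₀)).comp_smooth
      ((σ₁.isSmoothing_sndEnd h𝒮₁ hs₁).smoothNear c s x₀)
  -- Dually, `φ x ∘ ψ x - id` has no component in the range of `φ x₀`, so projecting it onto `C`
  -- does not change it.
  have hκ' : SmoothNear c s s₂ s₂ x₀ (fun x => σ₂.sndEnd ∘ₗ (φ x ∘ₗ ψ x + -LinearMap.id)) :=
    ((σ₂.isSmoothing_sndEnd h𝒮₂ hs₂).smoothNear c s x₀).comp_fam
      ((hφ'.comp hψ).add ((IsMor.id c s₂).neg.famNear s x₀))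
  obtain ⟨p, ⟨hp, hpW⟩, h1, h2, h3⟩ := ((s.eventually_ball_subset (hW.mem_nhds hx₀W)).and
    ((hψ.eventually_isScFamily h𝒮 h𝒮₂ hs hs₂ hs₁).and
      ((hκ.eventually_isStronglySmoothingFamily h𝒮 h𝒮₁ hs hs₁ hs₁).and
        (hκ'.eventually_isStronglySmoothingFamily h𝒮 h𝒮₂ hs hs₂ hs₂)))).exists
  refine ⟨_, s.isOpen_ball p.1 x₀ p.2, hp, hpW.trans hWU, _, _, _, h1, h2, h3, fun x hx => ?_⟩
  have hleft : ∀ u : X, γ x (σ₂.fst (φ x u)) = u := LinearMap.congr_fun (hγinv x (hpW hx)).1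
  have hright : ∀ v, σ₂.fst (φ x (γ x v)) = v := LinearMap.congr_fun (hγinv x (hpW hx)).2
  constructor
  · refine LinearMap.ext fun e => ?_
    have h4 := σ₁.fst_add_sndEnd e
    have h5 : ψ x (φ x (σ₁.fst e)) = σ₁.fst e := congrArg Subtype.val (hleft _)
    have h6 : ψ x (φ x e) = σ₁.fst e + ψ x (φ x (σ₁.sndEnd e)) := by
      conv_lhs => rw [← h4, map_add, map_add, h5]
    change ψ x (φ x e) = e + (ψ x (φ x (σ₁.sndEnd e)) + -σ₁.sndEnd e)
    rw [h6, eq_sub_of_add_eq h4]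
    abel
  · refine LinearMap.ext fun e => ?_
    have h4 := σ₂.fst_add_sndEnd (φ x (ψ x e) - e)
    have h5 : σ₂.fst (φ x (ψ x e) - e) = 0 := by
      rw [map_sub, sub_eq_zero]
      exact hright _
    rw [h5, Submodule.coe_zero, zero_add] at h4
    change φ x (ψ x e) = e + σ₂.sndEnd (φ x (ψ x e) + -e)
    rw [← sub_eq_add_neg, h4, add_sub_cancel]

/-- A parametrix near `x₀` makes every compression to complements of the kernel and the cokernel
invertible near `x₀`. -/
theorem compressionInvertibleNear_of_parametrix (h𝒮 : IsScClass c 𝒮) (h𝒮₁ : IsScClass c 𝒮₁)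
    (h𝒮₂ : IsScClass c 𝒮₂) (hs : s ∈ 𝒮) (hs₁ : s₁ ∈ 𝒮₁) (hs₂ : s₂ ∈ 𝒮₂) (hU : U ∈ 𝓝 x₀)
    (hF : IsFredholmMorphism c 𝒮₁ 𝒮₂ (φ x₀)) (hφ : FamNear c s s₁ s₂ x₀ φ)
    {ψ : E → E₂ →ₗ[𝕜] E₁} {κ : E → E₁ →ₗ[𝕜] E₁} {κ' : E → E₂ →ₗ[𝕜] E₂}
    (hψ : FamNear c s s₂ s₁ x₀ ψ) (hκ : SmoothNear c s s₁ s₁ x₀ κ)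
    (hκ' : SmoothNear c s s₂ s₂ x₀ κ')
    (h : ∀ᶠ x in 𝓝 x₀, ψ x ∘ₗ φ x = LinearMap.id + κ x ∧ φ x ∘ₗ ψ x = LinearMap.id + κ' x)
    {X : Submodule 𝕜 E₁} {C : Submodule 𝕜 E₂}
    (σ₁ : ScSplitting c 𝒮₁ X (LinearMap.ker (φ x₀)))
    (σ₂ : ScSplitting c 𝒮₂ (LinearMap.range (φ x₀)) C) :
    CompressionInvertibleNear c 𝒮 𝒮₁ 𝒮₂ U φ x₀ X σ₂ := by
  have hX := h𝒮₁.subClass σ₁.isScSubspace_left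
  have hR := h𝒮₂.subClass σ₂.isScSubspace_left
  obtain ⟨rX, hrX⟩ := hX.nonempty
  obtain ⟨rR, hrR⟩ := hR.nonempty
  have := hF.finiteDimensional_ker h𝒮₁
  obtain ⟨P, -, hPfin, hPker, -⟩ := hF.exists_projection h𝒮₂ hs₂
  have := σ₂.finiteDimensional_right hPker.le
  have hιX := (isMor_subtype h𝒮₁ hs₁ hrX).famNear s x₀
  have hιR := (isMor_subtype h𝒮₂ hs₂ hrR).famNear s x₀
  have hpX := (σ₁.isMor_fst h𝒮₁ hs₁ hrX).famNear s x₀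
  have hpR := (σ₂.isMor_fst h𝒮₂ hs₂ hrR).famNear s x₀
  have hQ₁ := (σ₁.isSmoothing_sndEnd h𝒮₁ hs₁).smoothNear c s x₀
  have hQ₂ := (σ₂.isSmoothing_sndEnd h𝒮₂ hs₂).smoothNear c s x₀
  have hA := hpR.comp (hφ.comp hιX)
  have hB := hpX.comp (hψ.comp hιR)
  -- Inserting the projection onto the range between `ψ x` and `φ x` costs a term that contains the
  -- smoothing projection onto `C`. The error of the compressed parametrix is thus the compressed
  -- `κ` minus this term; `hκR` is the mirror image, with the projection onto the kernel.
  have hκX := (hpX.comp_smooth (hκ.comp_fam hιX)).add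
    (hpX.comp_smooth (hψ.comp_smooth (hQ₂.comp_fam (hφ.comp hιX)))).neg
  have hκR := (hpR.comp_smooth (hκ'.comp_fam hιR)).add
    (hpR.comp_smooth (hφ.comp_smooth (hQ₁.comp_fam (hψ.comp hιR)))).neg
  -- At `x₀` the projection onto the range does nothing, and the compression is the bijection from a
  -- complement of the kernel onto the range.
  have hbij : Function.Bijective (σ₂.fst ∘ₗ φ x₀ ∘ₗ X.subtype) := by
    have hval : ∀ u : X, (σ₂.fst (φ x₀ u) : E₂) = φ x₀ u := fun u =>
      congrArg Subtype.val (σ₂.fst_coe ⟨φ x₀ u, u, rfl⟩)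
    constructor
    · refine LinearMap.ker_eq_bot.1 (LinearMap.ker_eq_bot'.2 fun u hu => ?_)
      have h1 : φ x₀ u = 0 := by rw [← hval]; exact congrArg Subtype.val hu
      exact Subtype.ext (σ₁.eq_zero_of_mem u.2 h1)
    · rintro ⟨_, e, rfl⟩
      refine ⟨σ₁.fst e, Subtype.ext ((hval _).trans ?_)⟩
      have h1 : φ x₀ (σ₁.sndEnd e) = 0 := σ₁.sndEnd_mem e
      change _ = φ x₀ e
      conv_rhs => rw [← σ₁.fst_add_sndEnd e, map_add, h1, add_zero]
  obtain ⟨γ, hγ, hinv⟩ := hA.exists_inverse hB hκX hκR (h.mono fun x hx => by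
    constructor
    · refine LinearMap.ext fun u => ?_
      have h1 : (σ₂.fst (φ x u) : E₂) = φ x u - σ₂.sndEnd (φ x u) :=
        eq_sub_of_add_eq (σ₂.fst_add_sndEnd _)
      have h2 : ψ x (φ x u) = u + κ x u := LinearMap.congr_fun hx.1 u
      change σ₁.fst (ψ x (σ₂.fst (φ x u))) =
        u + (σ₁.fst (κ x u) + -σ₁.fst (ψ x (σ₂.sndEnd (φ x u))))
      rw [h1, map_sub, map_sub, h2, map_add, σ₁.fst_coe]
      abel
    · refine LinearMap.ext fun v => ?_
      have h1 : (σ₁.fst (ψ x v) : E₁) = ψ x v - σ₁.sndEnd (ψ x v) :=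
        eq_sub_of_add_eq (σ₁.fst_add_sndEnd _)
      have h2 : φ x (ψ x v) = v + κ' x v := LinearMap.congr_fun hx.2 v
      change σ₂.fst (φ x (σ₁.fst (ψ x v))) =
        v + (σ₂.fst (κ' x v) + -σ₂.fst (φ x (σ₁.sndEnd (ψ x v))))
      rw [h1, map_sub, map_sub, h2, map_add, σ₂.fst_coe]
      abel) hbij
  obtain ⟨p, ⟨hp, hpU⟩, h1, h2⟩ := ((s.eventually_ball_subset (inter_mem hU hinv)).and
    ((hA.eventually_isScFamily h𝒮 hX hs hrX hrR).and
      (hγ.eventually_isScFamily h𝒮 hR hs hrR hrX))).exists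
  exact ⟨_, s.isOpen_ball p.1 x₀ p.2, hp, fun x hx => (hpU hx).1, h1, γ, h2,
    fun x hx => (hpU hx).2⟩

end

/-! ### The equivalence. -/

theorem theorem4p1 {𝕜 : Type w} [RCLike 𝕜]
    {E : Type u} [AddCommGroup E] [Module 𝕜 E] [TopologicalSpace E] [IsTopologicalAddGroup E]
    [ContinuousSMul 𝕜 E]
    {E₁ : Type u₁} [AddCommGroup E₁] [Module 𝕜 E₁] [TopologicalSpace E₁]
    [IsTopologicalAddGroup E₁] [ContinuousSMul 𝕜 E₁]
    {E₂ : Type u₂} [AddCommGroup E₂] [Module 𝕜 E₂] [TopologicalSpace E₂]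
    [IsTopologicalAddGroup E₂] [ContinuousSMul 𝕜 E₂]
    (c : ScContext) (𝒮 : Set (ScStructure 𝕜 E)) (𝒮₁ : Set (ScStructure 𝕜 E₁))
    (𝒮₂ : Set (ScStructure 𝕜 E₂)) (h𝒮 : IsScClass c 𝒮) (h𝒮₁ : IsScClass c 𝒮₁)
    (h𝒮₂ : IsScClass c 𝒮₂) (U : Set E) (hU : IsOpen U) (φ : E → E₁ →ₗ[𝕜] E₂)
    (hφ : IsScFamily c 𝒮 𝒮₁ 𝒮₂ U φ) :
    List.TFAE [
      IsFredholmFamily c 𝒮 𝒮₁ 𝒮₂ U φ,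
      ∀ x₀ ∈ U, IsFredholmMorphism c 𝒮₁ 𝒮₂ (φ x₀) ∧
        ∃ (X : Submodule 𝕜 E₁) (C : Submodule 𝕜 E₂)
          (_ : ScSplitting c 𝒮₁ X (LinearMap.ker (φ x₀)))
          (σ₂ : ScSplitting c 𝒮₂ (LinearMap.range (φ x₀)) C),
          CompressionInvertibleNear c 𝒮 𝒮₁ 𝒮₂ U φ x₀ X σ₂,
      ∀ x₀ ∈ U, IsFredholmMorphism c 𝒮₁ 𝒮₂ (φ x₀) ∧
        ∀ (X : Submodule 𝕜 E₁) (C : Submodule 𝕜 E₂)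
          (_ : ScSplitting c 𝒮₁ X (LinearMap.ker (φ x₀)))
          (σ₂ : ScSplitting c 𝒮₂ (LinearMap.range (φ x₀)) C),
          CompressionInvertibleNear c 𝒮 𝒮₁ 𝒮₂ U φ x₀ X σ₂] := by
  tfae_have 1 → 3 := by
    intro h x₀ hx₀
    obtain ⟨V, hV, hx₀V, -, ψ, κ, κ', hψ, hκ, hκ', hinv⟩ := h x₀ hx₀
    obtain ⟨s, hs⟩ := h𝒮.nonempty
    obtain ⟨s₁, hs₁⟩ := h𝒮₁.nonempty
    obtain ⟨s₂, hs₂⟩ := h𝒮₂.nonempty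
    have hφ' := ScStructure.famNear_of_isScFamily h𝒮 h𝒮₁ h𝒮₂ hs hs₁ hs₂ hφ hx₀
    have hψ' := ScStructure.famNear_of_isScFamily h𝒮 h𝒮₂ h𝒮₁ hs hs₂ hs₁ hψ hx₀V
    have hκ₁ := ScStructure.smoothNear_of_isStronglySmoothingFamily h𝒮 h𝒮₁ h𝒮₁ hs hs₁ hs₁ hκ hx₀V
    have hκ₂ := ScStructure.smoothNear_of_isStronglySmoothingFamily h𝒮 h𝒮₂ h𝒮₂ hs hs₂ hs₂ hκ' hx₀V
    have hF : IsFredholmMorphism c 𝒮₁ 𝒮₂ (φ x₀) :=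
      ⟨(isScMorphism_iff h𝒮₁ h𝒮₂ hs₁ hs₂).2 hφ'.isMor, ψ x₀, κ x₀, κ' x₀,
        (isScMorphism_iff h𝒮₂ h𝒮₁ hs₂ hs₁).2 hψ'.isMor,
        (isStronglySmoothingMorphism_iff h𝒮₁ h𝒮₁ hs₁ hs₁).2 hκ₁.isSmoothing,
        (isStronglySmoothingMorphism_iff h𝒮₂ h𝒮₂ hs₂ hs₂).2 hκ₂.isSmoothing, hinv x₀ hx₀V⟩
    exact ⟨hF, fun X C σ₁ σ₂ => compressionInvertibleNear_of_parametrix h𝒮 h𝒮₁ h𝒮₂ hs hs₁ hs₂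
      (hU.mem_nhds hx₀) hF hφ' hψ' hκ₁ hκ₂ (eventually_of_mem (hV.mem_nhds hx₀V) hinv) σ₁ σ₂⟩
  tfae_have 3 → 2 := by
    intro h x₀ hx₀
    obtain ⟨hF, h⟩ := h x₀ hx₀
    obtain ⟨⟨X, ⟨σ₁⟩⟩, C, ⟨σ₂⟩⟩ := hF.exists_scSplitting h𝒮₁ h𝒮₂
    exact ⟨hF, X, C, σ₁, σ₂, h X C σ₁ σ₂⟩
  tfae_have 2 → 1 := by
    intro h x₀ hx₀
    obtain ⟨hF, X, C, σ₁, σ₂, h⟩ := h x₀ hx₀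
    exact exists_parametrix_of_compressionInvertibleNear h𝒮 h𝒮₁ h𝒮₂ hφ hx₀ hF σ₁ σ₂ h
  tfae_finish
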